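/- Let $\gamma\in\mathbb R$, $N\in\mathbb Z_{\ge 0}$, and let $J=[x^+,x^-]\subset\mathbb R$ be a bounded interval with $x^+<x^-$. *Wavefunctions.* For $f\in\mathscr C(\mathbb R^N)$ and $j\neq k$ put $(I_{jk}f)(\boldsymbol x)=\int_0^{x_j-x_k}f(\boldsymbol x-y(\boldsymbol e_j-\boldsymbol e_k))\,dy$. Let $S_N$ act by $(wf)(\boldsymbol x)=f(w^{-1}\boldsymbol x)$, where $(w\boldsymbol x)_j=x_{w^{-1}(j)}$; let $s_j$ be the transposition of $j,j+1$ and $s_j^\gamma=s_j+\gamma I_{j\,j+1}$. For $w=s_{i_1}\cdots s_{i_l}\in S_N$ put $w^\gamma=s_{i_1}^\gamma\cdots s_{i_l}^\gamma$ (this does not depend on the decomposition). For $\boldsymbol\lambda\in\mathbb C^N$ the non-symmetric wavefunction $\psi_{\boldsymbol\lambda}$ is the continuous function on $\mathbb R^N$ that equals $w^{-1}w^\gamma e^{i\boldsymbol\lambda}$ on $w^{-1}\mathbb R^N_+$ for every $w\in S_N$, where $e^{i\boldsymbol\lambda}(\boldsymbol x)=e^{i\sum_j\lambda_jx_j}$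 and $\mathbb R^N_+=\{x_1>\dots>x_N\}$. Let $\mathfrak h_N=L^2(J^N)$ and $$\bar{\mathfrak z}_N=\overline{\operatorname{span}\{\psi_{\boldsymbol\lambda}|_{J^N}:\boldsymbol\lambda\in\mathbb C^N\}}\subset\mathfrak h_N .$$ *Operators.* For $0\le n\le N$ let $\mathfrak i^n$ be the set of $n$-tuples $\boldsymbol i=(i_1,\dots,i_n)$ of distinct elements of $\{1,\dots,N\}$. For $\boldsymbol z\in\mathbb R^N$ write $\boldsymbol z[\boldsymbol i;y_1,\dots,y_n]$ for $\boldsymbol z$ with $z_{i_m}$ replaced by $y_m$ for $m=1,\dots,n$. Let $\mu\in\mathbb C$. For $f\in\mathfrak h_N$ and $\boldsymbol x\in J^{N+1}$ define $$(\hat e^+_{\mu;\boldsymbol i}f)(\boldsymbol x)=e^{i\mu x_1}\Big(\prod_{m=1}^n\int_{p_{m+1}}^{p_m}dy_m\,e^{i\mu(p_m-y_m)}\Big)f\big((x_2,\dots,x_{N+1})[\boldsymbol i;y_1,\dots,y_n]\big)$$ if $p_1>\dots>p_{n+1}$, and $0$ otherwise, where $p_m=x_{i_m+1}$ for $1\le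 m\le n$ and $p_{n+1}=x_1$; and $$(\hat e^-_{\mu;\boldsymbol i}f)(\boldsymbol x)=e^{i\mu x_{N+1}}\Big(\prod_{m=1}^n\int_{q_m}^{q_{m-1}}dy_m\,e^{i\mu(q_m-y_m)}\Big)f\big((x_1,\dots,x_N)[\boldsymbol i;y_1,\dots,y_n]\big)$$ if $q_0>\dots>q_n$, and $0$ otherwise, where $q_0=x_{N+1}$ and $q_m=x_{i_m}$ for $1\le m\le n$. For $f\in\mathfrak h_{N+1}$ and $\boldsymbol x\in J^N$, with $x_{i_0}:=x^-$ and $x_{i_{n+1}}:=x^+$, define $$(\check e^+_{\mu;\boldsymbol i}f)(\boldsymbol x)=e^{i\mu x^+}\Big(\prod_{m=0}^n\int_{x_{i_{m+1}}}^{x_{i_m}}dy_m\,e^{i\mu(x_{i_m}-y_m)}\Big)f\big(\boldsymbol x[\boldsymbol i;y_1,\dots,y_n],\,y_0\big),$$ $$(\check e^-_{\mu;\boldsymbol i}f)(\boldsymbol x)=e^{i\mu x^-}\Big(\prod_{m=1}^{n+1}\int_{x_{i_m}}^{x_{i_{m-1}}}dy_m\,e^{i\mu(x_{i_m}-y_m)}\Big)f\big(y_{n+1},\,\boldsymbol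 x[\boldsymbol i;y_1,\dots,y_n]\big)$$ if $x_{i_1}>\dots>x_{i_n}$ (no condition if $n\le1$), and $0$ otherwise. The bounded operators $b^\pm_\mu:\mathfrak h_N\to\mathfrak h_{N+1}$ and $c^\pm_\mu:\mathfrak h_{N+1}\to\mathfrak h_N$ are $$b^\pm_\mu=\sum_{n=0}^N\gamma^n\sum_{\boldsymbol i\in\mathfrak i^n}\hat e^\pm_{\mu;\boldsymbol i},\qquad c^\pm_\mu=\sum_{n=0}^N\gamma^{n+1}\sum_{\boldsymbol i\in\mathfrak i^n}\check e^\pm_{\mu;\boldsymbol i}.$$ **Theorem.** Let $\mu,\nu\in\mathbb C$. 1. $b^+_\mu$ and $b^-_\nu$ map $\bar{\mathfrak z}_N$ into $\bar{\mathfrak z}_{N+1}$, the products $b^+_\mu b^-_\nu$ and $b^-_\nu b^+_\mu$ map $\bar{\mathfrak z}_N$ into $\bar{\mathfrak z}_{N+2}$, and $[b^+_\mu,b^-_\nu]=0$ on $\bar{\mathfrak z}_N$. 2. $c^+_\mu$ and $c^-_\nu$ map $\bar{\mathfrak z}_{N+2}$ into $\bar{\mathfrak z}_{N+1}$, the products $c^+_\mu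 c^-_\nu$ and $c^-_\nu c^+_\mu$ map $\bar{\mathfrak z}_{N+2}$ into $\bar{\mathfrak z}_N$, and $[c^+_\mu,c^-_\nu]=0$ on $\bar{\mathfrak z}_{N+2}$. -/

import Mathlib

open MeasureTheory

namespace QNLS

noncomputable section

/-! ### Non-symmetric wavefunctions -/

/-- The operator `(I_{jk} f)(x) = ∫_0^{x_j - x_k} f(x - y (e_j - e_k)) dy`. -/
def integralOp {N : ℕ} (j k : Fin N) (f : (Fin N → ℝ) → ℂ) (x : Fin N → ℝ) : ℂ :=
  ∫ y in (0 : ℝ)..(x j - x k), f (x - y • (Pi.single j 1 - Pi.single k 1))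

/-- The integral-reflection operator `s_{jk} + γ I_{jk}`. -/
def intReflection {N : ℕ} (γ : ℝ) (j k : Fin N) (f : (Fin N → ℝ) → ℂ) (x : Fin N → ℝ) : ℂ :=
  f (x ∘ Equiv.swap j k) + γ * integralOp j k f x

/-- The smaller of the two labels moved by the `j`-th simple transposition of `S_N`. -/
def leftLabel {N : ℕ} (j : Fin (N - 1)) : Fin N := ⟨j, by omega⟩

/-- The larger of the two labels moved by the `j`-th simple transposition of `S_N`. -/
def rightLabel {N : ℕ} (j : Fin (N - 1)) : Fin N := ⟨j + 1, by omega⟩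

/-- The `j`-th simple transposition of `S_N`. -/
def simpleTransposition {N : ℕ} (j : Fin (N - 1)) : Equiv.Perm (Fin N) :=
  Equiv.swap (leftLabel j) (rightLabel j)

theorem exists_word {N : ℕ} (w : Equiv.Perm (Fin N)) :
    ∃ l : List (Fin (N - 1)), (l.map simpleTransposition).prod = w := by
  cases N with
  | zero => exact ⟨[], Subsingleton.elim _ _⟩
  | succ n =>
    have h : w ∈ Submonoid.closure
        (Set.range fun i : Fin n => Equiv.swap i.castSucc i.succ) := by
      rw [Equiv.Perm.mclosure_swap_castSucc_succ]; trivial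
    obtain ⟨l, hl, rfl⟩ := Submonoid.exists_list_of_mem_closure h
    clear h
    induction l with
    | nil => exact ⟨[], rfl⟩
    | cons a l ih =>
      obtain ⟨l', hl'⟩ := ih fun y hy => hl y (List.mem_cons_of_mem _ hy)
      obtain ⟨i, hi⟩ := hl a List.mem_cons_self
      refine ⟨i :: l', ?_⟩
      rw [List.map_cons, List.prod_cons, List.prod_cons, hl', ← hi]
      rfl

/-- A decomposition of `w` as a product of simple transpositions. -/
def word {N : ℕ} (w : Equiv.Perm (Fin N)) : List (Fin (N - 1)) := (exists_word w).choose

/-- The integral representation `w^γ = s_{i_1}^γ ⋯ s_{i_l}^γ` for `w = s_{i_1} ⋯ s_{i_l}`; since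
the `s_j^γ` satisfy the defining relations of `S_N`, the decomposition does not matter. -/
def intRepr {N : ℕ} (γ : ℝ) (w : Equiv.Perm (Fin N)) (f : (Fin N → ℝ) → ℂ) :
    (Fin N → ℝ) → ℂ :=
  (word w).foldr (fun j g => intReflection γ (leftLabel j) (rightLabel j) g) f

/-- A permutation `σ` with `x_{σ 1} ≥ x_{σ 2} ≥ ⋯ ≥ x_{σ N}`. For regular `x` it is the unique
`σ = w⁻¹` such that `x` lies in the alcove `w⁻¹ {x_1 > ⋯ > x_N}`. -/
def sortDesc {N : ℕ} (x : Fin N → ℝ) : Equiv.Perm (Fin N) := Tuple.sort fun j => -x j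

/-- The propagation operator: it is `w⁻¹ w^γ f` on the alcove `w⁻¹ {x_1 > ⋯ > x_N}`, where
`(w f)(x) = f(w⁻¹ x)` and `(w x)_j = x_{w⁻¹ j}`, so that `(w⁻¹ g)(x) = g(x ∘ w⁻¹)`. On the walls
it takes the value given by the formula of an adjacent closed alcove. -/
def propagation {N : ℕ} (γ : ℝ) (f : (Fin N → ℝ) → ℂ) (x : Fin N → ℝ) : ℂ :=
  intRepr γ (sortDesc x)⁻¹ f (x ∘ sortDesc x)

/-- The plane wave with wavevector `lam`. -/
def planeWave {N : ℕ} (lam : Fin N → ℂ) (x : Fin N → ℝ) : ℂ :=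
  Complex.exp (Complex.I * ∑ j, lam j * (x j : ℂ))

/-- The non-symmetric wavefunction. -/
def psi {N : ℕ} (γ : ℝ) (lam : Fin N → ℂ) : (Fin N → ℝ) → ℂ :=
  propagation γ (planeWave lam)

/-! ### The operators on functions -/

/-- For `p = (p_0, …, p_n)`, the box `∏_{m=1}^n (p_m, p_{m-1}]`. -/
def segBox {n : ℕ} (p : Fin (n + 1) → ℝ) : Set (Fin n → ℝ) :=
  Set.univ.pi fun m => Set.Ioc (p m.succ) (p m.castSucc)

/-- The tuple `(x_{i_1 + 1}, …, x_{i_n + 1}, x_1)`. -/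
def bPlusChain {N n : ℕ} (i : Fin n ↪ Fin N) (x : Fin (N + 1) → ℝ) : Fin (n + 1) → ℝ :=
  Fin.snoc (α := fun _ => ℝ) (fun m => x (i m).succ) (x 0)

/-- The tuple `(x_{N+1}, x_{i_1}, …, x_{i_n})`. -/
def bMinusChain {N n : ℕ} (i : Fin n ↪ Fin N) (x : Fin (N + 1) → ℝ) : Fin (n + 1) → ℝ :=
  Fin.cons (α := fun _ => ℝ) (x (Fin.last N)) (fun m => x (i m).castSucc)

/-- The tuple `(x⁻, x_{i_1}, …, x_{i_n}, x⁺)`. -/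
def cChain (xp xm : ℝ) {N n : ℕ} (i : Fin n ↪ Fin N) (x : Fin N → ℝ) : Fin (n + 2) → ℝ :=
  Fin.cons (α := fun _ => ℝ) xm (Fin.snoc (α := fun _ => ℝ) (fun m => x (i m)) xp)

open Classical in
/-- Elementary creation operator `ê⁺_{μ;i}`: a new particle is added at the first position.
`Function.extend i y z` is `z` with `z_{i_m}` replaced by `y_m`. -/
def eHatPlus (μ : ℂ) {N n : ℕ} (i : Fin n ↪ Fin N) (f : (Fin N → ℝ) → ℂ)
    (x : Fin (N + 1) → ℝ) : ℂ :=
  if StrictAnti (bPlusChain i x) then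
    Complex.exp (Complex.I * μ * x 0) *
      ∫ y in segBox (bPlusChain i x),
        (∏ m, Complex.exp (Complex.I * μ * (x (i m).succ - y m))) *
          f (Function.extend i y fun j => x j.succ)
  else 0

open Classical in
/-- Elementary creation operator `ê⁻_{μ;i}`: a new particle is added at the last position. -/
def eHatMinus (μ : ℂ) {N n : ℕ} (i : Fin n ↪ Fin N) (f : (Fin N → ℝ) → ℂ)
    (x : Fin (N + 1) → ℝ) : ℂ :=
  if StrictAnti (bMinusChain i x) then
    Complex.exp (Complex.I * μ * x (Fin.last N)) *
      ∫ y in segBox (bMinusChain i x),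
        (∏ m, Complex.exp (Complex.I * μ * (x (i m).castSucc - y m))) *
          f (Function.extend i y fun j => x j.castSucc)
  else 0

open Classical in
/-- Elementary annihilation operator `ě⁺_{μ;i}`; the integration variables are `y_0, …, y_n` with
`y_m` between `x_{i_{m+1}}` and `x_{i_m}`, where `x_{i_0} = x⁻` and `x_{i_{n+1}} = x⁺`. -/
def eCheckPlus (xp xm : ℝ) (μ : ℂ) {N n : ℕ} (i : Fin n ↪ Fin N) (f : (Fin (N + 1) → ℝ) → ℂ)
    (x : Fin N → ℝ) : ℂ :=
  if StrictAnti (fun m => x (i m)) then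
    Complex.exp (Complex.I * μ * xp) *
      ∫ y in segBox (cChain xp xm i x),
        (∏ m : Fin (n + 1), Complex.exp (Complex.I * μ * (cChain xp xm i x m.castSucc - y m))) *
          f (Fin.snoc (α := fun _ => ℝ) (Function.extend i (fun m => y m.succ) x) (y 0))
  else 0

open Classical in
/-- Elementary annihilation operator `ě⁻_{μ;i}`; the integration variables are `y_1, …, y_{n+1}`
with `y_m` between `x_{i_m}` and `x_{i_{m-1}}`, where `x_{i_0} = x⁻` and `x_{i_{n+1}} = x⁺`. -/
def eCheckMinus (xp xm : ℝ) (μ : ℂ) {N n : ℕ} (i : Fin n ↪ Fin N) (f : (Fin (N + 1) → ℝ) → ℂ)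
    (x : Fin N → ℝ) : ℂ :=
  if StrictAnti (fun m => x (i m)) then
    Complex.exp (Complex.I * μ * xm) *
      ∫ y in segBox (cChain xp xm i x),
        (∏ m : Fin (n + 1), Complex.exp (Complex.I * μ * (cChain xp xm i x m.succ - y m))) *
          f (Fin.cons (α := fun _ => ℝ) (y (Fin.last n))
            (Function.extend i (fun m => y m.castSucc) x))
  else 0

/-- `b⁺_μ` on functions. -/
def bPlusFun (γ : ℝ) (μ : ℂ) {N : ℕ} (f : (Fin N → ℝ) → ℂ) : (Fin (N + 1) → ℝ) → ℂ :=
  ∑ n ∈ Finset.range (N + 1), ((γ : ℂ) ^ n) • ∑ i : Fin n ↪ Fin N, eHatPlus μ i f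

/-- `b⁻_μ` on functions. -/
def bMinusFun (γ : ℝ) (μ : ℂ) {N : ℕ} (f : (Fin N → ℝ) → ℂ) : (Fin (N + 1) → ℝ) → ℂ :=
  ∑ n ∈ Finset.range (N + 1), ((γ : ℂ) ^ n) • ∑ i : Fin n ↪ Fin N, eHatMinus μ i f

/-- `c⁺_μ` on functions. -/
def cPlusFun (γ xp xm : ℝ) (μ : ℂ) {N : ℕ} (f : (Fin (N + 1) → ℝ) → ℂ) : (Fin N → ℝ) → ℂ :=
  ∑ n ∈ Finset.range (N + 1),
    ((γ : ℂ) ^ (n + 1)) • ∑ i : Fin n ↪ Fin N, eCheckPlus xp xm μ i f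

/-- `c⁻_μ` on functions. -/
def cMinusFun (γ xp xm : ℝ) (μ : ℂ) {N : ℕ} (f : (Fin (N + 1) → ℝ) → ℂ) : (Fin N → ℝ) → ℂ :=
  ∑ n ∈ Finset.range (N + 1),
    ((γ : ℂ) ^ (n + 1)) • ∑ i : Fin n ↪ Fin N, eCheckMinus xp xm μ i f

/-! ### The `N`-particle sectors -/

/-- The cube `J^N` with `J = [x⁺, x⁻]`. -/
def cube (xp xm : ℝ) (N : ℕ) : Set (Fin N → ℝ) := Set.univ.pi fun _ => Set.Icc xp xm

/-- Lebesgue measure on the cube `J^N`. -/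
abbrev cubeMeasure (xp xm : ℝ) (N : ℕ) : Measure (Fin N → ℝ) :=
  volume.restrict (cube xp xm N)

/-- The `N`-particle sector `L²(J^N)`. -/
abbrev Sector (xp xm : ℝ) (N : ℕ) : Type := Lp ℂ 2 (cubeMeasure xp xm N)

/-! ### From operators on functions to bounded operators on `L²` -/

/-- The operator `T` on functions induces a bounded linear operator `L²(ρ) → L²(μ)`. -/
structure IsL2Bounded {α β : Type*} [MeasurableSpace α] [MeasurableSpace β]
    (ρ : Measure α) (μ : Measure β) (T : (α → ℂ) → β → ℂ) : Prop where
  congr : ∀ f g, f =ᵐ[ρ] g → T f =ᵐ[μ] T g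
  memLp : ∀ f, MemLp f 2 ρ → MemLp (T f) 2 μ
  add : ∀ f g, MemLp f 2 ρ → MemLp g 2 ρ → T (f + g) =ᵐ[μ] T f + T g
  smul : ∀ (c : ℂ) f, MemLp f 2 ρ → T (c • f) =ᵐ[μ] c • T f
  bound : ∃ C : NNReal, ∀ f, MemLp f 2 ρ → eLpNorm (T f) 2 μ ≤ C * eLpNorm f 2 ρ

/-- The bounded operator `L²(ρ) → L²(μ)` that sends the class of `f` to the class of `T f`. -/
def liftL2 {α β : Type*} [MeasurableSpace α] [MeasurableSpace β] {ρ : Measure α} {μ : Measure β}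
    (T : (α → ℂ) → β → ℂ) (hT : IsL2Bounded ρ μ T) : Lp ℂ 2 ρ →L[ℂ] Lp ℂ 2 μ :=
  LinearMap.mkContinuousOfExistsBound
    { toFun := fun f => (hT.memLp f (Lp.memLp f)).toLp (T f)
      map_add' := fun f g => by
        rw [← MemLp.toLp_add]
        refine MemLp.toLp_congr _ _ ?_
        exact (hT.congr _ _ (Lp.coeFn_add f g)).trans (hT.add _ _ (Lp.memLp f) (Lp.memLp g))
      map_smul' := fun c f => by
        rw [RingHom.id_apply, ← MemLp.toLp_const_smul]
        refine MemLp.toLp_congr _ _ ?_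
        exact (hT.congr _ _ (Lp.coeFn_smul c f)).trans (hT.smul _ _ (Lp.memLp f)) }
    (by
      obtain ⟨C, hC⟩ := hT.bound
      refine ⟨C, fun f => ?_⟩
      simp only [LinearMap.coe_mk, AddHom.coe_mk, Lp.norm_toLp]
      rw [Lp.norm_def, ← ENNReal.coe_toReal, ← ENNReal.toReal_mul]
      exact ENNReal.toReal_mono
        (ENNReal.mul_ne_top ENNReal.coe_ne_top (Lp.eLpNorm_ne_top f)) (hC f (Lp.memLp f)))

theorem IsL2Bounded.zero {α β : Type*} [MeasurableSpace α] [MeasurableSpace β]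
    {ρ : Measure α} {μ : Measure β} : IsL2Bounded ρ μ (fun _ => (0 : β → ℂ)) where
  congr _ _ _ := Filter.EventuallyEq.rfl
  memLp _ _ := by simp
  add _ _ _ _ := by simp
  smul _ _ _ := by simp
  bound := ⟨0, fun _ _ => by simp⟩

theorem IsL2Bounded.add_op {α β : Type*} [MeasurableSpace α] [MeasurableSpace β]
    {ρ : Measure α} {μ : Measure β} {S T : (α → ℂ) → β → ℂ}
    (hS : IsL2Bounded ρ μ S) (hT : IsL2Bounded ρ μ T) :
    IsL2Bounded ρ μ (fun f => S f + T f) where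
  congr f g h := (hS.congr f g h).add (hT.congr f g h)
  memLp f h := (hS.memLp f h).add (hT.memLp f h)
  add f g hf hg := by
    filter_upwards [hS.add f g hf hg, hT.add f g hf hg] with x h1 h2
    simp only [Pi.add_apply] at h1 h2 ⊢
    rw [h1, h2]; ring
  smul c f hf := by
    filter_upwards [hS.smul c f hf, hT.smul c f hf] with x h1 h2
    simp only [Pi.add_apply, Pi.smul_apply] at h1 h2 ⊢
    rw [h1, h2, smul_add]
  bound := by
    obtain ⟨C, hC⟩ := hS.bound
    obtain ⟨D, hD⟩ := hT.bound
    refine ⟨C + D, fun f hf => ?_⟩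
    refine (eLpNorm_add_le (hS.memLp f hf).1 (hT.memLp f hf).1 (by norm_num)).trans ?_
    rw [ENNReal.coe_add, add_mul]
    exact add_le_add (hC f hf) (hD f hf)

theorem IsL2Bounded.smul_op {α β : Type*} [MeasurableSpace α] [MeasurableSpace β]
    {ρ : Measure α} {μ : Measure β} {T : (α → ℂ) → β → ℂ} (a : ℂ)
    (hT : IsL2Bounded ρ μ T) : IsL2Bounded ρ μ (fun f => a • T f) where
  congr f g h := (hT.congr f g h).const_smul a
  memLp f h := (hT.memLp f h).const_smul a
  add f g hf hg := by
    filter_upwards [hT.add f g hf hg] with x h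
    simp only [Pi.add_apply, Pi.smul_apply] at h ⊢
    rw [h, smul_add]
  smul c f hf := by
    filter_upwards [hT.smul c f hf] with x h
    simp only [Pi.smul_apply] at h ⊢
    rw [h, smul_comm]
  bound := by
    obtain ⟨C, hC⟩ := hT.bound
    refine ⟨‖a‖₊ * C, fun f hf => ?_⟩
    rw [eLpNorm_const_smul, ENNReal.coe_mul, mul_assoc]
    exact mul_le_mul' le_rfl (hC f hf)

theorem IsL2Bounded.sum_op {α β ι : Type*} [MeasurableSpace α] [MeasurableSpace β]
    {ρ : Measure α} {μ : Measure β} (s : Finset ι) (T : ι → (α → ℂ) → β → ℂ)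
    (hT : ∀ i, IsL2Bounded ρ μ (T i)) : IsL2Bounded ρ μ (fun f => ∑ i ∈ s, T i f) := by
  classical
  induction s using Finset.induction_on with
  | empty => simpa using IsL2Bounded.zero
  | insert a s ha ih =>
    simp only [Finset.sum_insert ha]
    exact (hT a).add_op ih

/-- Integral operators with bounded kernel `k` and a substitution `g` that does not concentrate
mass are bounded on `L²`. -/
theorem isL2Bounded_kernel {α β Y : Type*} [MeasurableSpace α] [MeasurableSpace β]
    [MeasurableSpace Y] {ρ : Measure α} {μ : Measure β} {ν : Measure Y}
    [IsFiniteMeasure μ] [IsFiniteMeasure ν]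
    (k : β × Y → ℂ) (hk : AEStronglyMeasurable k (μ.prod ν)) (M : ℝ)
    (hM : ∀ᵐ z ∂(μ.prod ν), ‖k z‖ ≤ M)
    (g : β × Y → α) (hg : Measurable g) (C : NNReal)
    (hC : (μ.prod ν).map g ≤ (C : ENNReal) • ρ)
    (T : (α → ℂ) → β → ℂ)
    (hT : ∀ᵐ x ∂μ, ∀ f, T f x = ∫ y, k (x, y) * f (g (x, y)) ∂ν) :
    IsL2Bounded ρ μ T := by
  have hqmp : Measure.QuasiMeasurePreserving g (μ.prod ν) ρ :=
    ⟨hg, (Measure.absolutelyContinuous_of_le hC).trans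
      (Measure.smul_absolutelyContinuous)⟩
  have hcomp : ∀ f : α → ℂ, MemLp f 2 ρ → MemLp (f ∘ g) 2 (μ.prod ν) := fun f hf =>
    (hf.of_measure_le_smul ENNReal.coe_ne_top hC).comp_of_map hg.aemeasurable
  have hF : ∀ f : α → ℂ, MemLp f 2 ρ → MemLp (fun z => k z * f (g z)) 2 (μ.prod ν) := fun f hf => by
    refine MemLp.of_le_mul (c := M) (hcomp f hf) (hk.mul (hcomp f hf).1) ?_
    filter_upwards [hM] with z hz
    rw [norm_mul]
    exact mul_le_mul_of_nonneg_right hz (norm_nonneg _)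
  have hint : ∀ f : α → ℂ, MemLp f 2 ρ → ∀ᵐ x ∂μ, Integrable (fun y => k (x, y) * f (g (x, y))) ν :=
    fun f hf => ((hF f hf).integrable (by norm_num)).prod_right_ae
  have hTe : ∀ f : α → ℂ, T f =ᵐ[μ] fun x => ∫ y, k (x, y) * f (g (x, y)) ∂ν := fun f => by
    filter_upwards [hT] with x hx using hx f
  have hmeas : ∀ f : α → ℂ, MemLp f 2 ρ → AEStronglyMeasurable (T f) μ := fun f hf =>
    ((hF f hf).1.integral_prod_right').congr (hTe f).symm
  have hbound : ∀ f : α → ℂ, MemLp f 2 ρ → eLpNorm (T f) 2 μ ≤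
      ((ν Set.univ).toNNReal ^ (1 / 2 : ℝ) * (Real.toNNReal M * C ^ (1 / 2 : ℝ)) : NNReal) *
        eLpNorm f 2 ρ := by
    intro f hf
    have h1 : eLpNorm (fun z => k z * f (g z)) 2 (μ.prod ν) ≤
        (Real.toNNReal M) * (C ^ (1 / 2 : ℝ) : NNReal) * eLpNorm f 2 ρ := by
      have h2 : eLpNorm (fun z => k z * f (g z)) 2 (μ.prod ν) ≤
          Real.toNNReal M • eLpNorm (f ∘ g) 2 (μ.prod ν) := by
        refine eLpNorm_le_nnreal_smul_eLpNorm_of_ae_le_mul ?_ 2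
        filter_upwards [hM] with z hz
        rw [nnnorm_mul]
        refine mul_le_mul_of_nonneg_right ?_ zero_le
        rw [← norm_toNNReal]
        exact Real.toNNReal_le_toNNReal hz
      have h3 : eLpNorm (f ∘ g) 2 (μ.prod ν) ≤ (C ^ (1 / 2 : ℝ) : NNReal) * eLpNorm f 2 ρ := by
        rw [← eLpNorm_map_measure
          (hf.of_measure_le_smul ENNReal.coe_ne_top hC).1 hg.aemeasurable]
        refine (eLpNorm_mono_measure f hC).trans ?_
        rw [eLpNorm_smul_measure_of_ne_top (by norm_num)]
        simp [ENNReal.coe_rpow_of_nonneg]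
      refine h2.trans ?_
      rw [ENNReal.smul_def, smul_eq_mul, mul_assoc]
      exact mul_le_mul' le_rfl h3
    have h4 : eLpNorm (T f) 2 μ ≤
        (ν Set.univ) ^ (1 / 2 : ℝ) * eLpNorm (fun z => k z * f (g z)) 2 (μ.prod ν) := by
      rw [eLpNorm_congr_ae (hTe f)]
      rw [eLpNorm_eq_lintegral_rpow_enorm_toReal (by norm_num) (by norm_num),
        eLpNorm_eq_lintegral_rpow_enorm_toReal (by norm_num) (by norm_num)]
      rw [ENNReal.toReal_ofNat, ← ENNReal.mul_rpow_of_nonneg _ _ (by norm_num : (0 : ℝ) ≤ 1 / 2)]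
      refine ENNReal.rpow_le_rpow ?_ (by norm_num)
      rw [lintegral_prod _ ((hF f hf).1.enorm.pow_const _),
        ← lintegral_const_mul' _ _ (measure_ne_top ν _)]
      refine lintegral_mono_ae ?_
      filter_upwards [(hF f hf).1.prodMk_left] with x hx
      have h5 := eLpNorm_le_eLpNorm_mul_rpow_measure_univ (p := 1) (q := 2) (by norm_num) hx
      have h6 : ‖∫ y, k (x, y) * f (g (x, y)) ∂ν‖ₑ ≤
          eLpNorm (fun y => k (x, y) * f (g (x, y))) 1 ν := by
        rw [eLpNorm_one_eq_lintegral_enorm]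
        exact enorm_integral_le_lintegral_enorm _
      refine (ENNReal.rpow_le_rpow (h6.trans h5) (by norm_num)).trans ?_
      rw [eLpNorm_eq_lintegral_rpow_enorm_toReal (by norm_num) (by norm_num),
        ENNReal.mul_rpow_of_nonneg _ _ (by norm_num), ← ENNReal.rpow_mul, ← ENNReal.rpow_mul]
      norm_num
      rw [mul_comm]
    refine h4.trans ?_
    rw [ENNReal.coe_mul, ENNReal.coe_rpow_of_nonneg _ (by norm_num),
      ENNReal.coe_toNNReal (measure_ne_top ν _), mul_assoc, ENNReal.coe_mul]
    exact mul_le_mul' le_rfl h1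
  refine ⟨fun f f' hff' => ?_, fun f hf => ?_, fun f f' hf hf' => ?_, fun c f hf => ?_,
    _, hbound⟩
  · have h := Measure.ae_ae_of_ae_prod (hqmp.ae_eq_comp hff')
    filter_upwards [hT, h] with x hx hxe
    rw [hx f, hx f']
    refine integral_congr_ae ?_
    filter_upwards [hxe] with y hy
    simp only [Function.comp_apply] at hy
    rw [hy]
  · exact ⟨hmeas f hf, (hbound f hf).trans_lt (ENNReal.mul_lt_top ENNReal.coe_lt_top hf.2)⟩
  · filter_upwards [hT, hint f hf, hint f' hf'] with x hx h1 h2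
    rw [Pi.add_apply, hx, hx, hx, ← integral_add h1 h2]
    simp only [Pi.add_apply, mul_add]
  · filter_upwards [hT] with x hx
    rw [Pi.smul_apply, hx, hx, smul_eq_mul, ← integral_const_mul]
    refine integral_congr_ae (Filter.Eventually.of_forall fun y => ?_)
    simp only [Pi.smul_apply, smul_eq_mul]
    ring

theorem map_pi_comp_le {ι κ : Type*} [Fintype ι] [Fintype κ] (ν : Measure ℝ) [IsFiniteMeasure ν]
    (e : κ → ι) (he : Function.Injective e) :
    ∃ C : NNReal, (Measure.pi fun _ : ι => ν).map (fun x => x ∘ e) ≤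
      (C : ENNReal) • Measure.pi fun _ : κ => ν := by
  classical
  have hme : Measurable (fun x : ι → ℝ => x ∘ e) :=
    measurable_pi_lambda _ fun j => measurable_pi_apply (e j)
  set c : ENNReal := ∏ i ∈ (Finset.univ.image e)ᶜ, ν Set.univ with hc
  have hctop : c ≠ ⊤ := ENNReal.prod_ne_top fun _ _ => measure_ne_top ν _
  have hbox : ∀ s : κ → Set ℝ, (∀ j, MeasurableSet (s j)) →
      (Measure.pi fun _ : ι => ν).map (fun x => x ∘ e) (Set.univ.pi s) =
        c * ∏ j, ν (s j) := by
    intro s hs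
    rw [Measure.map_apply hme (MeasurableSet.univ_pi hs)]
    have hpre : (fun x : ι → ℝ => x ∘ e) ⁻¹' Set.univ.pi s =
        Set.univ.pi (Function.extend e s fun _ => Set.univ) := by
      ext x
      simp only [Set.mem_preimage, Set.mem_univ_pi, Function.comp_apply]
      constructor
      · intro h i
        by_cases hi : ∃ j, e j = i
        · obtain ⟨j, rfl⟩ := hi
          rw [he.extend_apply]; exact h j
        · rw [Function.extend_apply' _ _ _ hi]; trivial
      · intro h j
        have := h (e j)
        rwa [he.extend_apply] at this
    rw [hpre, Measure.pi_pi, ← Finset.prod_compl_mul_prod (Finset.univ.image e)]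
    congr 1
    · refine Finset.prod_congr rfl fun i hi => ?_
      rw [Function.extend_apply']
      simpa using hi
    · rw [Finset.prod_image fun a _ b _ h => he h]
      refine Finset.prod_congr rfl fun j _ => ?_
      rw [he.extend_apply]
  by_cases hc0 : c = 0
  · refine ⟨0, ?_⟩
    have h0 : (Measure.pi fun _ : ι => ν).map (fun x => x ∘ e) = 0 := by
      rw [← Measure.measure_univ_eq_zero, ← Set.pi_univ (Set.univ : Set κ),
        hbox _ fun _ => MeasurableSet.univ, hc0, zero_mul]
    rw [h0]
    exact Measure.zero_le _
  · refine ⟨c.toNNReal, ?_⟩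
    have h1 : (Measure.pi fun _ : κ => ν) =
        c⁻¹ • (Measure.pi fun _ : ι => ν).map (fun x => x ∘ e) := by
      refine Measure.pi_eq fun s hs => ?_
      rw [Measure.smul_apply, hbox s hs, smul_eq_mul, ← mul_assoc,
        ENNReal.inv_mul_cancel hc0 hctop, one_mul]
    rw [h1, ENNReal.coe_toNNReal hctop, smul_smul, ENNReal.mul_inv_cancel hc0 hctop, one_smul]

theorem cubeMeasure_eq_pi (xp xm : ℝ) (N : ℕ) :
    cubeMeasure xp xm N = Measure.pi fun _ : Fin N => volume.restrict (Set.Icc xp xm) := by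
  rw [cubeMeasure, cube, volume_pi, Measure.restrict_pi_pi]

theorem isCompact_cube (xp xm : ℝ) (N : ℕ) : IsCompact (cube xp xm N) :=
  isCompact_univ_pi fun _ => isCompact_Icc

instance isFiniteMeasure_cubeMeasure (xp xm : ℝ) (N : ℕ) :
    IsFiniteMeasure (cubeMeasure xp xm N) := by
  rw [cubeMeasure_eq_pi]; infer_instance

theorem measurableSet_cube (xp xm : ℝ) (N : ℕ) : MeasurableSet (cube xp xm N) :=
  MeasurableSet.univ_pi fun _ => measurableSet_Icc

theorem map_cube_le (xp xm : ℝ) {A B n : ℕ} (e : Fin B → Fin A ⊕ Fin n)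
    (he : Function.Injective e) :
    ∃ C : NNReal, ((cubeMeasure xp xm A).prod (cubeMeasure xp xm n)).map
      (fun z => Sum.elim z.1 z.2 ∘ e) ≤ (C : ENNReal) • cubeMeasure xp xm B := by
  obtain ⟨C, hC⟩ := map_pi_comp_le (volume.restrict (Set.Icc xp xm)) e he
  refine ⟨C, ?_⟩
  rw [cubeMeasure_eq_pi, cubeMeasure_eq_pi, cubeMeasure_eq_pi]
  have h := measurePreserving_sumPiEquivProdPi_symm (X := fun _ : Fin A ⊕ Fin n => ℝ)
    (fun _ => volume.restrict (Set.Icc xp xm))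
  have hme : Measurable (fun x : Fin A ⊕ Fin n → ℝ => x ∘ e) :=
    measurable_pi_lambda _ fun j => measurable_pi_apply (e j)
  rw [← h.map_eq, Measure.map_map hme h.measurable] at hC
  convert hC using 3
  funext z
  congr 1

theorem isL2Bounded_elementary (xp xm : ℝ) {A B n : ℕ} (p : (Fin A → ℝ) → Fin (n + 1) → ℝ)
    (hp : Continuous p) (hpJ : ∀ x ∈ cube xp xm A, ∀ m, p x m ∈ Set.Icc xp xm)
    (S : Set (Fin A → ℝ)) (hS : MeasurableSet S)
    (φ : (Fin A → ℝ) × (Fin n → ℝ) → ℂ) (hφ : Continuous φ)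
    (e : Fin B → Fin A ⊕ Fin n) (he : Function.Injective e)
    (T : ((Fin B → ℝ) → ℂ) → (Fin A → ℝ) → ℂ)
    (hT1 : ∀ f, ∀ x ∈ S,
      T f x = ∫ y in segBox (p x), φ (x, y) * f (Sum.elim x y ∘ e))
    (hT0 : ∀ f, ∀ x ∉ S, T f x = 0) :
    IsL2Bounded (cubeMeasure xp xm B) (cubeMeasure xp xm A) T := by
  classical
  obtain ⟨C, hC⟩ := map_cube_le xp xm e he
  obtain ⟨M, hM⟩ := ((isCompact_cube xp xm A).prod
    (isCompact_cube xp xm n)).exists_bound_of_continuousOn hφ.continuousOn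
  have hpm : ∀ m, Continuous fun z : (Fin A → ℝ) × (Fin n → ℝ) => p z.1 m := fun m =>
    (continuous_apply m).comp (hp.comp continuous_fst)
  have hym : ∀ m : Fin n, Continuous fun z : (Fin A → ℝ) × (Fin n → ℝ) => z.2 m := fun m =>
    (continuous_apply m).comp continuous_snd
  set D : Set ((Fin A → ℝ) × (Fin n → ℝ)) :=
    {z | z.1 ∈ S} ∩ {z | z.2 ∈ segBox (p z.1)} with hD
  have hDm : MeasurableSet D := by
    refine (measurable_fst hS).inter ?_
    have : {z : (Fin A → ℝ) × (Fin n → ℝ) | z.2 ∈ segBox (p z.1)} =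
        ⋂ m : Fin n, ({z | p z.1 m.succ < z.2 m} ∩ {z | z.2 m ≤ p z.1 m.castSucc}) := by
      ext z
      simp [segBox]
    rw [this]
    exact MeasurableSet.iInter fun m =>
      (measurableSet_lt (hpm _).measurable (hym m).measurable).inter
        (measurableSet_le (hym m).measurable (hpm _).measurable)
  have hsub : ∀ x ∈ cube xp xm A, segBox (p x) ⊆ cube xp xm n := by
    intro x hx y hy m _
    have h1 := hy m trivial
    exact ⟨((hpJ x hx m.succ).1.trans h1.1.le), h1.2.trans (hpJ x hx m.castSucc).2⟩
  have hbox : ∀ x, MeasurableSet (segBox (p x)) := fun x =>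
    MeasurableSet.univ_pi fun _ => measurableSet_Ioc
  refine isL2Bounded_kernel (D.indicator φ)
    (hφ.measurable.indicator hDm).aestronglyMeasurable M ?_
    (fun z => Sum.elim z.1 z.2 ∘ e) ?_ C hC T ?_
  · rw [cubeMeasure, cubeMeasure, Measure.prod_restrict]
    filter_upwards [ae_restrict_mem
      ((measurableSet_cube xp xm A).prod (measurableSet_cube xp xm n))] with z hz
    exact (norm_indicator_le_norm_self _ _).trans (hM z hz)
  · refine measurable_pi_lambda _ fun j => ?_
    simp only [Function.comp_apply]
    cases e j with
    | inl a => exact (measurable_pi_apply a).comp measurable_fst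
    | inr a => exact (measurable_pi_apply a).comp measurable_snd
  · filter_upwards [ae_restrict_mem (measurableSet_cube xp xm A)] with x hx f
    by_cases hxS : x ∈ S
    · rw [hT1 f x hxS]
      have : (fun y => D.indicator φ (x, y) * f (Sum.elim x y ∘ e)) =
          (segBox (p x)).indicator fun y => φ (x, y) * f (Sum.elim x y ∘ e) := by
        funext y
        by_cases hy : y ∈ segBox (p x)
        · rw [Set.indicator_of_mem hy, Set.indicator_of_mem (show (x, y) ∈ D from ⟨hxS, hy⟩)]
        · rw [Set.indicator_of_notMem hy,
            Set.indicator_of_notMem (fun h : (x, y) ∈ D => hy h.2), zero_mul]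
      simp only [this]
      rw [integral_indicator (hbox x), Measure.restrict_restrict (hbox x),
        Set.inter_eq_left.mpr (hsub x hx)]
    · rw [hT0 f x hxS]
      have : ∀ y, D.indicator φ (x, y) = 0 := fun y =>
        Set.indicator_of_notMem (fun h : (x, y) ∈ D => hxS h.1) _
      simp [this]

theorem measurableSet_strictAnti {A n : ℕ} (p : (Fin A → ℝ) → Fin n → ℝ) (hp : Continuous p) :
    MeasurableSet {x | StrictAnti (p x)} := by
  have : {x | StrictAnti (p x)} = ⋂ i, ⋂ j, {x | i < j → p x j < p x i} := by
    ext x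
    simp [StrictAnti]
  rw [this]
  refine MeasurableSet.iInter fun i => MeasurableSet.iInter fun j => ?_
  by_cases h : i < j
  · simp only [h, true_imp_iff]
    exact measurableSet_lt ((continuous_apply j).comp hp).measurable
      ((continuous_apply i).comp hp).measurable
  · simp [h]

theorem bPlusChain_continuous {N n : ℕ} (i : Fin n ↪ Fin N) :
    Continuous (bPlusChain i) := by
  refine continuous_pi fun m => ?_
  refine Fin.lastCases ?_ (fun m => ?_) m
  · simpa [bPlusChain] using continuous_apply 0
  · simpa [bPlusChain] using continuous_apply (i m).succ

theorem bMinusChain_continuous {N n : ℕ} (i : Fin n ↪ Fin N) :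
    Continuous (bMinusChain i) := by
  refine continuous_pi fun m => ?_
  refine Fin.cases ?_ (fun m => ?_) m
  · simpa [bMinusChain] using continuous_apply (Fin.last N)
  · simpa [bMinusChain] using continuous_apply (i m).castSucc

theorem cChain_continuous (xp xm : ℝ) {N n : ℕ} (i : Fin n ↪ Fin N) :
    Continuous (cChain xp xm i) := by
  refine continuous_pi fun m => ?_
  refine Fin.cases ?_ (fun m => ?_) m
  · simpa [cChain] using continuous_const
  · refine Fin.lastCases ?_ (fun m => ?_) m
    · simpa [cChain] using continuous_const
    · simpa [cChain] using continuous_apply (i m)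

theorem extend_injective {N n : ℕ} {X : Type*} (i : Fin n ↪ Fin N) (a : Fin n → X)
    (b : Fin N → X) (ha : Function.Injective a) (hb : Function.Injective b)
    (hab : ∀ m j, a m ≠ b j) : Function.Injective (Function.extend i a b) := by
  intro j k h
  by_cases hj : ∃ m, i m = j <;> by_cases hk : ∃ m, i m = k
  · obtain ⟨m, rfl⟩ := hj
    obtain ⟨l, rfl⟩ := hk
    rw [i.injective.extend_apply, i.injective.extend_apply] at h
    rw [ha h]
  · obtain ⟨m, rfl⟩ := hj
    rw [i.injective.extend_apply, Function.extend_apply' _ _ _ hk] at h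
    exact absurd h (hab _ _)
  · obtain ⟨l, rfl⟩ := hk
    rw [i.injective.extend_apply, Function.extend_apply' _ _ _ hj] at h
    exact absurd h.symm (hab _ _)
  · rw [Function.extend_apply' _ _ _ hj, Function.extend_apply' _ _ _ hk] at h
    exact hb h

theorem comp_extend {N n : ℕ} {X : Type*} (i : Fin n ↪ Fin N) (a : Fin n → X)
    (b : Fin N → X) (g : X → ℝ) :
    g ∘ Function.extend i a b = Function.extend i (g ∘ a) (g ∘ b) := by
  funext j
  by_cases hj : ∃ m, i m = j
  · obtain ⟨m, rfl⟩ := hj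
    simp only [Function.comp_apply, i.injective.extend_apply]
  · simp only [Function.comp_apply, Function.extend_apply' _ _ _ hj]

theorem eHatPlus_isL2Bounded (xp xm : ℝ) (μ : ℂ) {N n : ℕ} (i : Fin n ↪ Fin N) :
    IsL2Bounded (cubeMeasure xp xm N) (cubeMeasure xp xm (N + 1)) (eHatPlus μ i) := by
  refine isL2Bounded_elementary xp xm (bPlusChain i) (bPlusChain_continuous i) ?_
    {x | StrictAnti (bPlusChain i x)} (measurableSet_strictAnti _ (bPlusChain_continuous i))
    (fun z => Complex.exp (Complex.I * μ * z.1 0) *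
      ∏ m, Complex.exp (Complex.I * μ * (z.1 (i m).succ - z.2 m))) (by fun_prop)
    (Function.extend i Sum.inr fun j => Sum.inl j.succ) ?_ _ ?_ ?_
  · intro x hx m
    refine Fin.lastCases ?_ (fun m => ?_) m
    · simpa [bPlusChain] using hx 0 trivial
    · simpa [bPlusChain] using hx (i m).succ trivial
  · exact extend_injective i _ _ Sum.inr_injective
      (Sum.inl_injective.comp (Fin.succ_injective _)) (by simp)
  · intro f x hx
    rw [eHatPlus, if_pos (show StrictAnti (bPlusChain i x) from hx), ← integral_const_mul]
    refine integral_congr_ae (Filter.Eventually.of_forall fun y => ?_)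
    simp only [comp_extend]
    exact (mul_assoc _ _ _).symm
  · intro f x hx
    rw [eHatPlus, if_neg (show ¬ StrictAnti (bPlusChain i x) from hx)]

theorem eHatMinus_isL2Bounded (xp xm : ℝ) (μ : ℂ) {N n : ℕ} (i : Fin n ↪ Fin N) :
    IsL2Bounded (cubeMeasure xp xm N) (cubeMeasure xp xm (N + 1)) (eHatMinus μ i) := by
  refine isL2Bounded_elementary xp xm (bMinusChain i) (bMinusChain_continuous i) ?_
    {x | StrictAnti (bMinusChain i x)} (measurableSet_strictAnti _ (bMinusChain_continuous i))
    (fun z => Complex.exp (Complex.I * μ * z.1 (Fin.last N)) *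
      ∏ m, Complex.exp (Complex.I * μ * (z.1 (i m).castSucc - z.2 m))) (by fun_prop)
    (Function.extend i Sum.inr fun j => Sum.inl j.castSucc) ?_ _ ?_ ?_
  · intro x hx m
    refine Fin.cases ?_ (fun m => ?_) m
    · simpa [bMinusChain] using hx (Fin.last N) trivial
    · simpa [bMinusChain] using hx (i m).castSucc trivial
  · exact extend_injective i _ _ Sum.inr_injective
      (Sum.inl_injective.comp (Fin.castSucc_injective _)) (by simp)
  · intro f x hx
    rw [eHatMinus, if_pos (show StrictAnti (bMinusChain i x) from hx), ← integral_const_mul]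
    refine integral_congr_ae (Filter.Eventually.of_forall fun y => ?_)
    simp only [comp_extend]
    exact (mul_assoc _ _ _).symm
  · intro f x hx
    rw [eHatMinus, if_neg (show ¬ StrictAnti (bMinusChain i x) from hx)]

theorem cChain_mem {xp xm : ℝ} (hJ : xp ≤ xm) {N n : ℕ} (i : Fin n ↪ Fin N) (x : Fin N → ℝ)
    (hx : x ∈ cube xp xm N) (m : Fin (n + 2)) : cChain xp xm i x m ∈ Set.Icc xp xm := by
  refine Fin.cases ?_ (fun m => ?_) m
  · simpa [cChain] using hJ
  · refine Fin.lastCases ?_ (fun m => ?_) m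
    · simpa [cChain] using hJ
    · simpa [cChain] using hx (i m) trivial

theorem eCheckPlus_isL2Bounded {xp xm : ℝ} (hJ : xp ≤ xm) (μ : ℂ) {N n : ℕ}
    (i : Fin n ↪ Fin N) :
    IsL2Bounded (cubeMeasure xp xm (N + 1)) (cubeMeasure xp xm N) (eCheckPlus xp xm μ i) := by
  have hc := fun m => (continuous_apply m).comp
    ((cChain_continuous xp xm i).comp (continuous_fst (Y := Fin (n + 1) → ℝ)))
  simp only [Function.comp_def] at hc
  refine isL2Bounded_elementary xp xm (cChain xp xm i) (cChain_continuous xp xm i)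
    (cChain_mem hJ i)
    {x | StrictAnti fun m => x (i m)} (measurableSet_strictAnti _ (by fun_prop))
    (fun z => Complex.exp (Complex.I * μ * xp) *
      ∏ m : Fin (n + 1), Complex.exp (Complex.I * μ *
        (cChain xp xm i z.1 m.castSucc - z.2 m))) (by fun_prop)
    (Fin.snoc (α := fun _ => Fin N ⊕ Fin (n + 1))
      (Function.extend i (fun m => Sum.inr m.succ) Sum.inl) (Sum.inr 0)) ?_ _ ?_ ?_
  · rw [Fin.snoc_injective_iff]
    refine ⟨extend_injective i _ _ (Sum.inr_injective.comp (Fin.succ_injective _))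
      Sum.inl_injective (by simp), ?_⟩
    rintro ⟨j, hj⟩
    by_cases h : ∃ m, i m = j
    · obtain ⟨m, rfl⟩ := h
      rw [i.injective.extend_apply] at hj
      exact Fin.succ_ne_zero _ (Sum.inr_injective hj)
    · rw [Function.extend_apply' _ _ _ h] at hj
      exact Sum.inl_ne_inr hj
  · intro f x hx
    rw [eCheckPlus, if_pos (show StrictAnti fun m => x (i m) from hx), ← integral_const_mul]
    refine integral_congr_ae (Filter.Eventually.of_forall fun y => ?_)
    simp only [Fin.comp_snoc, comp_extend]
    exact (mul_assoc _ _ _).symm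
  · intro f x hx
    rw [eCheckPlus, if_neg (show ¬ StrictAnti fun m => x (i m) from hx)]

theorem eCheckMinus_isL2Bounded {xp xm : ℝ} (hJ : xp ≤ xm) (μ : ℂ) {N n : ℕ}
    (i : Fin n ↪ Fin N) :
    IsL2Bounded (cubeMeasure xp xm (N + 1)) (cubeMeasure xp xm N) (eCheckMinus xp xm μ i) := by
  have hc := fun m => (continuous_apply m).comp
    ((cChain_continuous xp xm i).comp (continuous_fst (Y := Fin (n + 1) → ℝ)))
  simp only [Function.comp_def] at hc
  refine isL2Bounded_elementary xp xm (cChain xp xm i) (cChain_continuous xp xm i)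
    (cChain_mem hJ i)
    {x | StrictAnti fun m => x (i m)} (measurableSet_strictAnti _ (by fun_prop))
    (fun z => Complex.exp (Complex.I * μ * xm) *
      ∏ m : Fin (n + 1), Complex.exp (Complex.I * μ *
        (cChain xp xm i z.1 m.succ - z.2 m))) (by fun_prop)
    (Fin.cons (α := fun _ => Fin N ⊕ Fin (n + 1)) (Sum.inr (Fin.last n))
      (Function.extend i (fun m => Sum.inr m.castSucc) Sum.inl)) ?_ _ ?_ ?_
  · rw [Fin.cons_injective_iff]
    refine ⟨?_, extend_injective i _ _ (Sum.inr_injective.comp (Fin.castSucc_injective _))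
      Sum.inl_injective (by simp)⟩
    rintro ⟨j, hj⟩
    by_cases h : ∃ m, i m = j
    · obtain ⟨m, rfl⟩ := h
      rw [i.injective.extend_apply] at hj
      exact (Fin.castSucc_lt_last m).ne (Sum.inr_injective hj)
    · rw [Function.extend_apply' _ _ _ h] at hj
      exact Sum.inl_ne_inr hj
  · intro f x hx
    rw [eCheckMinus, if_pos (show StrictAnti fun m => x (i m) from hx), ← integral_const_mul]
    refine integral_congr_ae (Filter.Eventually.of_forall fun y => ?_)
    simp only [Fin.comp_cons, comp_extend]
    exact (mul_assoc _ _ _).symm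
  · intro f x hx
    rw [eCheckMinus, if_neg (show ¬ StrictAnti fun m => x (i m) from hx)]

theorem bPlusFun_isL2Bounded (γ xp xm : ℝ) (μ : ℂ) (N : ℕ) :
    IsL2Bounded (cubeMeasure xp xm N) (cubeMeasure xp xm (N + 1)) (bPlusFun γ μ) :=
  IsL2Bounded.sum_op _ _ fun _ => (IsL2Bounded.sum_op _ _ fun i =>
    eHatPlus_isL2Bounded xp xm μ i).smul_op _

theorem bMinusFun_isL2Bounded (γ xp xm : ℝ) (μ : ℂ) (N : ℕ) :
    IsL2Bounded (cubeMeasure xp xm N) (cubeMeasure xp xm (N + 1)) (bMinusFun γ μ) :=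
  IsL2Bounded.sum_op _ _ fun _ => (IsL2Bounded.sum_op _ _ fun i =>
    eHatMinus_isL2Bounded xp xm μ i).smul_op _

theorem cPlusFun_isL2Bounded (γ : ℝ) {xp xm : ℝ} (hJ : xp ≤ xm) (μ : ℂ) (N : ℕ) :
    IsL2Bounded (cubeMeasure xp xm (N + 1)) (cubeMeasure xp xm N) (cPlusFun γ xp xm μ) :=
  IsL2Bounded.sum_op _ _ fun _ => (IsL2Bounded.sum_op _ _ fun i =>
    eCheckPlus_isL2Bounded hJ μ i).smul_op _

theorem cMinusFun_isL2Bounded (γ : ℝ) {xp xm : ℝ} (hJ : xp ≤ xm) (μ : ℂ) (N : ℕ) :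
    IsL2Bounded (cubeMeasure xp xm (N + 1)) (cubeMeasure xp xm N) (cMinusFun γ xp xm μ) :=
  IsL2Bounded.sum_op _ _ fun _ => (IsL2Bounded.sum_op _ _ fun i =>
    eCheckMinus_isL2Bounded hJ μ i).smul_op _

/-! ### The operators on the sectors and the spaces spanned by the wavefunctions -/

/-- `b⁺_μ : L²(J^N) → L²(J^{N+1})`. -/
def bPlus (γ xp xm : ℝ) (μ : ℂ) {N : ℕ} : Sector xp xm N →L[ℂ] Sector xp xm (N + 1) :=
  liftL2 (bPlusFun γ μ) (bPlusFun_isL2Bounded γ xp xm μ N)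

/-- `b⁻_μ : L²(J^N) → L²(J^{N+1})`. -/
def bMinus (γ xp xm : ℝ) (μ : ℂ) {N : ℕ} : Sector xp xm N →L[ℂ] Sector xp xm (N + 1) :=
  liftL2 (bMinusFun γ μ) (bMinusFun_isL2Bounded γ xp xm μ N)

/-- `c⁺_μ : L²(J^{N+1}) → L²(J^N)`. -/
def cPlus (γ : ℝ) {xp xm : ℝ} (hJ : xp < xm) (μ : ℂ) {N : ℕ} :
    Sector xp xm (N + 1) →L[ℂ] Sector xp xm N :=
  liftL2 (cPlusFun γ xp xm μ) (cPlusFun_isL2Bounded γ hJ.le μ N)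

/-- `c⁻_μ : L²(J^{N+1}) → L²(J^N)`. -/
def cMinus (γ : ℝ) {xp xm : ℝ} (hJ : xp < xm) (μ : ℂ) {N : ℕ} :
    Sector xp xm (N + 1) →L[ℂ] Sector xp xm N :=
  liftL2 (cMinusFun γ xp xm μ) (cMinusFun_isL2Bounded γ hJ.le μ N)

theorem continuous_intReflection {N : ℕ} (γ : ℝ) (j k : Fin N) (f : (Fin N → ℝ) → ℂ)
    (hf : Continuous f) : Continuous (intReflection γ j k f) := by
  have h1 : Continuous (integralOp j k f) := by
    unfold integralOp
    refine intervalIntegral.continuous_parametric_intervalIntegral_of_continuous ?_ (by fun_prop)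
    exact hf.comp (by fun_prop)
  have h2 : Continuous fun x : Fin N → ℝ => f (x ∘ Equiv.swap j k) :=
    hf.comp (continuous_pi fun m => continuous_apply _)
  exact h2.add (continuous_const.mul h1)

theorem continuous_intRepr {N : ℕ} (γ : ℝ) (w : Equiv.Perm (Fin N)) (f : (Fin N → ℝ) → ℂ)
    (hf : Continuous f) : Continuous (intRepr γ w f) := by
  unfold intRepr
  induction word w with
  | nil => exact hf
  | cons a l ih => exact continuous_intReflection _ _ _ _ ih

theorem measurableSet_sortDesc {N : ℕ} (σ : Equiv.Perm (Fin N)) :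
    MeasurableSet {x : Fin N → ℝ | sortDesc x = σ} := by
  have : {x : Fin N → ℝ | sortDesc x = σ} =
      (⋂ i, ⋂ j, {x : Fin N → ℝ | i ≤ j → x (σ j) ≤ x (σ i)}) ∩
        ⋂ i, ⋂ j, {x : Fin N → ℝ | i < j → x (σ i) = x (σ j) → σ i < σ j} := by
    ext x
    rw [Set.mem_ofPred_eq, sortDesc, eq_comm, Tuple.eq_sort_iff]
    simp [Monotone]
  rw [this]
  refine (MeasurableSet.iInter fun i => MeasurableSet.iInter fun j => ?_).inter
    (MeasurableSet.iInter fun i => MeasurableSet.iInter fun j => ?_)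
  · by_cases h : i ≤ j
    · simp only [h, true_imp_iff]
      exact measurableSet_le (measurable_pi_apply _) (measurable_pi_apply _)
    · simp [h]
  · by_cases h : i < j <;> by_cases h' : σ i < σ j
    · simp [h']
    · simp only [h, h', true_imp_iff, imp_false]
      exact (measurableSet_eq_fun (f := fun x : Fin N → ℝ => x (σ i))
        (g := fun x : Fin N → ℝ => x (σ j))
        (measurable_pi_apply _) (measurable_pi_apply _)).compl
    · simp [h]
    · simp [h]

theorem psi_memLp (γ xp xm : ℝ) {N : ℕ} (lam : Fin N → ℂ) :
    MemLp (psi γ lam) 2 (cubeMeasure xp xm N) := by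
  classical
  have hw : Continuous (planeWave lam) := by
    unfold planeWave
    fun_prop
  have hsum : psi γ lam = ∑ σ : Equiv.Perm (Fin N), {x | sortDesc x = σ}.indicator
      fun x => intRepr γ σ⁻¹ (planeWave lam) (x ∘ σ) := by
    funext x
    rw [Finset.sum_apply, Finset.sum_eq_single (sortDesc x)]
    · rw [Set.indicator_of_mem (by rfl)]; rfl
    · intro σ _ hσ
      exact Set.indicator_of_notMem (fun h => hσ h.symm) _
    · simp
  rw [hsum]
  refine memLp_finsetSum' _ fun σ _ => ?_
  refine MemLp.indicator (measurableSet_sortDesc σ) ?_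
  have hc : Continuous fun x : Fin N → ℝ => intRepr γ σ⁻¹ (planeWave lam) (x ∘ σ) :=
    (continuous_intRepr γ _ _ hw).comp (continuous_pi fun m => continuous_apply _)
  obtain ⟨M, hM⟩ := (isCompact_cube xp xm N).exists_bound_of_continuousOn hc.continuousOn
  refine MemLp.of_bound hc.aestronglyMeasurable M ?_
  filter_upwards [ae_restrict_mem (measurableSet_cube xp xm N)] with x hx using hM x hx

/-- The restriction of the non-symmetric wavefunction to `J^N`, as an element of `L²(J^N)`. -/
def psiRestricted (γ xp xm : ℝ) {N : ℕ} (lam : Fin N → ℂ) : Sector xp xm N :=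
  (psi_memLp γ xp xm lam).toLp (psi γ lam)

/-- The closure in `L²(J^N)` of the span of the restricted wavefunctions. -/
def zBar (γ xp xm : ℝ) (N : ℕ) : Submodule ℂ (Sector xp xm N) :=
  (Submodule.span ℂ (Set.range fun lam : Fin N → ℂ => psiRestricted γ xp xm lam)).topologicalClosure

end

end QNLS

namespace QNLS

noncomputable section

/-! ### Plane waves in one variable and iterated integrals -/

/-! The invariance statements hold because the span of the wavefunctions is dense: `zBar_eq_top`
shows that the closed subspace is all of `L²(J^N)`. What remains is the commutation of the operators
on the full sectors.

Creation operators. Splitting off one integration from each elementary term turns the sum over index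
tuples into a linear recursion (`bMinusFun_eq`, `bPlusFun_eq`). For `b⁻`, the value at `x` is a free
term plus `γ` times a sum of one-step terms; in each, the new particle drops to some `x_j` while
particle `j` moves up to `y`. For `b⁺` the new particle rises. A step reduces the number of
particles below (respectively above) the new one, so the recursions have unique solutions
(`eq_zero_of_low`, `eq_zero_of_up`). To compare `W = b⁺b⁻f` with `W' = b⁻b⁺f`, let `Z` be the defect
of `W` in the recursion that determines `W'`. The commutators of up-steps and down-steps give a
recursion for `Z` whose inhomogeneity vanishes where the particle added last in the tuple lies below
the one added first in the tuple. Hence `Z = 0` there, and `W` solves two first-order linear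
equations in that half-space, one for each new particle. Integrating these by parts
(`lowTerm_sub_upTerm_of_recursions`) shows that the inhomogeneity vanishes everywhere. So `Z = 0`
everywhere and `W = W'` (`eq_of_step_recursions`).

Density. For distinct wavenumbers, `psi` equals `b⁻_{λ_N} ⋯ b⁻_{λ_1} 1` (`psi_eq_created`). By
commutation this product can also be peeled from the front with `b⁺`, so an adjacent exchange of
coordinates reduces to two particles and obeys the same formula as the integral-reflection of a
plane wave. The operator `b⁻`, extended to arbitrary sources as `sourceOp`, differs from the
identity by an operator of norm at most `1/4` in a sup norm with exponential weight
(`exists_weight`). Stone–Weierstrass, a Neumann iteration and induction on `N` then give uniform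
density in the continuous functions (`gridClosure_of_continuous`).

Annihilation operators. Exchanging the names of the integrated variables and of the coordinates they
replace shows that `c⁺_μ` is `γ e^{iμ(x⁺+x⁻)}` times the transpose of `b⁻_{-μ}` for the bilinear
pairing, and likewise `c⁻_μ` for `b⁺_{-μ}` (`integral_eCheckPlus`, `integral_eCheckMinus`). Their
commutation is the transpose of that of the creation operators. -/

/-- The plane wave `s ↦ e^{iμs}` in one variable. -/
def cis (μ : ℂ) (s : ℝ) : ℂ := Complex.exp (Complex.I * μ * s)

@[simp] theorem cis_zero (μ : ℂ) : cis μ 0 = 1 := by simp [cis]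

theorem cis_add (μ : ℂ) (s t : ℝ) : cis μ (s + t) = cis μ s * cis μ t := by
  rw [cis, cis, cis, ← Complex.exp_add]; push_cast; ring_nf

theorem cis_mul_cis_of_eq (μ : ℂ) {s t r : ℝ} (h : s + t = r) : cis μ s * cis μ t = cis μ r := by
  rw [← cis_add, h]

@[fun_prop]
theorem continuous_cis (μ : ℂ) : Continuous (cis μ) := by unfold cis; fun_prop

theorem hasDerivAt_cis (μ : ℂ) (s : ℝ) : HasDerivAt (cis μ) (Complex.I * μ * cis μ s) s := by
  have h : HasDerivAt (fun s : ℝ => Complex.I * μ * (s : ℂ)) (Complex.I * μ * 1) s :=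
    (Complex.ofRealCLM.hasDerivAt (x := s)).const_mul _
  exact h.cexp.congr_deriv (by rw [mul_one, mul_comm]; rfl)

/-- Exchanges of integration are reduced to integrals over a common planar set `D`. Only
integrability on `D` is required, because some kernels contain a source that is not continuous. -/
theorem setIntegral_iterated {k : ℝ → ℝ → ℂ} {I : Set ℝ} {J : ℝ → Set ℝ} {D : Set (ℝ × ℝ)}
    (hI : MeasurableSet I) (hJ : ∀ y, MeasurableSet (J y)) (hDm : MeasurableSet D)
    (hD : ∀ y z, (y, z) ∈ D ↔ y ∈ I ∧ z ∈ J y)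
    (hint : IntegrableOn (fun p : ℝ × ℝ => k p.1 p.2) D) :
    ∫ y in I, ∫ z in J y, k y z = ∫ p in D, k p.1 p.2 := by
  rw [← integral_indicator hDm, Measure.volume_eq_prod, integral_prod _
    (by rw [← Measure.volume_eq_prod]; exact hint.integrable_indicator hDm),
    ← integral_indicator hI]
  refine integral_congr_ae (Filter.Eventually.of_forall fun y => ?_)
  by_cases hy : y ∈ I
  · simp only [Set.indicator_of_mem hy]
    rw [← integral_indicator (hJ y)]
    refine integral_congr_ae (Filter.Eventually.of_forall fun z => ?_)
    by_cases hz : z ∈ J y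
    · simp only [Set.indicator_of_mem hz]
      rw [Set.indicator_of_mem ((hD y z).2 ⟨hy, hz⟩)]
    · simp only [Set.indicator_of_notMem hz]
      rw [Set.indicator_of_notMem fun h => hz ((hD y z).1 h).2]
  · simp only [Set.indicator_of_notMem hy]
    symm
    refine integral_eq_zero_of_ae (Filter.Eventually.of_forall fun z => ?_)
    exact Set.indicator_of_notMem (fun h => hy ((hD y z).1 h).1) _

theorem setIntegral_iterated' {k : ℝ → ℝ → ℂ} {I : Set ℝ} {J : ℝ → Set ℝ} {D : Set (ℝ × ℝ)}
    (hI : MeasurableSet I) (hJ : ∀ y, MeasurableSet (J y)) (hDm : MeasurableSet D)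
    (hD : ∀ y z, (y, z) ∈ D ↔ z ∈ I ∧ y ∈ J z)
    (hint : IntegrableOn (fun p : ℝ × ℝ => k p.1 p.2) D) :
    ∫ z in I, ∫ y in J z, k y z = ∫ p in D, k p.1 p.2 := by
  have hmp : MeasurePreserving (Prod.swap : ℝ × ℝ → ℝ × ℝ) volume volume :=
    Measure.measurePreserving_swap
  have he : MeasurableEmbedding (Prod.swap : ℝ × ℝ → ℝ × ℝ) :=
    MeasurableEquiv.prodComm.measurableEmbedding
  rw [setIntegral_iterated (k := fun z y => k y z) (D := Prod.swap ⁻¹' D) hI hJ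
    (measurable_swap hDm) (fun z y => hD y z)
    ((hmp.integrableOn_comp_preimage he).2 hint)]
  exact hmp.setIntegral_preimage_emb he (fun p => k p.1 p.2) D

theorem integrableOn_of_continuous {k : ℝ → ℝ → ℂ} (hk : Continuous fun p : ℝ × ℝ => k p.1 p.2)
    {D : Set (ℝ × ℝ)} {m M : ℝ}
    (hD : ∀ y z, (y, z) ∈ D → (m ≤ y ∧ y ≤ M) ∧ m ≤ z ∧ z ≤ M) :
    IntegrableOn (fun p : ℝ × ℝ => k p.1 p.2) D :=
  (hk.continuousOn.integrableOn_compact (isCompact_Icc.prod isCompact_Icc)).mono_set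
    (t := Set.Icc m M ×ˢ Set.Icc m M) fun p hp => ⟨(hD p.1 p.2 hp).1, (hD p.1 p.2 hp).2⟩

theorem setIntegral_swap {k : ℝ → ℝ → ℂ} (hk : Continuous fun p : ℝ × ℝ => k p.1 p.2)
    (a b c d : ℝ) :
    ∫ y in Set.Ioc a b, ∫ z in Set.Ioc c d, k y z =
      ∫ z in Set.Ioc c d, ∫ y in Set.Ioc a b, k y z := by
  have hm : MeasurableSet (Set.Ioc a b ×ˢ Set.Ioc c d) := measurableSet_Ioc.prod measurableSet_Ioc
  have hint : IntegrableOn (fun p : ℝ × ℝ => k p.1 p.2) (Set.Ioc a b ×ˢ Set.Ioc c d) := by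
    refine integrableOn_of_continuous hk (m := min a c) (M := max b d) ?_
    rintro y z ⟨h1, h2⟩
    exact ⟨⟨(min_le_left _ _).trans h1.1.le, h1.2.trans (le_max_left _ _)⟩,
      (min_le_right _ _).trans h2.1.le, h2.2.trans (le_max_right _ _)⟩
  rw [setIntegral_iterated (D := Set.Ioc a b ×ˢ Set.Ioc c d) measurableSet_Ioc
      (fun _ => measurableSet_Ioc) hm (fun _ _ => Iff.rfl) hint,
    setIntegral_iterated' (D := Set.Ioc a b ×ˢ Set.Ioc c d) measurableSet_Ioc
      (fun _ => measurableSet_Ioc) hm (fun _ _ => And.comm) hint]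

/-- The order of integration on the triangle `a < y ≤ z ≤ t` may be exchanged. -/
theorem setIntegral_triangle_swap {k : ℝ → ℝ → ℂ} {a t : ℝ}
    (hint : IntegrableOn (fun p : ℝ × ℝ => k p.1 p.2) (Set.Ioc a t ×ˢ Set.Ioc a t)) :
    ∫ z in Set.Ioc a t, ∫ y in Set.Ioc a z, k y z =
      ∫ y in Set.Ioc a t, ∫ z in Set.Ioc y t, k y z := by
  have hm : MeasurableSet {p : ℝ × ℝ | (a < p.1 ∧ p.1 < p.2) ∧ p.2 ≤ t} := by measurability
  have hi : IntegrableOn (fun p : ℝ × ℝ => k p.1 p.2)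
      {p : ℝ × ℝ | (a < p.1 ∧ p.1 < p.2) ∧ p.2 ≤ t} :=
    hint.mono_set fun p hp => ⟨⟨hp.1.1, hp.1.2.le.trans hp.2⟩, hp.1.1.trans hp.1.2, hp.2⟩
  -- The diagonal `y = z` is excluded by `Ioc y t` on the right but not by `Ioc a z` on the left.
  -- Dropping this null set makes the two domains literally equal.
  have h1 : ∀ z, ∫ y in Set.Ioc a z, k y z = ∫ y in Set.Ioo a z, k y z := fun z =>
    integral_Ioc_eq_integral_Ioo
  simp only [h1]
  rw [setIntegral_iterated' measurableSet_Ioc (fun _ => measurableSet_Ioo) hm _ hi,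
    setIntegral_iterated measurableSet_Ioc (fun _ => measurableSet_Ioc) hm _ hi]
  · intro y z
    simp only [Set.mem_ofPred_eq, Set.mem_Ioc]
    constructor
    · rintro ⟨⟨h1, h2⟩, h3⟩; exact ⟨⟨h1, h2.le.trans h3⟩, h2, h3⟩
    · rintro ⟨⟨h1, h2⟩, h3, h4⟩; exact ⟨⟨h1, h3⟩, h4⟩
  · intro y z
    simp only [Set.mem_ofPred_eq, Set.mem_Ioc, Set.mem_Ioo]
    constructor
    · rintro ⟨⟨h1, h2⟩, h3⟩; exact ⟨⟨h1.trans h2, h3⟩, h1, h2⟩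
    · rintro ⟨⟨h1, h2⟩, h3, h4⟩; exact ⟨⟨h3, h4⟩, h2⟩

/-- Integration by parts for a solution of `u' = iνu + b`. -/
theorem integral_cis_mul_source {μ ν : ℂ} {u b : ℝ → ℂ} {a t : ℝ} (hat : a ≤ t)
    (hb : IntegrableOn b (Set.Ioc a t))
    (hu : ∀ y ∈ Set.Icc a t, u y = cis ν (y - a) * u a + ∫ v in Set.Ioc a y, cis ν (y - v) * b v) :
    ∫ y in Set.Ioc a t, cis μ (a - y) * b y =
      cis μ (a - t) * u t - u a +
        Complex.I * (μ - ν) * ∫ y in Set.Ioc a t, cis μ (a - y) * u y := by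
  -- The factor `I * (μ - ν)` is kept on the side of the integrand instead of being divided out, so
  -- `μ = ν` is not a special case.
  have hder : ∀ v y : ℝ, HasDerivAt (fun y => -(cis μ (a - y) * cis ν (y - v)))
      (Complex.I * (μ - ν) * (cis μ (a - y) * cis ν (y - v))) y := by
    intro v y
    have h1 := (hasDerivAt_cis μ (a - y)).scomp y ((hasDerivAt_id y).const_sub a)
    have h2 := (hasDerivAt_cis ν (y - v)).scomp y ((hasDerivAt_id y).sub_const v)
    refine ((h1.mul h2).neg).congr_deriv ?_
    simp only [Function.comp_apply, id, neg_smul, one_smul]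
    ring
  have hftc : ∀ v ≤ t, Complex.I * (μ - ν) * ∫ y in Set.Ioc v t, cis μ (a - y) * cis ν (y - v) =
      cis μ (a - v) - cis μ (a - t) * cis ν (t - v) := by
    intro v hv
    rw [← integral_const_mul, ← intervalIntegral.integral_of_le hv,
      intervalIntegral.integral_eq_sub_of_hasDerivAt (fun y _ => hder v y)
        (by apply Continuous.intervalIntegrable; fun_prop)]
    simp; ring
  have hint : IntegrableOn (fun p : ℝ × ℝ => cis μ (a - p.2) * (cis ν (p.2 - p.1) * b p.1))
      (Set.Ioc a t ×ˢ Set.Ioc a t) := by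
    have hc : Continuous fun p : ℝ × ℝ => cis μ (a - p.2) * cis ν (p.2 - p.1) := by fun_prop
    have h1 : IntegrableOn (fun p : ℝ × ℝ => b p.1) (Set.Ioc a t ×ˢ Set.Ioc a t) := by
      have := hb.mul_prod (g := fun _ : ℝ => (1 : ℂ))
        (integrableOn_const (μ := volume) (s := Set.Ioc a t) (by simp))
      rw [IntegrableOn, Measure.volume_eq_prod, ← Measure.prod_restrict]
      simpa using this
    obtain ⟨C, hC⟩ := (isCompact_Icc.prod (isCompact_Icc (a := a) (b := t))).exists_bound_of_continuousOn
      (s := Set.Icc a t ×ˢ Set.Icc a t) hc.continuousOn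
    have h2 := Integrable.bdd_mul (c := C) h1 (f := fun p : ℝ × ℝ => cis μ (a - p.2) * cis ν (p.2 - p.1))
      hc.aestronglyMeasurable (by
        filter_upwards [ae_restrict_mem (measurableSet_Ioc.prod measurableSet_Ioc)] with p hp
        exact hC p ⟨Set.Ioc_subset_Icc_self hp.1, Set.Ioc_subset_Icc_self hp.2⟩)
    simp only [mul_assoc] at h2
    exact h2
  have hcb : ∀ g : ℝ → ℂ, Continuous g → IntegrableOn (fun v => g v * b v) (Set.Ioc a t) := by
    intro g hg
    obtain ⟨C, hC⟩ := (isCompact_Icc (a := a) (b := t)).exists_bound_of_continuousOn hg.continuousOn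
    exact Integrable.bdd_mul (c := C) hb hg.aestronglyMeasurable (by
      filter_upwards [ae_restrict_mem measurableSet_Ioc] with p hp
      exact hC p (Set.Ioc_subset_Icc_self hp))
  have hswap := setIntegral_triangle_swap (k := fun v y => cis μ (a - y) * (cis ν (y - v) * b v)) hint
  -- Inserting the integral formula for `u` and exchanging the integrations leaves an inner integral
  -- of plane waves only, which `hftc` evaluates. This replaces the product rule, which would
  -- require a differentiable `u`.
  have hinner : ∫ y in Set.Ioc a t, cis μ (a - y) * u y =
      (∫ y in Set.Ioc a t, cis μ (a - y) * cis ν (y - a)) * u a +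
        ∫ v in Set.Ioc a t, (∫ y in Set.Ioc v t, cis μ (a - y) * cis ν (y - v)) * b v := by
    have h1 : ∀ y ∈ Set.Ioc a t, cis μ (a - y) * u y = cis μ (a - y) * cis ν (y - a) * u a +
        ∫ v in Set.Ioc a y, cis μ (a - y) * (cis ν (y - v) * b v) := by
      intro y hy
      rw [hu y (Set.Ioc_subset_Icc_self hy), integral_const_mul]; ring
    rw [setIntegral_congr_fun measurableSet_Ioc h1, integral_add, integral_mul_const, hswap]
    · congr 1
      refine setIntegral_congr_fun measurableSet_Ioc fun v _ => ?_
      rw [← integral_mul_const]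
      simp only [mul_assoc]
    · exact (Continuous.integrableOn_Ioc (by fun_prop))
    · have hm : MeasurableSet {p : ℝ × ℝ | p.2 ≤ p.1} := measurableSet_le measurable_snd measurable_fst
      have h3 : IntegrableOn (fun p : ℝ × ℝ => cis μ (a - p.1) * (cis ν (p.1 - p.2) * b p.2))
          (Set.Ioc a t ×ˢ Set.Ioc a t) := by
        have hmp : MeasurePreserving (Prod.swap : ℝ × ℝ → ℝ × ℝ) volume volume :=
          Measure.measurePreserving_swap
        have he : MeasurableEmbedding (Prod.swap : ℝ × ℝ → ℝ × ℝ) :=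
          MeasurableEquiv.prodComm.measurableEmbedding
        have := (hmp.integrableOn_comp_preimage he).2 hint
        rwa [Set.preimage_swap_prod] at this
      have h4 := (h3.indicator hm)
      rw [IntegrableOn, Measure.volume_eq_prod, ← Measure.prod_restrict] at h4
      refine h4.integral_prod_left.congr ?_
      filter_upwards [ae_restrict_mem measurableSet_Ioc] with y hy
      have : (fun v => {p : ℝ × ℝ | p.2 ≤ p.1}.indicator
          (fun p : ℝ × ℝ => cis μ (a - p.1) * (cis ν (p.1 - p.2) * b p.2)) (y, v)) =
          (Set.Iic y).indicator fun v => cis μ (a - y) * (cis ν (y - v) * b v) := by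
        funext v
        by_cases h : v ≤ y <;> simp [Set.indicator, h]
      rw [this, integral_indicator measurableSet_Iic, Measure.restrict_restrict measurableSet_Iic]
      congr 2
      ext v
      simp only [Set.mem_inter_iff, Set.mem_Iic, Set.mem_Ioc]
      constructor
      · rintro ⟨h1, h2, _⟩; exact ⟨h2, h1⟩
      · rintro ⟨h1, h2⟩; exact ⟨h2, h1, h2.trans hy.2⟩
  have h5 : Complex.I * (μ - ν) *
      ∫ v in Set.Ioc a t, (∫ y in Set.Ioc v t, cis μ (a - y) * cis ν (y - v)) * b v =
      (∫ v in Set.Ioc a t, cis μ (a - v) * b v) -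
        cis μ (a - t) * ∫ v in Set.Ioc a t, cis ν (t - v) * b v := by
    rw [← integral_const_mul, ← integral_const_mul, ← integral_sub]
    · refine setIntegral_congr_fun measurableSet_Ioc fun v hv => ?_
      rw [← mul_assoc, hftc v hv.2]; ring
    · exact hcb _ (by fun_prop)
    · have h := hcb (fun v => cis μ (a - t) * cis ν (t - v)) (by fun_prop)
      simp only [mul_assoc] at h
      exact h
  rw [hinner, mul_add, h5, hu t ⟨hat, le_rfl⟩, ← mul_assoc, hftc a hat]
  simp
  ring

/-- Integration by parts for a solution of `u' = iμu - b`, started at the right end point. -/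
theorem integral_cis_mul_source' {μ ν : ℂ} {u b : ℝ → ℂ} {a t : ℝ} (hat : a ≤ t)
    (hb : IntegrableOn b (Set.Ioc a t))
    (hu : ∀ z ∈ Set.Icc a t, u z = cis μ (z - t) * u t + ∫ v in Set.Ioc z t, cis μ (z - v) * b v) :
    ∫ z in Set.Ioc a t, cis ν (t - z) * b z =
      cis ν (t - a) * u a - u t +
        Complex.I * (μ - ν) * ∫ z in Set.Ioc a t, cis ν (t - z) * u z := by
  have hneg : ∀ (f : ℝ → ℂ) {c d : ℝ}, c ≤ d →
      ∫ z in Set.Ioc c d, f z = ∫ z in Set.Ioc (-d) (-c), f (-z) := by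
    intro f c d hcd
    rw [← intervalIntegral.integral_of_le hcd, ← intervalIntegral.integral_of_le (neg_le_neg hcd),
      intervalIntegral.integral_comp_neg, neg_neg, neg_neg]
  have hcis : ∀ (κ : ℂ) (s r : ℝ), s = -r → cis (-κ) s = cis κ r := by
    rintro κ s r rfl; simp [cis]
  -- The reflection `z ↦ -z` turns the right end point into the initial point. It changes the signs
  -- of both wavenumbers, and they also exchange roles.
  have h := integral_cis_mul_source (μ := -ν) (ν := -μ) (u := fun z => u (-z))
    (b := fun z => b (-z)) (neg_le_neg hat) ?_ ?_
  · rw [hneg _ hat, hneg (fun z => cis ν (t - z) * u z) hat]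
    simp only [neg_neg] at h
    rw [hcis ν _ (t - a) (by ring)] at h
    have h1 : ∀ z : ℝ, cis (-ν) (-t - z) = cis ν (t - -z) := fun z => hcis _ _ _ (by ring)
    simp only [h1] at h
    rw [h]; ring
  · have := (integrableOn_Ioc_iff_integrableOn_Ioo (μ := volume)).1 hb
    rw [integrableOn_Ioc_iff_integrableOn_Ioo]
    have hmp : MeasurePreserving (fun x : ℝ => -x) volume volume := Measure.measurePreserving_neg _
    have := (hmp.integrableOn_comp_preimage (MeasurableEquiv.neg ℝ).measurableEmbedding).2 this
    simpa [Function.comp_def] using this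
  · intro y hy
    have hy' : -y ∈ Set.Icc a t := ⟨by linarith [hy.2], by linarith [hy.1]⟩
    simp only [neg_neg]
    rw [hu _ hy', hneg _ hy'.2, neg_neg, hcis μ _ (-y - t) (by ring)]
    congr 1
    refine integral_congr_ae (Filter.Eventually.of_forall fun v => ?_)
    simp only
    rw [hcis μ _ (-y - -v) (by ring)]

/-! ### One-step operators -/

section Steps

variable {ι : Type*} [DecidableEq ι]

/-- The point `x` with `x_p` replaced by `x_j` and `x_j` replaced by `y`. -/
def exch (p j : ι) (x : ι → ℝ) (y : ℝ) : ι → ℝ :=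
  Function.update (Function.update x j y) p (x j)

@[simp] theorem exch_apply_self (p j : ι) (x : ι → ℝ) (y : ℝ) : exch p j x y p = x j := by
  simp [exch]

theorem exch_apply_of_ne {p j : ι} (h : j ≠ p) (x : ι → ℝ) (y : ℝ) : exch p j x y j = y := by
  simp [exch, h]

theorem exch_apply_of_ne_of_ne {p j k : ι} (h : k ≠ p) (h' : k ≠ j) (x : ι → ℝ) (y : ℝ) :
    exch p j x y k = x k := by
  simp [exch, h, h']

theorem continuous_exch (p j : ι) : Continuous fun z : (ι → ℝ) × ℝ => exch p j z.1 z.2 := by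
  unfold exch
  exact (continuous_fst.update j continuous_snd).update p ((continuous_apply j).comp continuous_fst)

/-- The particle at `x_p` is moved down to `x_j`, while the particle at `x_j` moves up. -/
def lowTerm (p : ι) (ν : ℂ) (j : ι) (U : (ι → ℝ) → ℂ) (x : ι → ℝ) : ℂ :=
  ∫ y in Set.Ioc (x j) (x p), cis ν (x p - y) * U (exch p j x y)

/-- The particle at `x_p` is moved up to `x_j`, while the particle at `x_j` moves down. -/
def upTerm (p : ι) (μ : ℂ) (j : ι) (U : (ι → ℝ) → ℂ) (x : ι → ℝ) : ℂ :=
  ∫ y in Set.Ioc (x p) (x j), cis μ (x p - y) * U (exch p j x y)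

/-- An integral over `Ioc a b` is cut off to zero for `b < a` instead of changing sign, so it is the
interval integral from `a` to `max a b`. Continuity persists across `a = b`. -/
theorem continuous_setIntegral_Ioc {X : Type*} [TopologicalSpace X]
    {k : X → ℝ → ℂ} {a b : X → ℝ} (hk : Continuous fun z : X × ℝ => k z.1 z.2)
    (ha : Continuous a) (hb : Continuous b) :
    Continuous fun x => ∫ y in Set.Ioc (a x) (b x), k x y := by
  have h : ∀ x, ∫ y in Set.Ioc (a x) (b x), k x y =
      (∫ y in (0 : ℝ)..(max (a x) (b x)), k x y) - ∫ y in (0 : ℝ)..(a x), k x y := by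
    intro x
    have hi : ∀ c d, IntervalIntegrable (k x) volume c d := fun c d =>
      (hk.comp (continuous_const.prodMk continuous_id)).intervalIntegrable _ _
    rw [intervalIntegral.integral_interval_sub_left (hi _ _) (hi _ _),
      intervalIntegral.integral_of_le (le_max_left _ _)]
    rcases le_total (a x) (b x) with h | h
    · rw [max_eq_right h]
    · rw [max_eq_left h, Set.Ioc_self, Set.Ioc_eq_empty (not_lt.2 h)]
  simp only [h]
  exact (intervalIntegral.continuous_parametric_intervalIntegral_of_continuous hk
    (ha.max hb)).sub (intervalIntegral.continuous_parametric_intervalIntegral_of_continuous hk ha)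

theorem continuous_lowTerm (p : ι) (ν : ℂ) (j : ι) {U : (ι → ℝ) → ℂ} (hU : Continuous U) :
    Continuous (lowTerm p ν j U) := by
  refine continuous_setIntegral_Ioc (k := fun x y => cis ν (x p - y) * U (exch p j x y)) ?_
    (continuous_apply j) (continuous_apply p)
  exact Continuous.mul (by fun_prop) (hU.comp (continuous_exch p j))

theorem continuous_upTerm (p : ι) (μ : ℂ) (j : ι) {U : (ι → ℝ) → ℂ} (hU : Continuous U) :
    Continuous (upTerm p μ j U) := by
  refine continuous_setIntegral_Ioc (k := fun x y => cis μ (x p - y) * U (exch p j x y)) ?_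
    (continuous_apply p) (continuous_apply j)
  exact Continuous.mul (by fun_prop) (hU.comp (continuous_exch p j))

theorem lowTerm_of_le {p j : ι} {x : ι → ℝ} (h : x p ≤ x j) (ν : ℂ) (U : (ι → ℝ) → ℂ) :
    lowTerm p ν j U x = 0 := by
  rw [lowTerm, Set.Ioc_eq_empty (not_lt.2 h), setIntegral_empty]

theorem upTerm_of_le {p j : ι} {x : ι → ℝ} (h : x j ≤ x p) (μ : ℂ) (U : (ι → ℝ) → ℂ) :
    upTerm p μ j U x = 0 := by
  rw [upTerm, Set.Ioc_eq_empty (not_lt.2 h), setIntegral_empty]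

theorem integrableOn_step (p j : ι) (κ : ℂ) {U : (ι → ℝ) → ℂ} (hU : Continuous U) (x : ι → ℝ)
    (a b : ℝ) : IntegrableOn (fun y => cis κ (x p - y) * U (exch p j x y)) (Set.Ioc a b) := by
  apply Continuous.integrableOn_Ioc
  exact Continuous.mul (by fun_prop) (hU.comp ((continuous_exch p j).comp (Continuous.prodMk_right x)))

/-- The lower step operator as a linear map on continuous functions. -/
def lowLin (p : ι) (ν : ℂ) (j : ι) : C(ι → ℝ, ℂ) →ₗ[ℂ] C(ι → ℝ, ℂ) where
  toFun U := ⟨lowTerm p ν j U, continuous_lowTerm p ν j U.continuous⟩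
  map_add' U V := by
    ext x
    simp only [ContinuousMap.coe_mk, ContinuousMap.add_apply, lowTerm, mul_add]
    exact integral_add (integrableOn_step p j ν U.continuous x _ _)
      (integrableOn_step p j ν V.continuous x _ _)
  map_smul' c U := by
    ext x
    simp only [ContinuousMap.coe_mk, ContinuousMap.smul_apply, lowTerm, smul_eq_mul,
      RingHom.id_apply, mul_left_comm _ c]
    exact integral_const_mul _ _

/-- The upper step operator as a linear map on continuous functions. -/
def upLin (p : ι) (μ : ℂ) (j : ι) : C(ι → ℝ, ℂ) →ₗ[ℂ] C(ι → ℝ, ℂ) where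
  toFun U := ⟨upTerm p μ j U, continuous_upTerm p μ j U.continuous⟩
  map_add' U V := by
    ext x
    simp only [ContinuousMap.coe_mk, ContinuousMap.add_apply, upTerm, mul_add]
    exact integral_add (integrableOn_step p j μ U.continuous x _ _)
      (integrableOn_step p j μ V.continuous x _ _)
  map_smul' c U := by
    ext x
    simp only [ContinuousMap.coe_mk, ContinuousMap.smul_apply, upTerm, smul_eq_mul,
      RingHom.id_apply, mul_left_comm _ c]
    exact integral_const_mul _ _

theorem lowLin_apply (p : ι) (ν : ℂ) (j : ι) (U : C(ι → ℝ, ℂ)) (x : ι → ℝ) :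
    lowLin p ν j U x = lowTerm p ν j U x := rfl

theorem upLin_apply (p : ι) (ν : ℂ) (j : ι) (U : C(ι → ℝ, ℂ)) (x : ι → ℝ) :
    upLin p ν j U x = upTerm p ν j U x := rfl

/-! ### Uniqueness for the one-step recursions -/

variable [Fintype ι]

/-- A step puts the `p`-th coordinate at the higher value `x j` and leaves no new coordinate above
it, so the number of coordinates strictly above it drops. Strong induction on this number applies.
The predicate `P` localises the argument to a region that the steps do not leave. -/
theorem eq_zero_of_up (p : ι) (μ γ : ℂ) (s : Finset ι) (Z : (ι → ℝ) → ℂ) (P : (ι → ℝ) → Prop)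
    (hP : ∀ x, P x → ∀ j ∈ s, ∀ y, x p < y → y ≤ x j → P (exch p j x y))
    (hZ : ∀ x, P x → Z x = γ * ∑ j ∈ s, upTerm p μ j Z x) (x : ι → ℝ) (hx : P x) : Z x = 0 := by
  induction h : (Finset.univ.filter fun k => x p < x k).card using Nat.strong_induction_on
    generalizing x with
  | _ n ih =>
  rw [hZ x hx, Finset.sum_eq_zero, mul_zero]
  intro j hj
  refine (setIntegral_congr_fun measurableSet_Ioc fun y hy => ?_).trans
    (integral_zero _ _)
  have hjp : j ≠ p := by
    rintro rfl; exact absurd (hy.1.trans_le hy.2) (lt_irrefl _)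
  have hz : Z (exch p j x y) = 0 := by
    refine ih _ ?_ _ (hP x hx j hj y hy.1 hy.2) rfl
    rw [← h]
    refine Finset.card_lt_card ⟨fun k hk => ?_, fun hsub => ?_⟩
    · simp only [Finset.mem_filter, Finset.mem_univ, true_and, exch_apply_self] at hk ⊢
      by_cases hkp : k = p
      · subst hkp; simp at hk
      by_cases hkj : k = j
      · subst hkj; rw [exch_apply_of_ne hkp] at hk; exact absurd hk (not_lt.2 hy.2)
      rw [exch_apply_of_ne_of_ne hkp hkj] at hk
      exact (hy.1.trans_le hy.2).trans hk
    · have := hsub (by simpa using hy.1.trans_le hy.2 : j ∈ _)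
      simp only [Finset.mem_filter, Finset.mem_univ, true_and, exch_apply_self,
        exch_apply_of_ne hjp] at this
      exact absurd this (not_lt.2 hy.2)
  simp only [hz, mul_zero]

/-- The mirror argument: a step lowers the `p`-th coordinate to `x j`, and fewer coordinates remain
strictly below it. -/
theorem eq_zero_of_low (p : ι) (ν γ : ℂ) (s : Finset ι) (Z : (ι → ℝ) → ℂ)
    (hZ : ∀ x, Z x = γ * ∑ j ∈ s, lowTerm p ν j Z x) (x : ι → ℝ) : Z x = 0 := by
  induction h : (Finset.univ.filter fun k => x k < x p).card using Nat.strong_induction_on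
    generalizing x with
  | _ n ih =>
  rw [hZ x, Finset.sum_eq_zero, mul_zero]
  intro j hj
  refine (setIntegral_congr_fun measurableSet_Ioc fun y hy => ?_).trans
    (integral_zero _ _)
  have hjp : j ≠ p := by
    rintro rfl; exact absurd (hy.1.trans_le hy.2) (lt_irrefl _)
  have hz : Z (exch p j x y) = 0 := by
    refine ih _ ?_ _ rfl
    rw [← h]
    refine Finset.card_lt_card ⟨fun k hk => ?_, fun hsub => ?_⟩
    · simp only [Finset.mem_filter, Finset.mem_univ, true_and, exch_apply_self] at hk ⊢
      by_cases hkp : k = p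
      · subst hkp; simp at hk
      by_cases hkj : k = j
      · subst hkj; rw [exch_apply_of_ne hkp] at hk; exact absurd hk (not_lt.2 hy.1.le)
      rw [exch_apply_of_ne_of_ne hkp hkj] at hk
      exact hk.trans (hy.1.trans_le hy.2)
    · have := hsub (by simpa using hy.1.trans_le hy.2 : j ∈ _)
      simp only [Finset.mem_filter, Finset.mem_univ, true_and, exch_apply_self,
        exch_apply_of_ne hjp] at this
      exact absurd this (not_lt.2 hy.1.le)
  simp only [hz, mul_zero]

end Steps

/-! ### Commutation of the two recursions -/

section Commutation

variable {ι : Type*} [DecidableEq ι]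

/-- The pairs `{p, j}` and `{q, k}` are disjoint, so neither step affects the bounds or the phase of
the other, and Fubini on a rectangle suffices. -/
theorem upTerm_lowTerm_comm {p q j k : ι} (hpq : p ≠ q) (hjq : j ≠ q) (hkp : k ≠ p)
    (hjk : j ≠ k) (μ ν : ℂ) {W : (ι → ℝ) → ℂ} (hW : Continuous W) :
    upTerm p μ j (lowTerm q ν k W) = lowTerm q ν k (upTerm p μ j W) := by
  funext x
  have hpt : ∀ y z, exch q k (exch p j x y) z = exch p j (exch q k x z) y := by
    intro y z
    funext l
    simp only [exch, Function.update_apply]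
    grind
  have h1 : upTerm p μ j (lowTerm q ν k W) x = ∫ y in Set.Ioc (x p) (x j),
      ∫ z in Set.Ioc (x k) (x q), cis μ (x p - y) * (cis ν (x q - z) *
        W (exch q k (exch p j x y) z)) := by
    refine setIntegral_congr_fun measurableSet_Ioc fun y _ => ?_
    simp only [lowTerm]
    rw [exch_apply_of_ne_of_ne hpq.symm hjq.symm, exch_apply_of_ne_of_ne hkp hjk.symm,
      ← integral_const_mul]
  have h2 : lowTerm q ν k (upTerm p μ j W) x = ∫ z in Set.Ioc (x k) (x q),
      ∫ y in Set.Ioc (x p) (x j), cis μ (x p - y) * (cis ν (x q - z) *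
        W (exch q k (exch p j x y) z)) := by
    refine setIntegral_congr_fun measurableSet_Ioc fun z _ => ?_
    simp only [upTerm]
    rw [exch_apply_of_ne_of_ne hpq hkp.symm, exch_apply_of_ne_of_ne hjq hjk,
      ← integral_const_mul]
    refine integral_congr_ae (Filter.Eventually.of_forall fun y => ?_)
    simp only [hpt]
    ring
  rw [h1, h2]
  refine setIntegral_swap ?_ _ _ _ _
  refine Continuous.mul (by fun_prop) (Continuous.mul (by fun_prop) (hW.comp ?_))
  exact (continuous_exch q k).comp (((continuous_exch p j).comp
    (continuous_const.prodMk continuous_fst)).prodMk continuous_snd)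

/-- The point `x` with `x_p`, `x_q`, `x_j` replaced by `a`, `b`, `c`. -/
def put (p q j : ι) (x : ι → ℝ) (a b c : ℝ) : ι → ℝ :=
  Function.update (Function.update (Function.update x j c) q b) p a

theorem continuous_put (p q j : ι) (x : ι → ℝ) :
    Continuous fun z : ℝ × ℝ × ℝ => put p q j x z.1 z.2.1 z.2.2 := by
  unfold put
  exact (((continuous_const.update j (by fun_prop)).update q (by fun_prop)).update p (by fun_prop))

/-- In both products the particles end at `x j`, `y`, `z` with the same integrand. The first has the
domain `x p < y ≤ x j < z ≤ x q`; the second only asks for `y < z` instead of `x j < z`. The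
difference is the part with `z ≤ x j`. There the `q`-th argument `y` of `W` lies below the `p`-th
argument `x j`. -/
theorem lowTerm_upTerm_sub {p q j : ι} (hpq : p ≠ q) (hjp : j ≠ p) (hjq : j ≠ q) (μ ν : ℂ)
    {W : (ι → ℝ) → ℂ} (hW : Continuous W) (x : ι → ℝ) :
    lowTerm q ν j (upTerm p μ q W) x - upTerm p μ j (lowTerm q ν j W) x =
      -∫ y in Set.Ioc (x p) (x q), cis μ (x p - y) * ∫ z in Set.Ioc y (x q), cis ν (x q - z) *
        (Set.Iic (x j)).indicator (fun z => W (put p q j x (x j) y z)) z := by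
  set F : ℝ → ℝ → ℂ := fun y z => cis μ (x p - y) * (cis ν (x q - z) *
    W (put p q j x (x j) y z)) with hF
  have hFc : Continuous fun r : ℝ × ℝ => F r.1 r.2 := by
    refine Continuous.mul (by fun_prop) (Continuous.mul (by fun_prop) (hW.comp ?_))
    exact (continuous_put p q j x).comp (f := fun r : ℝ × ℝ => (x j, r.1, r.2)) (by fun_prop)
  have hi : ∀ D : Set (ℝ × ℝ), (∀ y z, (y, z) ∈ D → (x p ≤ y ∧ y ≤ max (x j) (x q)) ∧
      x p ≤ z ∧ z ≤ max (x j) (x q)) → IntegrableOn (fun r : ℝ × ℝ => F r.1 r.2) D :=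
    fun D hD => integrableOn_of_continuous hFc hD
  have h1 : lowTerm q ν j (upTerm p μ q W) x =
      ∫ z in Set.Ioc (x j) (x q), ∫ y in Set.Ioc (x p) (x j), F y z := by
    refine setIntegral_congr_fun measurableSet_Ioc fun z _ => ?_
    simp only [upTerm, hF]
    rw [exch_apply_of_ne_of_ne hpq hjp.symm, exch_apply_self, ← integral_const_mul]
    refine integral_congr_ae (Filter.Eventually.of_forall fun y => ?_)
    have : exch p q (exch q j x z) y = put p q j x (x j) y z := by
      funext l
      simp only [exch, put, Function.update_apply]
      grind
    simp only [this]
    ring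
  have h2 : upTerm p μ j (lowTerm q ν j W) x =
      ∫ y in Set.Ioc (x p) (x j), ∫ z in Set.Ioc y (x q), F y z := by
    refine setIntegral_congr_fun measurableSet_Ioc fun y _ => ?_
    simp only [lowTerm, hF]
    rw [exch_apply_of_ne hjp, exch_apply_of_ne_of_ne hpq.symm hjq.symm, ← integral_const_mul]
    refine integral_congr_ae (Filter.Eventually.of_forall fun z => ?_)
    have : exch q j (exch p j x y) z = put p q j x (x j) y z := by
      funext l
      simp only [exch, put, Function.update_apply]
      grind
    simp only [this]
  have h3 : ∫ y in Set.Ioc (x p) (x q), cis μ (x p - y) * ∫ z in Set.Ioc y (x q),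
      cis ν (x q - z) * (Set.Iic (x j)).indicator (fun z => W (put p q j x (x j) y z)) z =
      ∫ y in Set.Ioc (x p) (x q), ∫ z in Set.Ioc y (x q) ∩ Set.Iic (x j), F y z := by
    refine setIntegral_congr_fun measurableSet_Ioc fun y _ => ?_
    simp only [hF]
    rw [← integral_const_mul, ← setIntegral_indicator measurableSet_Iic]
    refine integral_congr_ae (Filter.Eventually.of_forall fun z => ?_)
    by_cases hz : z ∈ Set.Iic (x j)
    · simp only [Set.indicator_of_mem hz]
    · simp only [Set.indicator_of_notMem hz, mul_zero]
  have hm1 : MeasurableSet (Set.Ioc (x p) (x j) ×ˢ Set.Ioc (x j) (x q)) :=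
    measurableSet_Ioc.prod measurableSet_Ioc
  have hm2 : MeasurableSet {r : ℝ × ℝ | (x p < r.1 ∧ r.1 < r.2) ∧ (r.2 ≤ x q ∧ r.2 ≤ x j)} :=
    ((measurableSet_lt measurable_const measurable_fst).inter
      (measurableSet_lt measurable_fst measurable_snd)).inter
      ((measurableSet_le measurable_snd measurable_const).inter
      (measurableSet_le measurable_snd measurable_const))
  have hi1 := hi (Set.Ioc (x p) (x j) ×ˢ Set.Ioc (x j) (x q)) (by
    rintro y z ⟨h1, h2⟩
    simp only [Set.mem_Ioc] at h1 h2
    exact ⟨⟨h1.1.le, le_max_of_le_left h1.2⟩, by linarith, le_max_of_le_right h2.2⟩)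
  have hi2 := hi {r : ℝ × ℝ | (x p < r.1 ∧ r.1 < r.2) ∧ (r.2 ≤ x q ∧ r.2 ≤ x j)} (by
    rintro y z ⟨⟨h1, h2⟩, h3, h4⟩
    simp only at h1 h2 h3 h4
    exact ⟨⟨h1.le, le_max_of_le_left (by linarith)⟩, by linarith, le_max_of_le_right h3⟩)
  rw [h1, h2, h3, setIntegral_iterated' measurableSet_Ioc (fun _ => measurableSet_Ioc) hm1
      (fun _ _ => And.comm) hi1,
    setIntegral_iterated measurableSet_Ioc (fun _ => measurableSet_Ioc.inter measurableSet_Iic) hm2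
      _ hi2,
    setIntegral_iterated measurableSet_Ioc (fun _ => measurableSet_Ioc) (hm1.union hm2) _
      (hi1.union hi2),
    setIntegral_union _ hm2 hi1 hi2]
  · ring
  · rw [Set.disjoint_left]
    rintro ⟨y, z⟩ ⟨_, h2⟩ ⟨_, _, h4⟩
    exact absurd h2.1 (not_lt.2 h4)
  · intro y z
    simp only [Set.mem_union, Set.mem_prod, Set.mem_ofPred_eq, Set.mem_Ioc]
    constructor
    · rintro (⟨⟨h1, h2⟩, h3, h4⟩ | ⟨⟨h1, h2⟩, h3, h4⟩)
      · exact ⟨⟨h1, h2⟩, by linarith, h4⟩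
      · exact ⟨⟨h1, by linarith⟩, h2, h3⟩
    · rintro ⟨⟨h1, h2⟩, h3, h4⟩
      rcases le_or_gt z (x j) with h | h
      · exact Or.inr ⟨⟨h1, h3⟩, h4, h⟩
      · exact Or.inl ⟨⟨h1, h2⟩, h, h4⟩
  · intro y z
    simp only [Set.mem_inter_iff, Set.mem_ofPred_eq, Set.mem_Ioc, Set.mem_Iic]
    constructor
    · rintro ⟨⟨h1, h2⟩, h3, h4⟩
      exact ⟨⟨h1, by linarith⟩, ⟨h2, h3⟩, h4⟩
    · rintro ⟨⟨h1, h2⟩, ⟨h3, h4⟩, h5⟩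
      exact ⟨⟨h1, h3⟩, h4, h5⟩

/-- Again the integrands agree, now with the particles at `z`, `x j`, `y`. The first domain exceeds
the second by the part with `y > x j`. There the `q`-th argument `x j` of `W` lies below the `p`-th
argument `z`. -/
theorem lowTerm_upTerm_sub' {p q j : ι} (hpq : p ≠ q) (hjp : j ≠ p) (hjq : j ≠ q) (μ ν : ℂ)
    {W : (ι → ℝ) → ℂ} (hW : Continuous W) (x : ι → ℝ) :
    lowTerm q ν j (upTerm p μ j W) x - upTerm p μ j (lowTerm q ν p W) x =
      ∫ z in Set.Ioc (x p) (x q), cis ν (x q - z) * ∫ y in Set.Ioc (x p) z, cis μ (x p - y) *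
        (Set.Ioi (x j)).indicator (fun y => W (put p q j x z (x j) y)) y := by
  set F : ℝ → ℝ → ℂ := fun y z => cis ν (x q - z) * (cis μ (x p - y) *
    W (put p q j x z (x j) y)) with hF
  have hFc : Continuous fun r : ℝ × ℝ => F r.1 r.2 := by
    refine Continuous.mul (by fun_prop) (Continuous.mul (by fun_prop) (hW.comp ?_))
    exact (continuous_put p q j x).comp (f := fun r : ℝ × ℝ => (r.2, x j, r.1)) (by fun_prop)
  have hi : ∀ D : Set (ℝ × ℝ), (∀ y z, (y, z) ∈ D → (min (x j) (x p) ≤ y ∧ y ≤ x q) ∧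
      min (x j) (x p) ≤ z ∧ z ≤ x q) → IntegrableOn (fun r : ℝ × ℝ => F r.1 r.2) D :=
    fun D hD => integrableOn_of_continuous hFc hD
  have h1 : lowTerm q ν j (upTerm p μ j W) x =
      ∫ z in Set.Ioc (x j) (x q), ∫ y in Set.Ioc (x p) z, F y z := by
    refine setIntegral_congr_fun measurableSet_Ioc fun z _ => ?_
    simp only [upTerm, hF]
    rw [exch_apply_of_ne_of_ne hpq hjp.symm, exch_apply_of_ne hjq, ← integral_const_mul]
    refine integral_congr_ae (Filter.Eventually.of_forall fun y => ?_)
    have : exch p j (exch q j x z) y = put p q j x z (x j) y := by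
      funext l
      simp only [exch, put, Function.update_apply]
      grind
    simp only [this]
  have h2 : upTerm p μ j (lowTerm q ν p W) x =
      ∫ y in Set.Ioc (x p) (x j), ∫ z in Set.Ioc (x j) (x q), F y z := by
    refine setIntegral_congr_fun measurableSet_Ioc fun y _ => ?_
    simp only [lowTerm, hF]
    rw [exch_apply_of_ne_of_ne hpq.symm hjq.symm, exch_apply_self, ← integral_const_mul]
    refine integral_congr_ae (Filter.Eventually.of_forall fun z => ?_)
    have : exch q p (exch p j x y) z = put p q j x z (x j) y := by
      funext l
      simp only [exch, put, Function.update_apply]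
      grind
    simp only [this]
    ring
  have h3 : ∫ z in Set.Ioc (x p) (x q), cis ν (x q - z) * ∫ y in Set.Ioc (x p) z,
      cis μ (x p - y) * (Set.Ioi (x j)).indicator (fun y => W (put p q j x z (x j) y)) y =
      ∫ z in Set.Ioc (x p) (x q), ∫ y in Set.Ioc (x p) z ∩ Set.Ioi (x j), F y z := by
    refine setIntegral_congr_fun measurableSet_Ioc fun z _ => ?_
    simp only [hF]
    rw [← integral_const_mul, ← setIntegral_indicator measurableSet_Ioi]
    refine integral_congr_ae (Filter.Eventually.of_forall fun y => ?_)
    by_cases hy : y ∈ Set.Ioi (x j)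
    · simp only [Set.indicator_of_mem hy]
    · simp only [Set.indicator_of_notMem hy, mul_zero]
  have hm1 : MeasurableSet (Set.Ioc (x p) (x j) ×ˢ Set.Ioc (x j) (x q)) :=
    measurableSet_Ioc.prod measurableSet_Ioc
  have hm2 : MeasurableSet {r : ℝ × ℝ | (x p < r.1 ∧ x j < r.1) ∧ (r.1 ≤ r.2 ∧ r.2 ≤ x q)} :=
    ((measurableSet_lt measurable_const measurable_fst).inter
      (measurableSet_lt measurable_const measurable_fst)).inter
      ((measurableSet_le measurable_fst measurable_snd).inter
      (measurableSet_le measurable_snd measurable_const))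
  have hi1 := hi (Set.Ioc (x p) (x j) ×ˢ Set.Ioc (x j) (x q)) (by
    rintro y z ⟨h1, h2⟩
    simp only [Set.mem_Ioc] at h1 h2
    exact ⟨⟨min_le_of_right_le h1.1.le, by linarith⟩, min_le_of_left_le h2.1.le, h2.2⟩)
  have hi2 := hi {r : ℝ × ℝ | (x p < r.1 ∧ x j < r.1) ∧ (r.1 ≤ r.2 ∧ r.2 ≤ x q)} (by
    rintro y z ⟨⟨h1, h2⟩, h3, h4⟩
    simp only at h1 h2 h3 h4
    exact ⟨⟨min_le_of_right_le h1.le, by linarith⟩, min_le_of_left_le (by linarith), h4⟩)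
  rw [h1, h2, h3, setIntegral_iterated measurableSet_Ioc (fun _ => measurableSet_Ioc) hm1
      (fun _ _ => Iff.rfl) hi1,
    setIntegral_iterated' measurableSet_Ioc (fun _ => measurableSet_Ioc.inter measurableSet_Ioi) hm2
      _ hi2,
    setIntegral_iterated' measurableSet_Ioc (fun _ => measurableSet_Ioc) (hm1.union hm2) _
      (hi1.union hi2),
    setIntegral_union _ hm2 hi1 hi2]
  · ring
  · rw [Set.disjoint_left]
    rintro ⟨y, z⟩ ⟨h1, _⟩ ⟨⟨_, h3⟩, _⟩
    exact absurd h3 (not_lt.2 h1.2)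
  · intro y z
    simp only [Set.mem_union, Set.mem_prod, Set.mem_ofPred_eq, Set.mem_Ioc]
    constructor
    · rintro (⟨⟨h1, h2⟩, h3, h4⟩ | ⟨⟨h1, h2⟩, h3, h4⟩)
      · exact ⟨⟨h3, h4⟩, h1, by linarith⟩
      · exact ⟨⟨by linarith, h4⟩, h1, h3⟩
    · rintro ⟨⟨h1, h2⟩, h3, h4⟩
      rcases le_or_gt y (x j) with h | h
      · exact Or.inl ⟨⟨h3, h⟩, h1, h2⟩
      · exact Or.inr ⟨⟨h3, h⟩, h4, h2⟩
  · intro y z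
    simp only [Set.mem_inter_iff, Set.mem_ofPred_eq, Set.mem_Ioc, Set.mem_Ioi]
    constructor
    · rintro ⟨⟨h1, h2⟩, h3, h4⟩
      exact ⟨⟨by linarith, h4⟩, ⟨h1, h3⟩, h2⟩
    · rintro ⟨⟨h1, h2⟩, ⟨h3, h4⟩, h5⟩
      exact ⟨⟨h3, h5⟩, h4, h2⟩

end Commutation

/-! ### Comparison of the two orders of creation -/

section Commutation

variable {ι : Type*} [DecidableEq ι]

/-- A function that satisfies both one-step recursions in the region `x_q ≤ x_p`: the two ways of
joining the particles at `x_p` and `x_q` differ by the three-particle terms. -/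
theorem lowTerm_sub_upTerm_of_recursions {p q : ι} (hpq : p ≠ q) {s : Finset ι} (hp : p ∉ s)
    (hq : q ∉ s) (γ μ ν : ℂ) {W G H : (ι → ℝ) → ℂ} (hW : Continuous W)
    (hH : ∀ x t, H (Function.update x q t) = cis ν (t - x q) * H x)
    (hG : ∀ x t, G (Function.update x p t) = cis μ (t - x p) * G x)
    (hlow : ∀ x, x q ≤ x p → W x = H x + γ * ∑ j ∈ s, lowTerm q ν j W x)
    (hup : ∀ x, x q ≤ x p → W x = G x + γ * ∑ j ∈ s, upTerm p μ j W x)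
    (x : ι → ℝ) :
    upTerm p μ q W x - lowTerm q ν p W x =
      γ * ∑ j ∈ s, (lowTerm q ν j (upTerm p μ q W) x - upTerm p μ j (lowTerm q ν j W) x +
        (lowTerm q ν j (upTerm p μ j W) x - upTerm p μ j (lowTerm q ν p W) x)) := by
  have hjp : ∀ j ∈ s, j ≠ p := fun j hj h => hp (h ▸ hj)
  have hjq : ∀ j ∈ s, j ≠ q := fun j hj h => hq (h ▸ hj)
  set a := x p with ha
  set t := x q with ht
  set w : ℝ → ℝ → ℂ := fun P Q => W (put p q p x P Q 0) with hw
  have hwc : Continuous fun r : ℝ × ℝ => w r.1 r.2 :=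
    hW.comp ((continuous_put p q p x).comp (f := fun r : ℝ × ℝ => (r.1, r.2, 0)) (by fun_prop))
  have hwc1 : ∀ Q, Continuous fun P => w P Q := fun Q =>
    hwc.comp (Continuous.prodMk_left Q)
  have hwc2 : ∀ P, Continuous fun Q => w P Q := fun P =>
    hwc.comp (Continuous.prodMk_right P)
  have hcF : ∀ j z, Continuous fun y => W (put p q j x z (x j) y) := fun j z =>
    hW.comp ((continuous_put p q j x).comp (f := fun r : ℝ => (z, x j, r)) (by fun_prop))
  have hcF' : ∀ j y, Continuous fun z => W (put p q j x (x j) y z) := fun j y =>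
    hW.comp ((continuous_put p q j x).comp (f := fun r : ℝ => (x j, y, r)) (by fun_prop))
  -- For `Q ≤ P` the recursions amount formally to `∂w/∂Q = iνw + β` and `∂w/∂P = iμw - α`. The
  -- sources arise from the moving end point of each step integral. The indicators record on which
  -- side of `x j` that end point lies, so the sources may jump.
  set β : ℝ → ℝ → ℂ := fun z y =>
    γ * ∑ j ∈ s, (Set.Ioi (x j)).indicator (fun y => W (put p q j x z (x j) y)) y with hβ
  set α : ℝ → ℝ → ℂ := fun y z =>
    γ * ∑ j ∈ s, (Set.Iic (x j)).indicator (fun z => W (put p q j x (x j) y z)) z with hα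
  have hiβ : ∀ j z c d, IntegrableOn ((Set.Ioi (x j)).indicator
      (fun y => W (put p q j x z (x j) y))) (Set.Ioc c d) := fun j z c d =>
    ((hcF j z).integrableOn_Ioc).indicator measurableSet_Ioi
  have hiα : ∀ j z c d, IntegrableOn ((Set.Iic (x j)).indicator
      (fun y => W (put p q j x (x j) z y))) (Set.Ioc c d) := fun j z c d =>
    ((hcF' j z).integrableOn_Ioc).indicator measurableSet_Iic
  have hbdd : ∀ (g f : ℝ → ℂ) (c d : ℝ), Continuous g → IntegrableOn f (Set.Ioc c d) →
      IntegrableOn (fun v => g v * f v) (Set.Ioc c d) := by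
    intro g f c d hg hf
    obtain ⟨C, hC⟩ := (isCompact_Icc (a := c) (b := d)).exists_bound_of_continuousOn hg.continuousOn
    exact Integrable.bdd_mul (c := C) hf hg.aestronglyMeasurable (by
      filter_upwards [ae_restrict_mem measurableSet_Ioc] with p hp
      exact hC p (Set.Ioc_subset_Icc_self hp))
  have hbi : ∀ z c d, IntegrableOn (β z) (Set.Ioc c d) := fun z c d =>
    (integrable_finsetSum _ fun j _ => hiβ j z c d).const_mul γ
  have hai : ∀ y c d, IntegrableOn (α y) (Set.Ioc c d) := fun y c d =>
    (integrable_finsetSum _ fun j _ => hiα j y c d).const_mul γ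
  have hβint : ∀ (g : ℝ → ℂ) (z c d : ℝ), Continuous g → ∫ y in Set.Ioc c d, g y * β z y =
      γ * ∑ j ∈ s, ∫ y in Set.Ioc c d, g y *
        (Set.Ioi (x j)).indicator (fun y => W (put p q j x z (x j) y)) y := by
    intro g z c d hg
    rw [← integral_finsetSum _ fun j _ => hbdd _ _ _ _ hg (hiβ j z c d), ← integral_const_mul]
    refine integral_congr_ae (Filter.Eventually.of_forall fun y => ?_)
    simp only [hβ]
    rw [mul_left_comm, Finset.mul_sum]
  have hαint : ∀ (g : ℝ → ℂ) (z c d : ℝ), Continuous g → ∫ y in Set.Ioc c d, g y * α z y =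
      γ * ∑ j ∈ s, ∫ y in Set.Ioc c d, g y *
        (Set.Iic (x j)).indicator (fun y => W (put p q j x (x j) z y)) y := by
    intro g z c d hg
    rw [← integral_finsetSum _ fun j _ => hbdd _ _ _ _ hg (hiα j z c d), ← integral_const_mul]
    refine integral_congr_ae (Filter.Eventually.of_forall fun y => ?_)
    simp only [hα]
    rw [mul_left_comm, Finset.mul_sum]
  have hputp : ∀ P Q, put p q p x P Q 0 p = P := fun P Q => by simp [put]
  have hputq : ∀ P Q, put p q p x P Q 0 q = Q := fun P Q => by simp [put, hpq.symm]
  have hputj : ∀ P Q, ∀ j ∈ s, put p q p x P Q 0 j = x j := fun P Q j hj => by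
    simp [put, hjp j hj, hjq j hj]
  -- the two recursions along the coordinate axes
  have hβu : ∀ z, ∀ y ∈ Set.Icc a z, w z y = cis ν (y - a) * w z a +
      ∫ v in Set.Ioc a y, cis ν (y - v) * β z v := by
    intro z y hy
    have hstep : ∀ Q, Q ≤ z → w z Q = H (put p q p x z Q 0) + γ * ∑ j ∈ s,
        ∫ v in Set.Ioc (x j) Q, cis ν (Q - v) * W (put p q j x z (x j) v) := by
      intro Q hQ
      simp only [hw]
      rw [hlow _ (by rw [hputp, hputq]; exact hQ)]
      congr 2
      refine Finset.sum_congr rfl fun j hj => ?_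
      have h1 := hjp j hj
      have h2 := hjq j hj
      simp only [lowTerm]
      rw [hputq, hputj _ _ j hj]
      refine integral_congr_ae (Filter.Eventually.of_forall fun v => ?_)
      have : exch q j (put p q p x z Q 0) v = put p q j x z (x j) v := by
        funext l
        simp only [exch, put, Function.update_apply]
        grind
      simp only [this]
    have hHy : H (put p q p x z y 0) = cis ν (y - a) * H (put p q p x z a 0) := by
      have := hH (put p q p x z a 0) y
      rw [hputq] at this
      rw [← this]
      congr 1
      funext l
      simp only [put, Function.update_apply]
      grind
    rw [hstep y hy.2, hstep a (hy.1.trans hy.2), hHy, hβint _ _ _ _ (by fun_prop), mul_add, add_assoc]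
    congr 1
    rw [mul_left_comm, ← mul_add]
    congr 1
    rw [Finset.mul_sum, ← Finset.sum_add_distrib]
    refine Finset.sum_congr rfl fun j _ => ?_
    set f : ℝ → ℂ := fun v => cis ν (y - v) * W (put p q j x z (x j) v) with hf
    have hfc : Continuous f := Continuous.mul (by fun_prop) (hcF j z)
    have e1 : cis ν (y - a) * ∫ v in Set.Ioc (x j) a, cis ν (a - v) * W (put p q j x z (x j) v) =
        ∫ v in Set.Ioc (x j) a, f v := by
      rw [← integral_const_mul]
      refine integral_congr_ae (Filter.Eventually.of_forall fun v => ?_)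
      simp only [hf]
      rw [← mul_assoc, cis_mul_cis_of_eq ν (r := y - v) (by ring)]
    have e2 : ∫ v in Set.Ioc a y, cis ν (y - v) *
        (Set.Ioi (x j)).indicator (fun v => W (put p q j x z (x j) v)) v =
        ∫ v in Set.Ioc a y ∩ Set.Ioi (x j), f v := by
      rw [← setIntegral_indicator measurableSet_Ioi]
      refine integral_congr_ae (Filter.Eventually.of_forall fun v => ?_)
      simp only [hf]
      by_cases hv : v ∈ Set.Ioi (x j)
      · simp only [Set.indicator_of_mem hv]
      · simp only [Set.indicator_of_notMem hv, mul_zero]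
    rw [e1, e2, ← setIntegral_union]
    · congr 2
      ext v
      have := hy.1
      simp only [Set.mem_Ioc, Set.mem_union, Set.mem_inter_iff, Set.mem_Ioi]
      grind
    · rw [Set.disjoint_left]
      rintro v ⟨_, h1⟩ ⟨⟨h2, _⟩, _⟩
      exact absurd h2 (not_lt.2 h1)
    · exact measurableSet_Ioc.inter measurableSet_Ioi
    · exact hfc.integrableOn_Ioc
    · exact hfc.integrableOn_Ioc.mono_set Set.inter_subset_left
  -- The same for the second equation, started at the right end point `t`.
  have hαu : ∀ y, ∀ z ∈ Set.Icc y t, w z y = cis μ (z - t) * w t y +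
      ∫ v in Set.Ioc z t, cis μ (z - v) * α y v := by
    intro y z hz
    have hstep : ∀ P, y ≤ P → w P y = G (put p q p x P y 0) + γ * ∑ j ∈ s,
        ∫ v in Set.Ioc P (x j), cis μ (P - v) * W (put p q j x (x j) y v) := by
      intro P hP
      simp only [hw]
      rw [hup _ (by rw [hputp, hputq]; exact hP)]
      congr 2
      refine Finset.sum_congr rfl fun j hj => ?_
      have h1 := hjp j hj
      have h2 := hjq j hj
      simp only [upTerm]
      rw [hputp, hputj _ _ j hj]
      refine integral_congr_ae (Filter.Eventually.of_forall fun v => ?_)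
      have : exch p j (put p q p x P y 0) v = put p q j x (x j) y v := by
        funext l
        simp only [exch, put, Function.update_apply]
        grind
      simp only [this]
    have hGy : G (put p q p x z y 0) = cis μ (z - t) * G (put p q p x t y 0) := by
      have := hG (put p q p x t y 0) z
      rw [hputp] at this
      rw [← this]
      congr 1
      funext l
      simp only [put, Function.update_apply]
      grind
    rw [hstep z hz.1, hstep t (hz.1.trans hz.2), hGy, hαint _ _ _ _ (by fun_prop), mul_add, add_assoc]
    congr 1
    rw [mul_left_comm, ← mul_add]
    congr 1
    rw [Finset.mul_sum, ← Finset.sum_add_distrib]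
    refine Finset.sum_congr rfl fun j _ => ?_
    set f : ℝ → ℂ := fun v => cis μ (z - v) * W (put p q j x (x j) y v) with hf
    have hfc : Continuous f := Continuous.mul (by fun_prop) (hcF' j y)
    have e1 : cis μ (z - t) * ∫ v in Set.Ioc t (x j), cis μ (t - v) * W (put p q j x (x j) y v) =
        ∫ v in Set.Ioc t (x j), f v := by
      rw [← integral_const_mul]
      refine integral_congr_ae (Filter.Eventually.of_forall fun v => ?_)
      simp only [hf]
      rw [← mul_assoc, cis_mul_cis_of_eq μ (r := z - v) (by ring)]
    have e2 : ∫ v in Set.Ioc z t, cis μ (z - v) *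
        (Set.Iic (x j)).indicator (fun v => W (put p q j x (x j) y v)) v =
        ∫ v in Set.Ioc z t ∩ Set.Iic (x j), f v := by
      rw [← setIntegral_indicator measurableSet_Iic]
      refine integral_congr_ae (Filter.Eventually.of_forall fun v => ?_)
      simp only [hf]
      by_cases hv : v ∈ Set.Iic (x j)
      · simp only [Set.indicator_of_mem hv]
      · simp only [Set.indicator_of_notMem hv, mul_zero]
    rw [e1, e2, ← setIntegral_union]
    · congr 2
      ext v
      have := hz.2
      simp only [Set.mem_Ioc, Set.mem_union, Set.mem_inter_iff, Set.mem_Iic]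
      grind
    · rw [Set.disjoint_left]
      rintro v ⟨h1, _⟩ ⟨⟨_, h2⟩, _⟩
      exact absurd h1 (not_lt.2 h2)
    · exact measurableSet_Ioc.inter measurableSet_Iic
    · exact hfc.integrableOn_Ioc
    · exact hfc.integrableOn_Ioc.mono_set Set.inter_subset_left
  -- continuity of iterated integrals
  have hJc : ∀ {k : ℝ → ℝ → ℂ} {b c : ℝ → ℝ}, Continuous (fun r : ℝ × ℝ => k r.1 r.2) →
      Continuous b → Continuous c → Continuous fun y => ∫ z in Set.Ioc (b y) (c y), k y z :=
    fun hk hb hc => continuous_setIntegral_Ioc hk hb hc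
  -- assembling
  have hT2 : γ * ∑ j ∈ s, (lowTerm q ν j (upTerm p μ j W) x - upTerm p μ j (lowTerm q ν p W) x) =
      ∫ z in Set.Ioc a t, cis ν (t - z) * (cis μ (a - z) * w z z - w z a +
        Complex.I * (μ - ν) * ∫ y in Set.Ioc a z, cis μ (a - y) * w z y) := by
    have h1 : ∀ z ∈ Set.Ioc a t, cis ν (t - z) * (cis μ (a - z) * w z z - w z a +
        Complex.I * (μ - ν) * ∫ y in Set.Ioc a z, cis μ (a - y) * w z y) =
        γ * ∑ j ∈ s, cis ν (t - z) * ∫ y in Set.Ioc a z, cis μ (a - y) *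
          (Set.Ioi (x j)).indicator (fun y => W (put p q j x z (x j) y)) y := by
      intro z hz
      rw [← integral_cis_mul_source hz.1.le (hbi z _ _) (hβu z), hβint _ _ _ _ (by fun_prop),
        Finset.mul_sum, Finset.mul_sum, Finset.mul_sum]
      exact Finset.sum_congr rfl fun j _ => mul_left_comm _ _ _
    rw [setIntegral_congr_fun measurableSet_Ioc h1, integral_const_mul, integral_finsetSum]
    · congr 1
      exact Finset.sum_congr rfl fun j hj =>
        lowTerm_upTerm_sub' hpq (hjp j hj) (hjq j hj) μ ν hW x
    · intro j _
      have h2 : ∀ z, ∫ y in Set.Ioc a z, cis μ (a - y) *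
          (Set.Ioi (x j)).indicator (fun y => W (put p q j x z (x j) y)) y =
          ∫ y in Set.Ioc (max a (x j)) z, cis μ (a - y) * W (put p q j x z (x j) y) := by
        intro z
        have : Set.Ioc (max a (x j)) z = Set.Ioc a z ∩ Set.Ioi (x j) := by
          ext v
          simp only [Set.mem_Ioc, Set.mem_inter_iff, Set.mem_Ioi, max_lt_iff]
          tauto
        rw [this, ← setIntegral_indicator measurableSet_Ioi]
        refine integral_congr_ae (Filter.Eventually.of_forall fun v => ?_)
        by_cases hv : v ∈ Set.Ioi (x j)
        · simp only [Set.indicator_of_mem hv]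
        · simp only [Set.indicator_of_notMem hv, mul_zero]
      simp only [h2]
      apply Continuous.integrableOn_Ioc
      refine Continuous.mul (by fun_prop) (hJc ?_ (by fun_prop) (by fun_prop))
      refine Continuous.mul (by fun_prop) (hW.comp ?_)
      exact (continuous_put p q j x).comp (f := fun r : ℝ × ℝ => (r.1, x j, r.2)) (by fun_prop)
  have hT1 : γ * ∑ j ∈ s, (lowTerm q ν j (upTerm p μ q W) x - upTerm p μ j (lowTerm q ν j W) x) =
      -∫ y in Set.Ioc a t, cis μ (a - y) * (cis ν (t - y) * w y y - w t y +
        Complex.I * (μ - ν) * ∫ z in Set.Ioc y t, cis ν (t - z) * w z y) := by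
    have h1 : ∀ y ∈ Set.Ioc a t, cis μ (a - y) * (cis ν (t - y) * w y y - w t y +
        Complex.I * (μ - ν) * ∫ z in Set.Ioc y t, cis ν (t - z) * w z y) =
        γ * ∑ j ∈ s, cis μ (a - y) * ∫ z in Set.Ioc y t, cis ν (t - z) *
          (Set.Iic (x j)).indicator (fun z => W (put p q j x (x j) y z)) z := by
      intro y hy
      rw [← integral_cis_mul_source' hy.2 (hai y _ _) (hαu y), hαint _ _ _ _ (by fun_prop),
        Finset.mul_sum, Finset.mul_sum, Finset.mul_sum]
      exact Finset.sum_congr rfl fun j _ => mul_left_comm _ _ _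
    rw [setIntegral_congr_fun measurableSet_Ioc h1, integral_const_mul, integral_finsetSum,
      ← mul_neg, ← Finset.sum_neg_distrib]
    · congr 1
      exact Finset.sum_congr rfl fun j hj =>
        lowTerm_upTerm_sub hpq (hjp j hj) (hjq j hj) μ ν hW x
    · intro j _
      have h2 : ∀ y, ∫ z in Set.Ioc y t, cis ν (t - z) *
          (Set.Iic (x j)).indicator (fun z => W (put p q j x (x j) y z)) z =
          ∫ z in Set.Ioc y (min t (x j)), cis ν (t - z) * W (put p q j x (x j) y z) := by
        intro y
        have : Set.Ioc y (min t (x j)) = Set.Ioc y t ∩ Set.Iic (x j) := by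
          ext v
          simp only [Set.mem_Ioc, Set.mem_inter_iff, Set.mem_Iic, le_min_iff]
          tauto
        rw [this, ← setIntegral_indicator measurableSet_Iic]
        refine integral_congr_ae (Filter.Eventually.of_forall fun v => ?_)
        by_cases hv : v ∈ Set.Iic (x j)
        · simp only [Set.indicator_of_mem hv]
        · simp only [Set.indicator_of_notMem hv, mul_zero]
      simp only [h2]
      apply Continuous.integrableOn_Ioc
      refine Continuous.mul (by fun_prop) (hJc ?_ (by fun_prop) (by fun_prop))
      refine Continuous.mul (by fun_prop) (hW.comp ?_)
      exact (continuous_put p q j x).comp (f := fun r : ℝ × ℝ => (x j, r.1, r.2)) (by fun_prop)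
  have hup' : upTerm p μ q W x = ∫ y in Set.Ioc a t, cis μ (a - y) * w t y := by
    refine integral_congr_ae (Filter.Eventually.of_forall fun y => ?_)
    have : exch p q x y = put p q p x t y 0 := by
      funext l
      simp only [exch, put, Function.update_apply]
      grind
    simp only [this, ← ha, hw]
  have hlow' : lowTerm q ν p W x = ∫ z in Set.Ioc a t, cis ν (t - z) * w z a := by
    refine integral_congr_ae (Filter.Eventually.of_forall fun y => ?_)
    have : exch q p x y = put p q p x y a 0 := by
      funext l
      simp only [exch, put, Function.update_apply]
      grind
    simp only [this, ← ht, hw]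
  have hdiag : Continuous fun y => w y y := hwc.comp (continuous_id.prodMk continuous_id)
  have htri := setIntegral_triangle_swap (a := a) (t := t)
    (k := fun y z => cis μ (a - y) * (cis ν (t - z) * w z y)) (by
      refine integrableOn_of_continuous
        (k := fun y z => cis μ (a - y) * (cis ν (t - z) * w z y)) (m := a) (M := t) ?_ ?_
      · exact Continuous.mul (by fun_prop) (Continuous.mul (by fun_prop)
          (hwc.comp continuous_swap))
      · rintro y z ⟨h1, h2⟩
        exact ⟨⟨h1.1.le, h1.2⟩, h2.1.le, h2.2⟩)
  have hI2 : ∫ z in Set.Ioc a t, cis ν (t - z) * (cis μ (a - z) * w z z - w z a +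
        Complex.I * (μ - ν) * ∫ y in Set.Ioc a z, cis μ (a - y) * w z y) =
      (∫ z in Set.Ioc a t, cis ν (t - z) * (cis μ (a - z) * w z z)) -
        (∫ z in Set.Ioc a t, cis ν (t - z) * w z a) +
        Complex.I * (μ - ν) * ∫ z in Set.Ioc a t, ∫ y in Set.Ioc a z,
          cis μ (a - y) * (cis ν (t - z) * w z y) := by
    rw [← integral_sub, ← integral_const_mul, ← integral_add]
    · refine integral_congr_ae (Filter.Eventually.of_forall fun z => ?_)
      have : ∫ y in Set.Ioc a z, cis μ (a - y) * (cis ν (t - z) * w z y) =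
          cis ν (t - z) * ∫ y in Set.Ioc a z, cis μ (a - y) * w z y := by
        rw [← integral_const_mul]
        exact integral_congr_ae (Filter.Eventually.of_forall fun y => mul_left_comm _ _ _)
      simp only [this]
      ring
    · exact Continuous.integrableOn_Ioc (Continuous.sub
        (Continuous.mul (by fun_prop) (Continuous.mul (by fun_prop) hdiag))
        (Continuous.mul (by fun_prop) (hwc1 a)))
    · refine Continuous.integrableOn_Ioc (Continuous.mul continuous_const
        (hJc ?_ (by fun_prop) (by fun_prop)))
      exact Continuous.mul (by fun_prop) (Continuous.mul (by fun_prop) hwc)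
    · exact Continuous.integrableOn_Ioc
        (Continuous.mul (by fun_prop) (Continuous.mul (by fun_prop) hdiag))
    · exact Continuous.integrableOn_Ioc (Continuous.mul (by fun_prop) (hwc1 a))
  have hI1 : ∫ y in Set.Ioc a t, cis μ (a - y) * (cis ν (t - y) * w y y - w t y +
        Complex.I * (μ - ν) * ∫ z in Set.Ioc y t, cis ν (t - z) * w z y) =
      (∫ z in Set.Ioc a t, cis ν (t - z) * (cis μ (a - z) * w z z)) -
        (∫ y in Set.Ioc a t, cis μ (a - y) * w t y) +
        Complex.I * (μ - ν) * ∫ y in Set.Ioc a t, ∫ z in Set.Ioc y t,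
          cis μ (a - y) * (cis ν (t - z) * w z y) := by
    rw [← integral_sub, ← integral_const_mul, ← integral_add]
    · refine integral_congr_ae (Filter.Eventually.of_forall fun y => ?_)
      have : ∫ z in Set.Ioc y t, cis μ (a - y) * (cis ν (t - z) * w z y) =
          cis μ (a - y) * ∫ z in Set.Ioc y t, cis ν (t - z) * w z y := by
        rw [← integral_const_mul]
      simp only [this]
      ring
    · exact Continuous.integrableOn_Ioc (Continuous.sub
        (Continuous.mul (by fun_prop) (Continuous.mul (by fun_prop) hdiag))
        (Continuous.mul (by fun_prop) (hwc2 t)))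
    · refine Continuous.integrableOn_Ioc (Continuous.mul continuous_const
        (hJc ?_ (by fun_prop) (by fun_prop)))
      exact Continuous.mul (by fun_prop) (Continuous.mul (by fun_prop) (hwc.comp continuous_swap))
    · exact Continuous.integrableOn_Ioc
        (Continuous.mul (by fun_prop) (Continuous.mul (by fun_prop) hdiag))
    · exact Continuous.integrableOn_Ioc (Continuous.mul (by fun_prop) (hwc2 t))
  -- The contributions of `w z z` cancel, and the double integrals cancel because they cover the
  -- same triangle. The boundary terms `w t y` and `w z a` are the two ways of joining the
  -- particles.
  rw [Finset.sum_add_distrib, mul_add, hT1, hT2, hI1, hI2, htri, hup', hlow']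
  ring

/-- Pure algebra: the operator `1 - γ ∑ u j` is moved through the defect. Commutators with `j ≠ k`
vanish, and the recursions for `W`, `G`, `H` eliminate all single sums. What survives are the
commutators with `j = k` and the terms in which the two new particles meet, represented by `v` and
`m`. -/
theorem step_commutator {M : Type*} [AddCommGroup M] [Module ℂ M] (s : Finset ι) (γ : ℂ)
    (u l : ι → M →ₗ[ℂ] M) (v m : M →ₗ[ℂ] M) (W G H S : M)
    (hcomm : ∀ j ∈ s, ∀ k ∈ s, j ≠ k → u j (l k W) = l k (u j W))
    (hWG : W = G + γ • (∑ j ∈ s, u j W + v W))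
    (hGS : G = S + γ • ∑ j ∈ s, l j G)
    (hHS : H = S + γ • ∑ j ∈ s, u j H) :
    (W - γ • (∑ j ∈ s, l j W + m W) - H) -
      γ • ∑ j ∈ s, u j (W - γ • (∑ j ∈ s, l j W + m W) - H) =
      γ • (v W - m W -
        γ • ∑ j ∈ s, (l j (v W) - u j (l j W) + (l j (u j W) - u j (m W)))) := by
  have hsum1 : γ • ∑ j ∈ s, u j W = W - G - γ • v W := by
    nth_rewrite 2 [hWG]
    rw [smul_add]
    abel
  have hsum2 : γ • ∑ j ∈ s, u j H = H - S := by
    nth_rewrite 2 [hHS]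
    abel
  have hsum3 : γ • ∑ j ∈ s, l j G = G - S := by
    nth_rewrite 2 [hGS]
    abel
  have hk : ∀ k ∈ s, γ • ∑ j ∈ s, u j (l k W) =
      l k W - l k G - γ • l k (v W) + γ • (u k (l k W) - l k (u k W)) := by
    intro k hk
    have h1 : ∑ j ∈ s, u j (l k W) = ∑ j ∈ s, l k (u j W) + (u k (l k W) - l k (u k W)) := by
      rw [← Finset.add_sum_erase _ _ hk, ← Finset.add_sum_erase _ _ hk]
      rw [Finset.sum_congr rfl fun j hj => hcomm j (Finset.mem_of_mem_erase hj) k hk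
        (Finset.ne_of_mem_erase hj)]
      abel
    rw [h1, smul_add, ← map_sum, ← map_smul, hsum1, map_sub, map_sub, map_smul]
  have e1 : γ • ∑ j ∈ s, u j (W - γ • (∑ j ∈ s, l j W + m W) - H) = γ • ∑ j ∈ s, u j W -
      γ • ∑ k ∈ s, γ • ∑ j ∈ s, u j (l k W) -
      γ • γ • ∑ j ∈ s, u j (m W) - γ • ∑ j ∈ s, u j H := by
    simp only [map_sub, map_smul, map_add, map_sum, Finset.sum_sub_distrib,
      Finset.sum_add_distrib, smul_sub, smul_add, ← Finset.smul_sum]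
    rw [Finset.sum_comm (s := s) (t := s)]
    abel
  rw [e1, Finset.sum_congr rfl hk, hsum1, hsum2]
  simp only [Finset.sum_sub_distrib, Finset.sum_add_distrib, smul_sub, smul_add,
    ← Finset.smul_sum, hsum3]
  abel

/-- If `W` is obtained from `S` by first creating a particle at `q` from below and then one at `p`
from above, and `W'` is obtained in the opposite order, then `W = W'`. -/
theorem eq_of_step_recursions [Fintype ι] {p q : ι} (hpq : p ≠ q) {s : Finset ι} (hp : p ∉ s)
    (hq : q ∉ s) (γ μ ν : ℂ) (W W' G H S : C(ι → ℝ, ℂ))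
    (hH : ∀ x t, H (Function.update x q t) = cis ν (t - x q) * H x)
    (hG : ∀ x t, G (Function.update x p t) = cis μ (t - x p) * G x)
    (hWG : W = G + γ • (∑ j ∈ s, upLin p μ j W + upLin p μ q W))
    (hGS : G = S + γ • ∑ j ∈ s, lowLin q ν j G)
    (hWH : W' = H + γ • (∑ j ∈ s, lowLin q ν j W' + lowLin q ν p W'))
    (hHS : H = S + γ • ∑ j ∈ s, upLin p μ j H) : W = W' := by
  have hjp : ∀ j ∈ s, j ≠ p := fun j hj h => hp (h ▸ hj)
  have hjq : ∀ j ∈ s, j ≠ q := fun j hj h => hq (h ▸ hj)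
  -- The defect of `W` in the recursion that characterises `W'`.
  set Z : C(ι → ℝ, ℂ) := W - γ • (∑ j ∈ s, lowLin q ν j W + lowLin q ν p W) - H with hZ
  set d : C(ι → ℝ, ℂ) := ∑ j ∈ s, (lowLin q ν j (upLin p μ q W) - upLin p μ j (lowLin q ν j W) +
        (lowLin q ν j (upLin p μ j W) - upLin p μ j (lowLin q ν p W))) with hd
  have hcomm : ∀ j ∈ s, ∀ k ∈ s, j ≠ k → upLin p μ j (lowLin q ν k W) =
      lowLin q ν k (upLin p μ j W) := by
    intro j hj k hk hjk
    ext x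
    exact congrFun (upTerm_lowTerm_comm hpq (hjq j hj) (hjp k hk) hjk μ ν W.continuous) x
  have hkey : Z - γ • ∑ j ∈ s, upLin p μ j Z =
      γ • (upLin p μ q W - lowLin q ν p W - γ • d) :=
    step_commutator s γ (upLin p μ) (lowLin q ν) (upLin p μ q) (lowLin q ν p) W G H S hcomm hWG
      hGS hHS
  have hZx : ∀ x, Z x = γ * ∑ j ∈ s, upTerm p μ j Z x +
      γ * (upTerm p μ q W x - lowTerm q ν p W x - γ * d x) := by
    intro x
    have := DFunLike.congr_fun hkey x
    simp only [ContinuousMap.sub_apply, ContinuousMap.smul_apply, ContinuousMap.sum_apply,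
      smul_eq_mul, upLin_apply, lowLin_apply] at this
    rw [← this]; ring
  have hdx : ∀ x, d x = ∑ j ∈ s, (lowTerm q ν j (upTerm p μ q W) x -
      upTerm p μ j (lowTerm q ν j W) x +
        (lowTerm q ν j (upTerm p μ j W) x - upTerm p μ j (lowTerm q ν p W) x)) := by
    intro x
    simp only [hd, ContinuousMap.sum_apply]
    rfl
  -- In this half-space every inhomogeneous term is an integral over a subset of the empty interval
  -- `(x p, x q]`. Up-steps along `s` raise the coordinate `p` and keep the coordinate `q`, so they
  -- stay in the half-space.
  have hR : ∀ x, x q ≤ x p → Z x = 0 := by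
    refine fun x hx => eq_zero_of_up p μ γ s Z (fun x => x q ≤ x p) ?_ ?_ x hx
    · intro x hx j hj y h1 h2
      rw [exch_apply_self, exch_apply_of_ne_of_ne hpq.symm (hjq j hj).symm]
      linarith
    · intro x hx
      have h0 : d x = 0 := by
        rw [hdx]
        refine Finset.sum_eq_zero fun j hj => ?_
        rw [lowTerm_upTerm_sub hpq (hjp j hj) (hjq j hj) μ ν W.continuous,
          lowTerm_upTerm_sub' hpq (hjp j hj) (hjq j hj) μ ν W.continuous,
          Set.Ioc_eq_empty (not_lt.2 hx)]
        simp
      rw [hZx x, h0, upTerm_of_le hx, lowTerm_of_le hx]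
      ring
  have hlow : ∀ x, x q ≤ x p → W x = H x + γ * ∑ j ∈ s, lowTerm q ν j W x := by
    intro x hx
    have := hR x hx
    simp only [hZ, ContinuousMap.sub_apply, ContinuousMap.smul_apply, ContinuousMap.add_apply,
      ContinuousMap.sum_apply, smul_eq_mul, lowLin_apply, lowTerm_of_le hx] at this
    linear_combination this
  have hup : ∀ x, x q ≤ x p → W x = G x + γ * ∑ j ∈ s, upTerm p μ j W x := by
    intro x hx
    have := DFunLike.congr_fun hWG x
    simp only [ContinuousMap.smul_apply, ContinuousMap.add_apply,
      ContinuousMap.sum_apply, smul_eq_mul, upLin_apply, upTerm_of_le hx] at this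
    linear_combination this
  -- The identity for the inhomogeneity involves `W` only at points of the half-space once the
  -- differences are taken, so `hlow` and `hup` suffice to remove it at every `x`.
  have hZ0 : Z = 0 := by
    ext x
    refine eq_zero_of_up p μ γ s Z (fun _ => True) (fun _ _ _ _ _ _ _ => trivial) ?_ x trivial
    intro x _
    rw [hZx x, hdx x, lowTerm_sub_upTerm_of_recursions hpq hp hq γ μ ν W.continuous hH hG
      hlow hup x]
    ring
  have hWrec : W = H + γ • (∑ j ∈ s, lowLin q ν j W + lowLin q ν p W) := by
    rw [hZ, sub_sub, sub_eq_zero] at hZ0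
    nth_rewrite 1 [hZ0]
    abel
  rw [← sub_eq_zero]
  ext x
  -- Both functions solve the full recursion, in which the particle at `q` may also exchange with
  -- the one at `p`.
  refine eq_zero_of_low q ν γ (insert p s) (W - W' : C(ι → ℝ, ℂ)) (fun x => ?_) x
  have h1 := DFunLike.congr_fun hWrec x
  have h2 := DFunLike.congr_fun hWH x
  have h3 : ∀ j, lowTerm q ν j (W - W' : C(ι → ℝ, ℂ)) x = lowTerm q ν j W x - lowTerm q ν j W' x := by
    intro j
    rw [← lowLin_apply, map_sub]; rfl
  simp only [h3, Finset.sum_sub_distrib, Finset.sum_insert hp]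
  simp only [ContinuousMap.smul_apply, ContinuousMap.add_apply, ContinuousMap.sub_apply,
      ContinuousMap.sum_apply, smul_eq_mul, lowLin_apply] at h1 h2 ⊢
  linear_combination h1 - h2

end Commutation

/-! ### The creation operators satisfy one-step recursions -/

theorem setIntegral_pi_insertNth {n : ℕ} (p : Fin (n + 1)) (s : Fin (n + 1) → Set ℝ)
    (F : (Fin (n + 1) → ℝ) → ℂ) (hF : IntegrableOn F (Set.univ.pi s)) :
    ∫ y in Set.univ.pi s, F y = ∫ a in s p, ∫ y in Set.univ.pi fun j => s (p.succAbove j),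
      F (p.insertNth (α := fun _ => ℝ) a y) := by
  have hmp := (volume_preserving_piFinSuccAbove (fun _ : Fin (n + 1) => ℝ) p).symm
  have he := (MeasurableEquiv.piFinSuccAbove (fun _ : Fin (n + 1) => ℝ) p).symm.measurableEmbedding
  have hpre : (MeasurableEquiv.piFinSuccAbove (fun _ : Fin (n + 1) => ℝ) p).symm ⁻¹'
      Set.univ.pi s = s p ×ˢ Set.univ.pi fun j => s (p.succAbove j) := by
    ext ⟨a, y⟩
    simp only [Set.mem_preimage, Set.mem_univ_pi, Set.mem_prod]
    rw [Fin.forall_iff_succAbove p]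
    simp [MeasurableEquiv.piFinSuccAbove, Fin.insertNthEquiv]
  have hint := (hmp.integrableOn_comp_preimage he).2 hF
  rw [← hmp.setIntegral_preimage_emb he, hpre, Measure.volume_eq_prod, setIntegral_prod]
  · rfl
  · rw [hpre] at hint
    exact hint

theorem integrableOn_segBox {n : ℕ} (c : Fin (n + 1) → ℝ) {F : (Fin n → ℝ) → ℂ}
    (hF : Continuous F) : IntegrableOn F (segBox c) :=
  (hF.continuousOn.integrableOn_compact (isCompact_univ_pi fun m : Fin n =>
    isCompact_Icc (a := c m.succ) (b := c m.castSucc))).mono_set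
    (Set.pi_mono fun _ _ => Set.Ioc_subset_Icc_self)

theorem setIntegral_segBox_cons {n : ℕ} (c : Fin (n + 2) → ℝ) {F : (Fin (n + 1) → ℝ) → ℂ}
    (hF : Continuous F) :
    ∫ y in segBox c, F y = ∫ a in Set.Ioc (c 1) (c 0), ∫ y in segBox fun m => c m.succ,
      F (Fin.cons (α := fun _ => ℝ) a y) := by
  rw [segBox, setIntegral_pi_insertNth 0 _ _ (integrableOn_segBox c hF)]
  simp only [Fin.insertNth_zero', Fin.succAbove_zero]
  rfl

theorem setIntegral_segBox_snoc {n : ℕ} (c : Fin (n + 2) → ℝ) {F : (Fin (n + 1) → ℝ) → ℂ}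
    (hF : Continuous F) :
    ∫ y in segBox c, F y = ∫ a in Set.Ioc (c (Fin.last _)) (c (Fin.last n).castSucc),
      ∫ y in segBox fun m => c m.castSucc, F (Fin.snoc (α := fun _ => ℝ) y a) := by
  rw [segBox, setIntegral_pi_insertNth (Fin.last n) _ _ (integrableOn_segBox c hF)]
  simp only [Fin.insertNth_last', Fin.succAbove_last]
  rfl

/-- The ordering conditions in the elementary operators are automatic, since a chain that is not
decreasing has an empty box. The case distinctions can thus be dropped. -/
theorem segBox_eq_empty {n : ℕ} {c : Fin (n + 1) → ℝ} (hc : ¬ StrictAnti c) : segBox c = ∅ := by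
  rw [Fin.strictAnti_iff_succ_lt] at hc
  push Not at hc
  obtain ⟨m, hm⟩ := hc
  exact Set.univ_pi_eq_empty (i := m) (Set.Ioc_eq_empty (not_lt.2 hm))

variable {N n : ℕ} (μ : ℂ) (f : (Fin N → ℝ) → ℂ)

theorem eHatMinus_eq (i : Fin n ↪ Fin N) (x : Fin (N + 1) → ℝ) :
    eHatMinus μ i f x = cis μ (x (Fin.last N)) * ∫ y in segBox (bMinusChain i x),
      (∏ m, cis μ (x (i m).castSucc - y m)) * f (Function.extend i y fun j => x j.castSucc) := by
  rw [eHatMinus]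
  split_ifs with h
  · simp only [cis, Complex.ofReal_sub]
  · rw [segBox_eq_empty h, setIntegral_empty, mul_zero]

theorem eHatPlus_eq (i : Fin n ↪ Fin N) (x : Fin (N + 1) → ℝ) :
    eHatPlus μ i f x = cis μ (x 0) * ∫ y in segBox (bPlusChain i x),
      (∏ m, cis μ (x (i m).succ - y m)) * f (Function.extend i y fun j => x j.succ) := by
  rw [eHatPlus]
  split_ifs with h
  · simp only [cis, Complex.ofReal_sub]
  · rw [segBox_eq_empty h, setIntegral_empty, mul_zero]

theorem continuous_extend (i : Fin n ↪ Fin N) (z : Fin N → ℝ) :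
    Continuous fun y : Fin n → ℝ => Function.extend i y z := by
  refine continuous_pi fun j => ?_
  by_cases h : ∃ m, i m = j
  · obtain ⟨m, rfl⟩ := h
    simp only [i.injective.extend_apply]
    exact continuous_apply m
  · simp only [Function.extend_apply' _ _ _ h]
    exact continuous_const

variable {f}

theorem continuous_eHat_integrand (hf : Continuous f) (i : Fin n ↪ Fin N) (z w : Fin N → ℝ) :
    Continuous fun y : Fin n → ℝ => (∏ m, cis μ (z (i m) - y m)) * f (Function.extend i y w) :=
  Continuous.mul (continuous_finsetProd _ fun _ _ => by fun_prop)
    (hf.comp (continuous_extend i w))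

theorem extend_cons_apply {i : Fin (n + 1) ↪ Fin N} {e : Fin n ↪ Fin N} {j : Fin N}
    (hi : ⇑i = Fin.cons j e) (a : ℝ) (y : Fin n → ℝ) (z : Fin N → ℝ) :
    Function.extend i (Fin.cons (α := fun _ => ℝ) a y) z =
      Function.extend e y (Function.update z j a) := by
  have hj : ∀ m, e m ≠ j := fun m h => by
    have h1 : i m.succ = i 0 := by rw [hi]; simpa using h
    exact Fin.succ_ne_zero m (i.injective h1)
  have hi0 : i 0 = j := by rw [hi]; rfl
  have his : ∀ m : Fin n, i m.succ = e m := fun m => by rw [hi]; rfl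
  funext k
  by_cases hk : ∃ m, e m = k
  · obtain ⟨m, rfl⟩ := hk
    rw [e.injective.extend_apply, ← his, i.injective.extend_apply, Fin.cons_succ]
  · rw [Function.extend_apply' _ _ _ hk]
    by_cases hkj : k = j
    · rw [hkj, Function.update_self, ← hi0, i.injective.extend_apply, Fin.cons_zero]
    · rw [Function.update_of_ne hkj, Function.extend_apply']
      rintro ⟨m, hm⟩
      refine Fin.cases (fun h => ?_) (fun m h => ?_) m hm
      · exact hkj (by rw [← h, hi0])
      · exact hk ⟨m, by rw [← h, his]⟩

theorem extend_snoc_apply {i : Fin (n + 1) ↪ Fin N} {e : Fin n ↪ Fin N} {j : Fin N}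
    (hi : ⇑i = Fin.snoc (α := fun _ => Fin N) e j) (a : ℝ) (y : Fin n → ℝ) (z : Fin N → ℝ) :
    Function.extend i (Fin.snoc (α := fun _ => ℝ) y a) z =
      Function.extend e y (Function.update z j a) := by
  have hi0 : i (Fin.last n) = j := by rw [hi]; simp
  have his : ∀ m : Fin n, i m.castSucc = e m := fun m => by rw [hi]; simp
  funext k
  by_cases hk : ∃ m, e m = k
  · obtain ⟨m, rfl⟩ := hk
    rw [e.injective.extend_apply, ← his, i.injective.extend_apply, Fin.snoc_castSucc]
  · rw [Function.extend_apply' _ _ _ hk]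
    by_cases hkj : k = j
    · rw [hkj, Function.update_self, ← hi0, i.injective.extend_apply, Fin.snoc_last]
    · rw [Function.update_of_ne hkj, Function.extend_apply']
      rintro ⟨m, hm⟩
      refine Fin.lastCases (fun h => ?_) (fun m h => ?_) m hm
      · exact hkj (by rw [← h, hi0])
      · exact hk ⟨m, by rw [← h, his]⟩

/-- The outermost integration runs over `(x_j, x_{N+1}]`, where `j` is the first index. With `y` in
slot `j` and `x_j` in the last slot, the rest is the operator for the remaining indices, whose chain
now starts at `x_j`. The phases agree because `x_{N+1} + (x_j - y) = (x_{N+1} - y) + x_j`. -/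
theorem eHatMinus_succ (hf : Continuous f) {i : Fin (n + 1) ↪ Fin N} {e : Fin n ↪ Fin N}
    {j : Fin N} (hi : ⇑i = Fin.cons j e) :
    eHatMinus μ i f = lowTerm (Fin.last N) μ j.castSucc (eHatMinus μ e f) := by
  have hj : ∀ m, e m ≠ j := fun m h => by
    have h1 : i m.succ = i 0 := by rw [hi]; simpa using h
    exact Fin.succ_ne_zero m (i.injective h1)
  have hi0 : i 0 = j := by rw [hi]; rfl
  have his : ∀ m : Fin n, i m.succ = e m := fun m => by rw [hi]; rfl
  funext x
  rw [eHatMinus_eq, setIntegral_segBox_cons _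
    (continuous_eHat_integrand μ hf i (fun k => x k.castSucc) _), ← integral_const_mul]
  have e1 : bMinusChain i x 1 = x j.castSucc := by
    rw [← hi0]; rfl
  have e0 : bMinusChain i x 0 = x (Fin.last N) := rfl
  rw [e1, e0]
  refine setIntegral_congr_fun measurableSet_Ioc fun a _ => ?_
  have hne : ∀ m, (e m).castSucc ≠ j.castSucc := fun m h => hj m (Fin.castSucc_injective _ h)
  have hx : ∀ m, exch (Fin.last N) j.castSucc x a (e m).castSucc = x (e m).castSucc := fun m =>
    exch_apply_of_ne_of_ne (Fin.castSucc_lt_last _).ne (hne m) x a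
  have hchain : bMinusChain e (exch (Fin.last N) j.castSucc x a) = fun m => bMinusChain i x m.succ := by
    funext m
    refine Fin.cases ?_ (fun m => ?_) m
    · simp [bMinusChain, hi0]
    · simp [bMinusChain, his, hx]
  have hinit : (fun k : Fin N => exch (Fin.last N) j.castSucc x a k.castSucc) =
      Function.update (fun k => x k.castSucc) j a := by
    funext k
    by_cases hk : k = j
    · subst hk
      rw [exch_apply_of_ne (Fin.castSucc_lt_last _).ne, Function.update_self]
    · rw [Function.update_of_ne hk, exch_apply_of_ne_of_ne (Fin.castSucc_lt_last _).ne
        fun h => hk (Fin.castSucc_injective _ h)]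
  rw [eHatMinus_eq, hchain, exch_apply_self, hinit, ← mul_assoc,
    cis_mul_cis_of_eq μ (r := x (Fin.last N) + (x j.castSucc - a)) (by ring), cis_add, mul_assoc]
  congr 1
  rw [← integral_const_mul]
  refine integral_congr_ae (Filter.Eventually.of_forall fun y => ?_)
  simp only [Fin.prod_univ_succ, Fin.cons_zero, Fin.cons_succ, hi0, his, hx,
    extend_cons_apply hi, mul_assoc]

/-- The exchange puts `y > x_j` in slot `j`, above the top `x_j` of the new chain, so the chain is
not decreasing. Sums over the indices not yet used may therefore be extended to all indices. -/
theorem lowTerm_eHatMinus_of_mem (e : Fin n ↪ Fin N) (f : (Fin N → ℝ) → ℂ) {j : Fin N}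
    (hj : j ∈ Set.range e) : lowTerm (Fin.last N) μ j.castSucc (eHatMinus μ e f) = 0 := by
  funext x
  refine (setIntegral_congr_fun measurableSet_Ioc fun y hy => ?_).trans (integral_zero _ _)
  obtain ⟨m, rfl⟩ := hj
  rw [eHatMinus, if_neg, mul_zero]
  intro h
  have := h (Fin.succ_pos m)
  simp only [bMinusChain, Fin.cons_succ, Fin.cons_zero, exch_apply_self,
    exch_apply_of_ne (Fin.castSucc_lt_last (e m)).ne] at this
  exact absurd this (not_lt.2 hy.1.le)

/-- The new particle sits at the lower end of the chain for `ê⁺`, so it is the last index that is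
split off. -/
theorem eHatPlus_succ (hf : Continuous f) {i : Fin (n + 1) ↪ Fin N} {e : Fin n ↪ Fin N}
    {j : Fin N} (hi : ⇑i = Fin.snoc (α := fun _ => Fin N) e j) :
    eHatPlus μ i f = upTerm 0 μ j.succ (eHatPlus μ e f) := by
  have hj : ∀ m, e m ≠ j := fun m h => by
    have h1 : i m.castSucc = i (Fin.last n) := by rw [hi]; simpa using h
    exact (Fin.castSucc_lt_last m).ne (i.injective h1)
  have hi0 : i (Fin.last n) = j := by rw [hi]; simp
  have his : ∀ m : Fin n, i m.castSucc = e m := fun m => by rw [hi]; simp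
  funext x
  rw [eHatPlus_eq, setIntegral_segBox_snoc _
    (continuous_eHat_integrand μ hf i (fun k => x k.succ) _), ← integral_const_mul]
  have e1 : bPlusChain i x (Fin.last n).castSucc = x j.succ := by
    rw [← hi0, bPlusChain, Fin.snoc_castSucc]
  have e0 : bPlusChain i x (Fin.last _) = x 0 := by
    rw [bPlusChain, Fin.snoc_last]
  rw [e1, e0]
  refine setIntegral_congr_fun measurableSet_Ioc fun a _ => ?_
  have hne : ∀ m, (e m).succ ≠ j.succ := fun m h => hj m (Fin.succ_injective _ h)
  have hx : ∀ m, exch 0 j.succ x a (e m).succ = x (e m).succ := fun m =>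
    exch_apply_of_ne_of_ne (Fin.succ_ne_zero _) (hne m) x a
  have hchain : bPlusChain e (exch 0 j.succ x a) = fun m => bPlusChain i x m.castSucc := by
    funext m
    refine Fin.lastCases ?_ (fun m => ?_) m
    · rw [e1, bPlusChain, Fin.snoc_last, exch_apply_self]
    · simp only [bPlusChain, Fin.snoc_castSucc, his, hx]
  have hinit : (fun k : Fin N => exch 0 j.succ x a k.succ) =
      Function.update (fun k => x k.succ) j a := by
    funext k
    by_cases hk : k = j
    · subst hk
      rw [exch_apply_of_ne (Fin.succ_ne_zero _), Function.update_self]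
    · rw [Function.update_of_ne hk, exch_apply_of_ne_of_ne (Fin.succ_ne_zero _)
        fun h => hk (Fin.succ_injective _ h)]
  rw [eHatPlus_eq, hchain, exch_apply_self, hinit, ← mul_assoc,
    cis_mul_cis_of_eq μ (r := x 0 + (x j.succ - a)) (by ring), cis_add, mul_assoc]
  congr 1
  rw [← integral_const_mul]
  refine integral_congr_ae (Filter.Eventually.of_forall fun y => ?_)
  simp only [Fin.prod_univ_castSucc, Fin.snoc_last, Fin.snoc_castSucc, hi0, his, hx,
    extend_snoc_apply hi]
  ring

theorem upTerm_eHatPlus_of_mem (e : Fin n ↪ Fin N) (f : (Fin N → ℝ) → ℂ) {j : Fin N}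
    (hj : j ∈ Set.range e) : upTerm 0 μ j.succ (eHatPlus μ e f) = 0 := by
  funext x
  refine (setIntegral_congr_fun measurableSet_Ioc fun y hy => ?_).trans (integral_zero _ _)
  obtain ⟨m, rfl⟩ := hj
  rw [eHatPlus, if_neg, mul_zero]
  intro h
  have := h (Fin.castSucc_lt_last m)
  simp only [bPlusChain, Fin.snoc_castSucc, Fin.snoc_last, exch_apply_self,
    exch_apply_of_ne (Fin.succ_ne_zero (e m))] at this
  exact absurd this (not_lt.2 hy.2)

theorem eHatMinus_zero (i : Fin 0 ↪ Fin N) (f : (Fin N → ℝ) → ℂ) (x : Fin (N + 1) → ℝ) :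
    eHatMinus μ i f x = cis μ (x (Fin.last N)) * f fun j => x j.castSucc := by
  rw [eHatMinus_eq]
  have h1 : segBox (bMinusChain i x) = Set.univ := Set.eq_univ_of_forall fun y m => m.elim0
  have h2 : ∀ y : Fin 0 → ℝ, Function.extend i y (fun j => x j.castSucc) = fun j => x j.castSucc :=
    fun y => funext fun j => Function.extend_apply' _ _ _ fun ⟨m, _⟩ => m.elim0
  simp [h1, h2, Measure.real, volume_pi]

theorem eHatPlus_zero (i : Fin 0 ↪ Fin N) (f : (Fin N → ℝ) → ℂ) (x : Fin (N + 1) → ℝ) :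
    eHatPlus μ i f x = cis μ (x 0) * f fun j => x j.succ := by
  rw [eHatPlus_eq]
  have h1 : segBox (bPlusChain i x) = Set.univ := Set.eq_univ_of_forall fun y m => m.elim0
  have h2 : ∀ y : Fin 0 → ℝ, Function.extend i y (fun j => x j.succ) = fun j => x j.succ :=
    fun y => funext fun j => Function.extend_apply' _ _ _ fun ⟨m, _⟩ => m.elim0
  simp [h1, h2, Measure.real, volume_pi]

theorem continuous_eHatMinus {f : (Fin N → ℝ) → ℂ} (hf : Continuous f) (i : Fin n ↪ Fin N) :
    Continuous (eHatMinus μ i f) := by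
  induction n with
  | zero =>
    have : eHatMinus μ i f = _ := funext (eHatMinus_zero μ i f)
    rw [this]
    fun_prop
  | succ n ih =>
    obtain ⟨⟨e, j⟩, rfl⟩ := (Equiv.embeddingFinSucc n (Fin N)).symm.surjective i
    rw [eHatMinus_succ μ hf (Equiv.coe_embeddingFinSucc_symm _)]
    exact continuous_lowTerm _ _ _ (ih e)

/-- Appending a last value to an embedding. -/
def embeddingFinSnoc (n : ℕ) (α : Type*) :
    (Fin (n + 1) ↪ α) ≃ Σ e : Fin n ↪ α, {j // j ∉ Set.range e} where
  toFun i := ⟨Fin.castSuccEmb.trans i, i (Fin.last n), by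
    rintro ⟨m, hm⟩
    exact (Fin.castSucc_lt_last m).ne (i.injective hm)⟩
  invFun e := ⟨Fin.snoc (α := fun _ => α) e.1 e.2.1,
    Fin.snoc_injective_iff.2 ⟨e.1.injective, e.2.2⟩⟩
  left_inv i := by
    ext m
    refine Fin.lastCases ?_ (fun m => ?_) m
    · simp
    · simp
  right_inv e := by
    obtain ⟨e, j, hj⟩ := e
    have h : Fin.castSuccEmb.trans (⟨Fin.snoc (α := fun _ => α) e j,
        Fin.snoc_injective_iff.2 ⟨e.injective, hj⟩⟩ : Fin (n + 1) ↪ α) = e := by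
      ext m; simp
    refine Sigma.ext h ?_
    rw [Subtype.heq_iff_coe_eq]
    · simp
    · intro a
      simp [h]

theorem coe_embeddingFinSnoc_symm {n : ℕ} {α : Type*}
    (e : Σ e : Fin n ↪ α, {j // j ∉ Set.range e}) :
    ⇑((embeddingFinSnoc n α).symm e) = Fin.snoc (α := fun _ => α) e.1 e.2.1 := rfl

theorem continuous_eHatPlus {f : (Fin N → ℝ) → ℂ} (hf : Continuous f) (i : Fin n ↪ Fin N) :
    Continuous (eHatPlus μ i f) := by
  induction n with
  | zero =>
    have : eHatPlus μ i f = _ := funext (eHatPlus_zero μ i f)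
    rw [this]
    fun_prop
  | succ n ih =>
    obtain ⟨⟨e, j⟩, rfl⟩ := (embeddingFinSnoc n (Fin N)).symm.surjective i
    rw [eHatPlus_succ μ hf (coe_embeddingFinSnoc_symm _)]
    exact continuous_upTerm _ _ _ (ih e)

theorem lowTerm_sum {ι κ : Type*} [DecidableEq ι] (p : ι) (ν : ℂ) (j : ι) (s : Finset κ)
    (U : κ → (ι → ℝ) → ℂ) (hU : ∀ k, Continuous (U k)) :
    lowTerm p ν j (∑ k ∈ s, U k) = ∑ k ∈ s, lowTerm p ν j (U k) := by
  funext x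
  simp only [lowTerm, Finset.sum_apply, Finset.mul_sum]
  exact integral_finsetSum _ fun k _ => integrableOn_step p j ν (hU k) x _ _

theorem upTerm_sum {ι κ : Type*} [DecidableEq ι] (p : ι) (ν : ℂ) (j : ι) (s : Finset κ)
    (U : κ → (ι → ℝ) → ℂ) (hU : ∀ k, Continuous (U k)) :
    upTerm p ν j (∑ k ∈ s, U k) = ∑ k ∈ s, upTerm p ν j (U k) := by
  funext x
  simp only [upTerm, Finset.sum_apply, Finset.mul_sum]
  exact integral_finsetSum _ fun k _ => integrableOn_step p j ν (hU k) x _ _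

theorem sum_embedding_succ {M : Type*} [AddCommMonoid M] {X : (Fin (n + 1) ↪ Fin N) → M}
    {Y : (Fin n ↪ Fin N) → Fin N → M}
    (E : (Fin (n + 1) ↪ Fin N) ≃ Σ e : Fin n ↪ Fin N, {j // j ∉ Set.range e})
    (hX : ∀ e, X (E.symm e) = Y e.1 e.2.1) (hY : ∀ (e : Fin n ↪ Fin N), ∀ j ∈ Set.range e, Y e j = 0) :
    ∑ i, X i = ∑ j, ∑ e, Y e j := by
  classical
  rw [← E.symm.sum_comp, Fintype.sum_sigma, Finset.sum_comm]
  refine Finset.sum_congr rfl fun e _ => ?_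
  simp only [hX]
  rw [← Fintype.sum_subtype_add_sum_subtype (fun j => j ∈ Set.range e) (Y e),
    Finset.sum_eq_zero (f := fun j : {j // j ∈ Set.range e} => Y e j) fun j _ => hY e _ j.2,
    zero_add]

theorem sum_eHatMinus_succ {f : (Fin N → ℝ) → ℂ} (hf : Continuous f) (n : ℕ) :
    ∑ i : Fin (n + 1) ↪ Fin N, eHatMinus μ i f =
      ∑ j : Fin N, lowTerm (Fin.last N) μ j.castSucc (∑ i : Fin n ↪ Fin N, eHatMinus μ i f) := by
  rw [sum_embedding_succ (Y := fun e j => lowTerm (Fin.last N) μ j.castSucc (eHatMinus μ e f))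
    (Equiv.embeddingFinSucc n (Fin N))
    (fun e => eHatMinus_succ μ hf (Equiv.coe_embeddingFinSucc_symm e))
    (fun e j hj => lowTerm_eHatMinus_of_mem μ e f hj)]
  exact Finset.sum_congr rfl fun j _ =>
    (lowTerm_sum _ _ _ _ _ fun e => continuous_eHatMinus μ hf e).symm

theorem sum_eHatPlus_succ {f : (Fin N → ℝ) → ℂ} (hf : Continuous f) (n : ℕ) :
    ∑ i : Fin (n + 1) ↪ Fin N, eHatPlus μ i f =
      ∑ j : Fin N, upTerm 0 μ j.succ (∑ i : Fin n ↪ Fin N, eHatPlus μ i f) := by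
  rw [sum_embedding_succ (Y := fun e j => upTerm 0 μ j.succ (eHatPlus μ e f))
    (embeddingFinSnoc n (Fin N))
    (fun e => eHatPlus_succ μ hf (coe_embeddingFinSnoc_symm e))
    (fun e j hj => upTerm_eHatPlus_of_mem μ e f hj)]
  exact Finset.sum_congr rfl fun j _ =>
    (upTerm_sum _ _ _ _ _ fun e => continuous_eHatPlus μ hf e).symm

theorem isEmpty_embedding_succ (N : ℕ) : IsEmpty (Fin (N + 1) ↪ Fin N) :=
  ⟨fun i => absurd (Fintype.card_le_of_embedding i) (by simp)⟩

theorem continuous_bMinusFun (γ : ℝ) (μ : ℂ) {f : (Fin N → ℝ) → ℂ} (hf : Continuous f) :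
    Continuous (bMinusFun γ μ f) := by
  unfold bMinusFun
  have : ∀ n, Continuous (((γ : ℂ) ^ n) • ∑ i : Fin n ↪ Fin N, eHatMinus μ i f) := fun n => by
    refine Continuous.const_smul ?_ _
    have h := continuous_finsetSum Finset.univ fun (i : Fin n ↪ Fin N) _ =>
      continuous_eHatMinus μ hf i
    convert h using 1
    ext; simp
  have h := continuous_finsetSum (Finset.range (N + 1)) fun n _ => this n
  convert h using 1
  ext; simp

theorem continuous_bPlusFun (γ : ℝ) (μ : ℂ) {f : (Fin N → ℝ) → ℂ} (hf : Continuous f) :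
    Continuous (bPlusFun γ μ f) := by
  unfold bPlusFun
  have : ∀ n, Continuous (((γ : ℂ) ^ n) • ∑ i : Fin n ↪ Fin N, eHatPlus μ i f) := fun n => by
    refine Continuous.const_smul ?_ _
    have h := continuous_finsetSum Finset.univ fun (i : Fin n ↪ Fin N) _ =>
      continuous_eHatPlus μ hf i
    convert h using 1
    ext; simp
  have h := continuous_finsetSum (Finset.range (N + 1)) fun n _ => this n
  convert h using 1
  ext; simp

/-- The sum of the step operators maps the contribution of order `n` to that of order `n + 1`. Order
zero is the free term, and the rest of the series is a shifted copy of itself. -/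
theorem bMinusFun_eq (γ : ℝ) (μ : ℂ) {f : (Fin N → ℝ) → ℂ} (hf : Continuous f)
    (x : Fin (N + 1) → ℝ) :
    bMinusFun γ μ f x = cis μ (x (Fin.last N)) * f (fun j => x j.castSucc) +
      γ * ∑ j : Fin N, lowTerm (Fin.last N) μ j.castSucc (bMinusFun γ μ f) x := by
  have hS : ∀ n, Continuous (∑ i : Fin n ↪ Fin N, eHatMinus μ i f) := fun n => by
    have h := continuous_finsetSum Finset.univ fun (i : Fin n ↪ Fin N) _ =>
      continuous_eHatMinus μ hf i
    convert h using 1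
    ext; simp
  have hlow : ∀ j : Fin N, lowTerm (Fin.last N) μ j.castSucc (bMinusFun γ μ f) =
      ∑ n ∈ Finset.range (N + 1), ((γ : ℂ) ^ n) •
        lowTerm (Fin.last N) μ j.castSucc (∑ i : Fin n ↪ Fin N, eHatMinus μ i f) := by
    intro j
    rw [bMinusFun, lowTerm_sum _ _ _ _ _ fun n => (hS n).const_smul _]
    refine Finset.sum_congr rfl fun n _ => ?_
    funext x
    simp only [lowTerm, Pi.smul_apply, smul_eq_mul, mul_left_comm _ ((γ : ℂ) ^ n)]
    exact integral_const_mul _ _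
  set T : ℕ → ℂ := fun n => (∑ i : Fin n ↪ Fin N, eHatMinus μ i f) x with hT
  have h1 : ∀ n, ∑ j : Fin N, lowTerm (Fin.last N) μ j.castSucc
      (∑ i : Fin n ↪ Fin N, eHatMinus μ i f) x = T (n + 1) := by
    intro n
    simp only [hT]
    rw [sum_eHatMinus_succ μ hf, Finset.sum_apply]
  have h0 : T 0 = cis μ (x (Fin.last N)) * f fun j => x j.castSucc := by
    simp only [hT, Fintype.sum_unique]
    exact eHatMinus_zero μ _ f x
  -- The shifted sum reaches one order beyond the definition; no tuple of `N + 1` distinct indices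
  -- exists.
  have hlast : T (N + 1) = 0 := by
    have := isEmpty_embedding_succ N
    simp [hT]
  have hb : bMinusFun γ μ f x = ∑ n ∈ Finset.range (N + 1), (γ : ℂ) ^ n * T n := by
    simp only [bMinusFun, Finset.sum_apply, Pi.smul_apply, smul_eq_mul, hT]
  have hr : ∑ j : Fin N, lowTerm (Fin.last N) μ j.castSucc (bMinusFun γ μ f) x =
      ∑ n ∈ Finset.range (N + 1), (γ : ℂ) ^ n * T (n + 1) := by
    simp only [hlow, Finset.sum_apply, Pi.smul_apply, smul_eq_mul]
    rw [Finset.sum_comm]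
    simp only [← Finset.mul_sum, h1]
  rw [hb, hr, ← h0, Finset.sum_range_succ', Finset.sum_range_succ _ N, hlast, mul_zero, add_zero,
    Finset.mul_sum, pow_zero, one_mul, add_comm]
  congr 1
  exact Finset.sum_congr rfl fun n _ => by ring


theorem bPlusFun_eq (γ : ℝ) (μ : ℂ) {f : (Fin N → ℝ) → ℂ} (hf : Continuous f)
    (x : Fin (N + 1) → ℝ) :
    bPlusFun γ μ f x = cis μ (x 0) * f (fun j => x j.succ) +
      γ * ∑ j : Fin N, upTerm 0 μ j.succ (bPlusFun γ μ f) x := by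
  have hS : ∀ n, Continuous (∑ i : Fin n ↪ Fin N, eHatPlus μ i f) := fun n => by
    have h := continuous_finsetSum Finset.univ fun (i : Fin n ↪ Fin N) _ =>
      continuous_eHatPlus μ hf i
    convert h using 1
    ext; simp
  have hup : ∀ j : Fin N, upTerm 0 μ j.succ (bPlusFun γ μ f) =
      ∑ n ∈ Finset.range (N + 1), ((γ : ℂ) ^ n) •
        upTerm 0 μ j.succ (∑ i : Fin n ↪ Fin N, eHatPlus μ i f) := by
    intro j
    rw [bPlusFun, upTerm_sum _ _ _ _ _ fun n => (hS n).const_smul _]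
    refine Finset.sum_congr rfl fun n _ => ?_
    funext x
    simp only [upTerm, Pi.smul_apply, smul_eq_mul, mul_left_comm _ ((γ : ℂ) ^ n)]
    exact integral_const_mul _ _
  set T : ℕ → ℂ := fun n => (∑ i : Fin n ↪ Fin N, eHatPlus μ i f) x with hT
  have h1 : ∀ n, ∑ j : Fin N, upTerm 0 μ j.succ
      (∑ i : Fin n ↪ Fin N, eHatPlus μ i f) x = T (n + 1) := by
    intro n
    simp only [hT]
    rw [sum_eHatPlus_succ μ hf, Finset.sum_apply]
  have h0 : T 0 = cis μ (x 0) * f fun j => x j.succ := by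
    simp only [hT, Fintype.sum_unique]
    exact eHatPlus_zero μ _ f x
  have hlast : T (N + 1) = 0 := by
    have := isEmpty_embedding_succ N
    simp [hT]
  have hb : bPlusFun γ μ f x = ∑ n ∈ Finset.range (N + 1), (γ : ℂ) ^ n * T n := by
    simp only [bPlusFun, Finset.sum_apply, Pi.smul_apply, smul_eq_mul, hT]
  have hr : ∑ j : Fin N, upTerm 0 μ j.succ (bPlusFun γ μ f) x =
      ∑ n ∈ Finset.range (N + 1), (γ : ℂ) ^ n * T (n + 1) := by
    simp only [hup, Finset.sum_apply, Pi.smul_apply, smul_eq_mul]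
    rw [Finset.sum_comm]
    simp only [← Finset.mul_sum, h1]
  rw [hb, hr, ← h0, Finset.sum_range_succ', Finset.sum_range_succ _ N, hlast, mul_zero, add_zero,
    Finset.mul_sum, pow_zero, one_mul, add_comm]
  congr 1
  exact Finset.sum_congr rfl fun n _ => by ring

/-! ### Commutation on continuous functions -/

theorem exch_comp {ι κ : Type*} [DecidableEq ι] [DecidableEq κ] {e : κ → ι}
    (he : Function.Injective e) (p j : κ) (x : ι → ℝ) (y : ℝ) :
    exch (e p) (e j) x y ∘ e = exch p j (x ∘ e) y := by
  funext k
  simp only [exch, Function.comp_apply, Function.update_apply, he.eq_iff]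

theorem lowTerm_mul_comp {ι κ : Type*} [DecidableEq ι] [DecidableEq κ] {e : κ → ι}
    (he : Function.Injective e) (p j : κ) (ν : ℂ) (φ : (ι → ℝ) → ℂ) (U : (κ → ℝ) → ℂ) (x : ι → ℝ)
    (hφ : ∀ y, φ (exch (e p) (e j) x y) = φ x) :
    lowTerm (e p) ν (e j) (fun x => φ x * U (x ∘ e)) x = φ x * lowTerm p ν j U (x ∘ e) := by
  simp only [lowTerm, hφ, exch_comp he, mul_left_comm _ (φ x)]
  exact integral_const_mul _ _

theorem upTerm_mul_comp {ι κ : Type*} [DecidableEq ι] [DecidableEq κ] {e : κ → ι}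
    (he : Function.Injective e) (p j : κ) (ν : ℂ) (φ : (ι → ℝ) → ℂ) (U : (κ → ℝ) → ℂ) (x : ι → ℝ)
    (hφ : ∀ y, φ (exch (e p) (e j) x y) = φ x) :
    upTerm (e p) ν (e j) (fun x => φ x * U (x ∘ e)) x = φ x * upTerm p ν j U (x ∘ e) := by
  simp only [upTerm, hφ, exch_comp he, mul_left_comm _ (φ x)]
  exact integral_const_mul _ _

/-- The creation operators `b⁺` and `b⁻` commute on continuous functions. -/
theorem bPlusFun_bMinusFun_comm (γ : ℝ) (μ ν : ℂ) {N : ℕ} {f : (Fin N → ℝ) → ℂ}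
    (hf : Continuous f) :
    bPlusFun γ μ (bMinusFun γ ν f) = bMinusFun γ ν (bPlusFun γ μ f) := by
  have hg := continuous_bMinusFun γ ν hf
  have hh := continuous_bPlusFun γ μ hf
  have hinj : Function.Injective fun j : Fin N => j.castSucc.succ :=
    (Fin.succ_injective _).comp (Fin.castSucc_injective _)
  set s : Finset (Fin (N + 2)) := Finset.univ.map ⟨fun j : Fin N => j.castSucc.succ, hinj⟩ with hs
  -- Here `p` and `q` are the two new particles and `s` consists of the old ones. The five functions
  -- are the two products, the two sources in which one particle is already coupled and the other
  -- still free, and the source in which both are free.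
  have h := eq_of_step_recursions (p := (0 : Fin (N + 2))) (q := Fin.last (N + 1)) (s := s)
    (Fin.last_pos).ne ?_ ?_ γ μ ν
    ⟨_, continuous_bPlusFun γ μ hg⟩ ⟨_, continuous_bMinusFun γ ν hh⟩
    ⟨fun x => cis μ (x 0) * bMinusFun γ ν f (x ∘ Fin.succ),
      Continuous.mul (by fun_prop) (hg.comp (by fun_prop))⟩
    ⟨fun x => cis ν (x (Fin.last (N + 1))) * bPlusFun γ μ f (x ∘ Fin.castSucc),
      Continuous.mul (by fun_prop) (hh.comp (by fun_prop))⟩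
    ⟨fun x => cis μ (x 0) * cis ν (x (Fin.last (N + 1))) * f fun j => x j.castSucc.succ,
      Continuous.mul (by fun_prop) (hf.comp (by fun_prop))⟩ ?_ ?_ ?_ ?_ ?_ ?_
  · exact congrArg DFunLike.coe h
  · simp [hs, Fin.ext_iff]
  · simp only [hs, Finset.mem_map, Finset.mem_univ, true_and, Function.Embedding.coeFn_mk,
      Fin.ext_iff, Fin.val_succ, Fin.val_castSucc, Fin.val_last, not_exists]
    intro j
    have := j.2
    omega
  · intro x t
    simp only [ContinuousMap.coe_mk, Function.update_self]
    rw [← mul_assoc, cis_mul_cis_of_eq ν (r := t) (by ring)]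
    congr 2
    funext k
    simp [(Fin.castSucc_lt_last k).ne]
  · intro x t
    simp only [ContinuousMap.coe_mk, Function.update_self]
    rw [← mul_assoc, cis_mul_cis_of_eq μ (r := t) (by ring)]
    congr 2
  · ext x
    simp only [ContinuousMap.coe_mk, ContinuousMap.add_apply, ContinuousMap.smul_apply,
      ContinuousMap.sum_apply, smul_eq_mul, upLin_apply, hs, Finset.sum_map,
      Function.Embedding.coeFn_mk]
    rw [bPlusFun_eq γ μ hg, Fin.sum_univ_castSucc, Fin.succ_last]
    rfl
  · ext x
    simp only [ContinuousMap.coe_mk, ContinuousMap.add_apply, ContinuousMap.smul_apply,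
      ContinuousMap.sum_apply, smul_eq_mul, lowLin_apply, hs, Finset.sum_map,
      Function.Embedding.coeFn_mk]
    have h1 : ∀ j : Fin N, lowTerm (Fin.last (N + 1)) ν j.castSucc.succ
        (fun x => cis μ (x 0) * bMinusFun γ ν f (x ∘ Fin.succ)) x =
        cis μ (x 0) * lowTerm (Fin.last N) ν j.castSucc (bMinusFun γ ν f) (x ∘ Fin.succ) := by
      intro j
      refine lowTerm_mul_comp (Fin.succ_injective _) (Fin.last N) j.castSucc ν
        (fun x => cis μ (x 0)) _ x fun y => ?_
      rw [exch_apply_of_ne_of_ne (Fin.succ_ne_zero _).symm (Fin.succ_ne_zero _).symm]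
    simp only [h1]
    rw [bMinusFun_eq γ ν hf, ← Finset.mul_sum]
    simp only [Function.comp_apply, Fin.succ_last]
    ring
  · ext x
    simp only [ContinuousMap.coe_mk, ContinuousMap.add_apply, ContinuousMap.smul_apply,
      ContinuousMap.sum_apply, smul_eq_mul, lowLin_apply, hs, Finset.sum_map,
      Function.Embedding.coeFn_mk]
    rw [bMinusFun_eq γ ν hh, Fin.sum_univ_succ, Fin.castSucc_zero, add_comm (lowTerm _ _ _ _ _)]
    rfl
  · ext x
    simp only [ContinuousMap.coe_mk, ContinuousMap.add_apply, ContinuousMap.smul_apply,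
      ContinuousMap.sum_apply, smul_eq_mul, upLin_apply, hs, Finset.sum_map,
      Function.Embedding.coeFn_mk]
    have h1 : ∀ j : Fin N, upTerm 0 μ j.castSucc.succ
        (fun x => cis ν (x (Fin.last (N + 1))) * bPlusFun γ μ f (x ∘ Fin.castSucc)) x =
        cis ν (x (Fin.last (N + 1))) *
          upTerm 0 μ j.succ (bPlusFun γ μ f) (x ∘ Fin.castSucc) := by
      intro j
      refine upTerm_mul_comp (Fin.castSucc_injective _) 0 j.succ μ
        (fun x => cis ν (x (Fin.last (N + 1)))) _ x fun y => ?_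
      rw [exch_apply_of_ne_of_ne (Fin.castSucc_lt_last _).ne' (Fin.castSucc_lt_last _).ne']
    simp only [h1]
    rw [bPlusFun_eq γ μ hf, ← Finset.mul_sum]
    simp only [Function.comp_apply, Fin.castSucc_zero, Fin.succ_castSucc]
    ring

/-! ### The wavefunctions are created from the vacuum -/

/-- A difference of two solutions solves the homogeneous recursion. This criterion yields linearity
and permutation covariance of `b⁻` without manipulating sums over index tuples. -/
theorem bMinusFun_unique (γ : ℝ) (μ : ℂ) {N : ℕ} {f : (Fin N → ℝ) → ℂ} (hf : Continuous f)
    {U : (Fin (N + 1) → ℝ) → ℂ} (hU : Continuous U)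
    (h : ∀ x, U x = cis μ (x (Fin.last N)) * f (fun j => x j.castSucc) +
      γ * ∑ j : Fin N, lowTerm (Fin.last N) μ j.castSucc U x) : bMinusFun γ μ f = U := by
  have hb := continuous_bMinusFun γ μ hf
  funext x
  rw [← sub_eq_zero]
  refine eq_zero_of_low (Fin.last N) μ γ (Finset.univ.map Fin.castSuccEmb)
    (fun x => bMinusFun γ μ f x - U x) (fun x => ?_) x
  have h1 : ∀ j, lowTerm (Fin.last N) μ j (fun x => bMinusFun γ μ f x - U x) x =
      lowTerm (Fin.last N) μ j (bMinusFun γ μ f) x - lowTerm (Fin.last N) μ j U x := fun j =>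
    DFunLike.congr_fun (map_sub (lowLin (Fin.last N) μ j) ⟨_, hb⟩ ⟨_, hU⟩) x
  simp only [h1, Finset.sum_map, Fin.coe_castSuccEmb, Finset.sum_sub_distrib]
  rw [h x, bMinusFun_eq γ μ hf x]
  ring

theorem bPlusFun_unique (γ : ℝ) (μ : ℂ) {N : ℕ} {f : (Fin N → ℝ) → ℂ} (hf : Continuous f)
    {U : (Fin (N + 1) → ℝ) → ℂ} (hU : Continuous U)
    (h : ∀ x, U x = cis μ (x 0) * f (fun j => x j.succ) +
      γ * ∑ j : Fin N, upTerm 0 μ j.succ U x) : bPlusFun γ μ f = U := by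
  have hb := continuous_bPlusFun γ μ hf
  funext x
  rw [← sub_eq_zero]
  refine eq_zero_of_up 0 μ γ (Finset.univ.map (Fin.succEmb N))
    (fun x => bPlusFun γ μ f x - U x) (fun _ => True) (fun _ _ _ _ _ _ _ => trivial)
    (fun x _ => ?_) x trivial
  have h1 : ∀ j, upTerm 0 μ j (fun x => bPlusFun γ μ f x - U x) x =
      upTerm 0 μ j (bPlusFun γ μ f) x - upTerm 0 μ j U x := fun j =>
    DFunLike.congr_fun (map_sub (upLin 0 μ j) ⟨_, hb⟩ ⟨_, hU⟩) x
  simp only [h1, Finset.sum_map, Fin.coe_succEmb, Finset.sum_sub_distrib]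
  rw [h x, bPlusFun_eq γ μ hf x]
  ring

theorem lowTerm_linear {ι : Type*} [DecidableEq ι] (p : ι) (ν : ℂ) (j : ι) (a b : ℂ)
    {U V : (ι → ℝ) → ℂ} (hU : Continuous U) (hV : Continuous V) (x : ι → ℝ) :
    lowTerm p ν j (fun x => a * U x + b * V x) x = a * lowTerm p ν j U x + b * lowTerm p ν j V x := by
  have h := map_add (lowLin p ν j) (a • ⟨U, hU⟩) (b • ⟨V, hV⟩)
  rw [map_smul, map_smul] at h
  exact DFunLike.congr_fun h x

theorem upTerm_linear {ι : Type*} [DecidableEq ι] (p : ι) (ν : ℂ) (j : ι) (a b : ℂ)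
    {U V : (ι → ℝ) → ℂ} (hU : Continuous U) (hV : Continuous V) (x : ι → ℝ) :
    upTerm p ν j (fun x => a * U x + b * V x) x = a * upTerm p ν j U x + b * upTerm p ν j V x := by
  have h := map_add (upLin p ν j) (a • ⟨U, hU⟩) (b • ⟨V, hV⟩)
  rw [map_smul, map_smul] at h
  exact DFunLike.congr_fun h x

theorem bMinusFun_linear (γ : ℝ) (μ : ℂ) {N : ℕ} (a b : ℂ) {f g : (Fin N → ℝ) → ℂ}
    (hf : Continuous f) (hg : Continuous g) :
    bMinusFun γ μ (fun x => a * f x + b * g x) =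
      fun x => a * bMinusFun γ μ f x + b * bMinusFun γ μ g x := by
  have hbf := continuous_bMinusFun γ μ hf
  have hbg := continuous_bMinusFun γ μ hg
  refine bMinusFun_unique γ μ (by fun_prop) (by fun_prop) fun x => ?_
  simp only [lowTerm_linear _ _ _ _ _ hbf hbg, Finset.sum_add_distrib, ← Finset.mul_sum]
  rw [bMinusFun_eq γ μ hf x, bMinusFun_eq γ μ hg x]
  ring

theorem bPlusFun_linear (γ : ℝ) (μ : ℂ) {N : ℕ} (a b : ℂ) {f g : (Fin N → ℝ) → ℂ}
    (hf : Continuous f) (hg : Continuous g) :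
    bPlusFun γ μ (fun x => a * f x + b * g x) =
      fun x => a * bPlusFun γ μ f x + b * bPlusFun γ μ g x := by
  have hbf := continuous_bPlusFun γ μ hf
  have hbg := continuous_bPlusFun γ μ hg
  refine bPlusFun_unique γ μ (by fun_prop) (by fun_prop) fun x => ?_
  simp only [upTerm_linear _ _ _ _ _ hbf hbg, Finset.sum_add_distrib, ← Finset.mul_sum]
  rw [bPlusFun_eq γ μ hf x, bPlusFun_eq γ μ hg x]
  ring

theorem bMinusFun_comp_perm (γ : ℝ) (μ : ℂ) {N : ℕ} {f : (Fin N → ℝ) → ℂ} (hf : Continuous f)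
    (σ : Equiv.Perm (Fin N)) (τ : Equiv.Perm (Fin (N + 1))) (h0 : τ (Fin.last N) = Fin.last N)
    (h : ∀ j : Fin N, τ j.castSucc = (σ j).castSucc) :
    bMinusFun γ μ (fun z => f (z ∘ σ)) = fun x => bMinusFun γ μ f (x ∘ τ) := by
  have hb := continuous_bMinusFun γ μ hf
  refine bMinusFun_unique γ μ (by fun_prop) (by fun_prop) fun x => ?_
  have h1 : ∀ j : Fin N, lowTerm (Fin.last N) μ (σ j).castSucc (fun x => bMinusFun γ μ f (x ∘ τ)) x =
      lowTerm (Fin.last N) μ j.castSucc (bMinusFun γ μ f) (x ∘ τ) := by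
    intro j
    have := lowTerm_mul_comp τ.injective (Fin.last N) j.castSucc μ (fun _ => 1) (bMinusFun γ μ f) x
      fun _ => rfl
    simpa only [one_mul, h0, h] using this
  rw [← Equiv.sum_comp σ, Finset.sum_congr rfl fun j _ => h1 j]
  rw [bMinusFun_eq γ μ hf]
  simp only [Function.comp_apply, h0, h]
  rfl

theorem bPlusFun_comp_perm (γ : ℝ) (μ : ℂ) {N : ℕ} {f : (Fin N → ℝ) → ℂ} (hf : Continuous f)
    (σ : Equiv.Perm (Fin N)) (τ : Equiv.Perm (Fin (N + 1))) (h0 : τ 0 = 0)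
    (h : ∀ j : Fin N, τ j.succ = (σ j).succ) :
    bPlusFun γ μ (fun z => f (z ∘ σ)) = fun x => bPlusFun γ μ f (x ∘ τ) := by
  have hb := continuous_bPlusFun γ μ hf
  refine bPlusFun_unique γ μ (by fun_prop) (by fun_prop) fun x => ?_
  have h1 : ∀ j : Fin N, upTerm 0 μ (σ j).succ (fun x => bPlusFun γ μ f (x ∘ τ)) x =
      upTerm 0 μ j.succ (bPlusFun γ μ f) (x ∘ τ) := by
    intro j
    have := upTerm_mul_comp τ.injective 0 j.succ μ (fun _ => 1) (bPlusFun γ μ f) x fun _ => rfl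
    simpa only [one_mul, h0, h] using this
  rw [← Equiv.sum_comp σ, Finset.sum_congr rfl fun j _ => h1 j]
  rw [bPlusFun_eq γ μ hf]
  simp only [Function.comp_apply, h0, h]
  rfl

/-- The function `b⁻_{λ_N} ⋯ b⁻_{λ_1} 1`. -/
def created (γ : ℝ) : {N : ℕ} → (Fin N → ℂ) → (Fin N → ℝ) → ℂ
  | 0, _ => fun _ => 1
  | N + 1, lam => bMinusFun γ (lam (Fin.last N)) (created γ fun j : Fin N => lam j.castSucc)

theorem continuous_created (γ : ℝ) {N : ℕ} (lam : Fin N → ℂ) : Continuous (created γ lam) := by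
  induction N with
  | zero => exact continuous_const
  | succ N ih => exact continuous_bMinusFun _ _ (ih _)

theorem created_succ (γ : ℝ) {N : ℕ} (lam : Fin (N + 1) → ℂ) :
    created γ lam = bMinusFun γ (lam (Fin.last N)) (created γ fun j : Fin N => lam j.castSucc) := rfl

/-- On one particle both operators give the plane wave; commutation then carries `b⁺` past each
further `b⁻`. This gives access to the first particle, which the definition of `created` hides
innermost. -/
theorem created_succ' (γ : ℝ) {N : ℕ} (lam : Fin (N + 1) → ℂ) :
    created γ lam = bPlusFun γ (lam 0) (created γ fun j : Fin N => lam j.succ) := by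
  induction N with
  | zero =>
    funext x
    rw [created_succ, bMinusFun_eq γ _ (continuous_created γ _),
      bPlusFun_eq γ _ (continuous_created γ _)]
    simp [created]
  | succ N ih =>
    rw [created_succ, ih, ← bPlusFun_bMinusFun_comm γ _ _ (continuous_created γ _)]
    rfl

theorem planeWave_succ {N : ℕ} (lam : Fin (N + 1) → ℂ) (x : Fin (N + 1) → ℝ) :
    planeWave lam x = cis (lam (Fin.last N)) (x (Fin.last N)) *
      planeWave (fun j : Fin N => lam j.castSucc) fun j => x j.castSucc := by
  rw [planeWave, planeWave, cis, ← Complex.exp_add, Fin.sum_univ_castSucc]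
  congr 1
  ring

/-- When the last coordinate is the lowest, every step integral is over an empty interval and only
the free term remains. -/
theorem created_eq_planeWave (γ : ℝ) {N : ℕ} (lam : Fin N → ℂ) {x : Fin N → ℝ} (hx : Antitone x) :
    created γ lam x = planeWave lam x := by
  induction N with
  | zero => simp [created, planeWave]
  | succ N ih =>
    rw [created_succ, bMinusFun_eq γ _ (continuous_created γ _), planeWave_succ,
      ih _ (x := fun j => x j.castSucc) fun a b h => hx (Fin.castSucc_le_castSucc_iff.2 h),
      Finset.sum_eq_zero fun j _ => lowTerm_of_le (hx (Fin.le_last _)) _ _]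
    ring

theorem created_two (γ : ℝ) (lam : Fin 2 → ℂ) (h : lam 0 ≠ lam 1) (x : Fin 2 → ℝ) :
    created γ lam x = cis (lam 0) (x 0) * cis (lam 1) (x 1) + if x 0 < x 1 then
      γ / (Complex.I * (lam 0 - lam 1)) * (cis (lam 0) (x 1) * cis (lam 1) (x 0) -
        cis (lam 0) (x 0) * cis (lam 1) (x 1)) else 0 := by
  have hc := continuous_created γ fun j : Fin 1 => lam j.castSucc
  have h1 : ∀ z : Fin 1 → ℝ, created γ (fun j : Fin 1 => lam j.castSucc) z = cis (lam 0) (z 0) := by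
    intro z
    rw [created_succ, bMinusFun_eq γ _ (continuous_created γ _)]
    simp [created]
  have hle : ∀ z : Fin 2 → ℝ, z 1 ≤ z 0 → created γ lam z = cis (lam 1) (z 1) * cis (lam 0) (z 0) := by
    intro z hz
    rw [created_succ, bMinusFun_eq γ _ hc, h1, Fin.sum_univ_one]
    rw [lowTerm_of_le (by simpa using hz)]
    simp
  split_ifs with hx
  · have hne : Complex.I * (lam 0 - lam 1) ≠ 0 := mul_ne_zero Complex.I_ne_zero (sub_ne_zero.2 h)
    have hint : lowTerm (1 : Fin 2) (lam 1) 0 (created γ lam) x =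
        (cis (lam 0) (x 1) * cis (lam 1) (x 0) - cis (lam 0) (x 0) * cis (lam 1) (x 1)) /
          (Complex.I * (lam 0 - lam 1)) := by
      have hder : ∀ y : ℝ, HasDerivAt (fun y => cis (lam 0) y * cis (lam 1) (x 0 + x 1 - y) /
          (Complex.I * (lam 0 - lam 1))) (cis (lam 0) y * cis (lam 1) (x 0 + x 1 - y)) y := by
        intro y
        have h1 := hasDerivAt_cis (lam 0) y
        have h2 : HasDerivAt (fun y => cis (lam 1) (x 0 + x 1 - y))
            (-(Complex.I * lam 1 * cis (lam 1) (x 0 + x 1 - y))) y :=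
          (hasDerivAt_cis (lam 1) (x 0 + x 1 - y)).comp_const_sub _ _
        refine ((h1.mul h2).div_const _).congr_deriv ?_
        rw [div_eq_iff hne]
        ring
      have h3 : lowTerm (1 : Fin 2) (lam 1) 0 (created γ lam) x =
          ∫ y in Set.Ioc (x 0) (x 1), cis (lam 0) y * cis (lam 1) (x 0 + x 1 - y) := by
        refine setIntegral_congr_fun measurableSet_Ioc fun y hy => ?_
        have e0 : exch (1 : Fin 2) 0 x y 0 = y := exch_apply_of_ne (by decide) x y
        have e1 : exch (1 : Fin 2) 0 x y 1 = x 0 := exch_apply_self _ _ _ _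
        rw [hle _ (by rw [e0, e1]; exact hy.1.le), e0, e1, ← mul_assoc,
          cis_mul_cis_of_eq _ (r := x 0 + x 1 - y) (by ring), mul_comm]
      rw [h3, ← intervalIntegral.integral_of_le hx.le,
        intervalIntegral.integral_eq_sub_of_hasDerivAt (fun y _ => hder y)
          (by apply Continuous.intervalIntegrable; fun_prop)]
      rw [show x 0 + x 1 - x 1 = x 0 by ring, show x 0 + x 1 - x 0 = x 1 by ring]
      ring
    rw [created_succ, bMinusFun_eq γ _ hc, h1, Fin.sum_univ_one, ← created_succ]
    have : lowTerm (Fin.last 1) (lam (Fin.last 1)) (Fin.castSucc (0 : Fin 1)) (created γ lam) x = _ :=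
      hint
    rw [this]
    change cis (lam 1) (x 1) * cis (lam 0) (x 0) + _ = _
    field_simp
  · rw [hle x (not_lt.1 hx)]; ring

theorem swap_castSucc {N : ℕ} (a b j : Fin N) :
    Equiv.swap a.castSucc b.castSucc j.castSucc = (Equiv.swap a b j).castSucc := by
  simp only [Equiv.swap_apply_def, (Fin.castSucc_injective N).eq_iff]
  split_ifs <;> rfl

theorem swap_succ {N : ℕ} (a b j : Fin N) :
    Equiv.swap a.succ b.succ j.succ = (Equiv.swap a b j).succ := by
  simp only [Equiv.swap_apply_def, (Fin.succ_injective N).eq_iff]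
  split_ifs <;> rfl

/-- If the exchange avoids the last particle, the last creation operator is peeled off; if it avoids
the first, `created_succ'` peels off `b⁺`. Linearity and covariance reduce the claim to fewer
particles, until two are left and `created_two` is explicit. The coefficients are those of
`intReflection_planeWave`. -/
theorem created_comp_swap (γ : ℝ) {N : ℕ} (lam : Fin N → ℂ) (a b : Fin N) (hab : (b : ℕ) = a + 1)
    (h : lam a ≠ lam b) : (fun x => created γ lam (x ∘ Equiv.swap a b)) = fun x =>
      (1 - γ / (Complex.I * (lam a - lam b))) * created γ (lam ∘ Equiv.swap a b) x +
        γ / (Complex.I * (lam a - lam b)) * created γ lam x := by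
  induction N with
  | zero => exact a.elim0
  | succ N ih =>
    by_cases hb : (b : ℕ) < N
    · obtain ⟨a, rfl⟩ : ∃ a' : Fin N, a'.castSucc = a := ⟨⟨a, by omega⟩, rfl⟩
      obtain ⟨b, rfl⟩ : ∃ b' : Fin N, b'.castSucc = b := ⟨⟨b, hb⟩, rfl⟩
      have hs0 : Equiv.swap a.castSucc b.castSucc (Fin.last N) = Fin.last N :=
        Equiv.swap_apply_of_ne_of_ne (Fin.castSucc_lt_last _).ne' (Fin.castSucc_lt_last _).ne'
      rw [created_succ, ← bMinusFun_comp_perm γ _ (continuous_created γ _) (Equiv.swap a b) _ hs0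
        (swap_castSucc a b), ih (fun j => lam j.castSucc) a b hab h,
        bMinusFun_linear _ _ _ _ (continuous_created γ _) (continuous_created γ _)]
      funext x
      rw [created_succ γ (lam ∘ _)]
      simp only [Function.comp_apply, hs0, swap_castSucc]
      rfl
    · by_cases ha : a = 0
      · have hN : N = 1 := by have := b.2; subst ha; simp at hab; omega
        subst hN
        obtain rfl : b = 1 := Fin.ext (by subst ha; simpa using hab)
        subst ha
        funext x
        rw [created_two γ _ h, created_two γ _ h, created_two γ _ (by simpa using h.symm)]
        simp only [Function.comp_apply, Equiv.swap_apply_left, Equiv.swap_apply_right]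
        have hne : Complex.I * (lam 0 - lam 1) ≠ 0 := mul_ne_zero Complex.I_ne_zero (sub_ne_zero.2 h)
        have hneg : (γ : ℂ) / (Complex.I * (lam 1 - lam 0)) = -(γ / (Complex.I * (lam 0 - lam 1))) := by
          rw [← neg_sub (lam 0), mul_neg, div_neg]
        rw [hneg]
        rcases lt_trichotomy (x 0) (x 1) with hx | hx | hx
        · rw [if_neg hx.not_gt, if_pos hx, if_pos hx]; ring
        · rw [hx]; simp; ring
        · rw [if_pos hx, if_neg hx.not_gt, if_neg hx.not_gt]; ring
      · obtain ⟨a, rfl⟩ := Fin.exists_succ_eq.2 ha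
        obtain ⟨b, rfl⟩ : ∃ b', Fin.succ b' = b :=
          Fin.exists_succ_eq.2 (by rintro rfl; simp at hab)
        have hs0 : Equiv.swap a.succ b.succ 0 = 0 :=
          Equiv.swap_apply_of_ne_of_ne (Fin.succ_ne_zero _).symm (Fin.succ_ne_zero _).symm
        rw [created_succ', ← bPlusFun_comp_perm γ _ (continuous_created γ _) (Equiv.swap a b) _ hs0
          (swap_succ a b), ih (fun j => lam j.succ) a b (by simpa using hab) h,
          bPlusFun_linear _ _ _ _ (continuous_created γ _) (continuous_created γ _)]
        funext x
        rw [created_succ' γ (lam ∘ _)]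
        simp only [Function.comp_apply, hs0, swap_succ]
        rfl

/-! ### Integral-reflections of plane waves and the identification of `psi` -/

theorem continuous_planeWave {N : ℕ} (lam : Fin N → ℂ) : Continuous (planeWave lam) := by
  unfold planeWave
  fun_prop

theorem planeWave_comp_swap {N : ℕ} (lam : Fin N → ℂ) (a b : Fin N) (x : Fin N → ℝ) :
    planeWave lam (x ∘ Equiv.swap a b) = planeWave (lam ∘ Equiv.swap a b) x := by
  rw [planeWave, planeWave, ← Equiv.sum_comp (Equiv.swap a b)]
  simp

theorem planeWave_sub_smul {N : ℕ} (lam : Fin N → ℂ) (a b : Fin N) (x : Fin N → ℝ) (y : ℝ) :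
    planeWave lam (x - y • (Pi.single a 1 - Pi.single b 1)) =
      planeWave lam x * cis (lam b - lam a) y := by
  rw [planeWave, planeWave, cis, ← Complex.exp_add]
  congr 1
  have : ∑ j, lam j * (((x - y • (Pi.single a 1 - Pi.single b 1) : Fin N → ℝ) j : ℝ) : ℂ) =
      ∑ j, lam j * (x j : ℂ) - (lam a - lam b) * y := by
    have h1 : ∀ j, lam j * (((x - y • (Pi.single a 1 - Pi.single b 1) : Fin N → ℝ) j : ℝ) : ℂ) =
        lam j * (x j : ℂ) - ((if j = a then lam j * y else 0) - if j = b then lam j * y else 0) := by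
      intro j
      simp only [Pi.sub_apply, Pi.smul_apply, Pi.single_apply, smul_eq_mul]
      split_ifs <;> push_cast <;> ring
    simp only [h1, Finset.sum_sub_distrib, Finset.sum_ite_eq', Finset.mem_univ, if_true]
    ring
  rw [this]
  ring

theorem intReflection_planeWave (γ : ℝ) {N : ℕ} (lam : Fin N → ℂ) (a b : Fin N)
    (h : lam a ≠ lam b) : intReflection γ a b (planeWave lam) = fun x =>
      (1 - γ / (Complex.I * (lam a - lam b))) * planeWave (lam ∘ Equiv.swap a b) x +
        γ / (Complex.I * (lam a - lam b)) * planeWave lam x := by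
  funext x
  have hne : Complex.I * (lam b - lam a) ≠ 0 :=
    mul_ne_zero Complex.I_ne_zero (sub_ne_zero.2 h.symm)
  have hne' : Complex.I * (lam a - lam b) ≠ 0 :=
    mul_ne_zero Complex.I_ne_zero (sub_ne_zero.2 h)
  have hab : a ≠ b := fun hab => h (by rw [hab])
  have hx : x - (x a - x b) • (Pi.single a 1 - Pi.single b 1) = x ∘ Equiv.swap a b := by
    funext j
    by_cases ha : j = a
    · subst ha; simp [hab]
    · by_cases hb : j = b
      · subst hb; simp [hab]
      · simp [ha, hb, Equiv.swap_apply_of_ne_of_ne ha hb]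
  have hsw := planeWave_sub_smul lam a b x (x a - x b)
  rw [hx, planeWave_comp_swap] at hsw
  rw [intReflection, integralOp]
  simp only [planeWave_sub_smul]
  rw [intervalIntegral.integral_const_mul]
  have hder : ∀ y : ℝ, HasDerivAt (fun y => cis (lam b - lam a) y / (Complex.I * (lam b - lam a)))
      (cis (lam b - lam a) y) y := fun y =>
    ((hasDerivAt_cis (lam b - lam a) y).div_const _).congr_deriv (by field_simp)
  rw [intervalIntegral.integral_eq_sub_of_hasDerivAt (fun y _ => hder y)
    (by apply Continuous.intervalIntegrable; fun_prop), cis_zero, planeWave_comp_swap]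
  have hneg : Complex.I * (lam b - lam a) = -(Complex.I * (lam a - lam b)) := by ring
  rw [hneg, hsw]
  field_simp
  ring

/-- The graph of the propagation operator on the span of the plane waves with distinct wavenumbers. -/
def propagationGraph (γ : ℝ) (N : ℕ) :
    Submodule ℂ (((Fin N → ℝ) → ℂ) × ((Fin N → ℝ) → ℂ)) :=
  Submodule.span ℂ {r | ∃ lam : Fin N → ℂ, Function.Injective lam ∧
    r = (planeWave lam, created γ lam)}

theorem continuous_of_mem_propagationGraph {γ : ℝ} {N : ℕ} {r : ((Fin N → ℝ) → ℂ) × ((Fin N → ℝ) → ℂ)}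
    (hr : r ∈ propagationGraph γ N) : Continuous r.1 := by
  induction hr using Submodule.span_induction with
  | mem r h => obtain ⟨lam, -, rfl⟩ := h; exact continuous_planeWave lam
  | zero => exact continuous_const
  | add r s _ _ h1 h2 => exact h1.add h2
  | smul c r _ h => exact h.const_smul c

theorem eq_of_mem_propagationGraph {γ : ℝ} {N : ℕ} {r : ((Fin N → ℝ) → ℂ) × ((Fin N → ℝ) → ℂ)}
    (hr : r ∈ propagationGraph γ N) {x : Fin N → ℝ} (hx : Antitone x) : r.1 x = r.2 x := by
  induction hr using Submodule.span_induction with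
  | mem r h => obtain ⟨lam, -, rfl⟩ := h; exact (created_eq_planeWave γ lam hx).symm
  | zero => rfl
  | add r s _ _ h1 h2 => simp [h1, h2]
  | smul c r _ h => simp [h]

theorem integralOp_add {N : ℕ} (a b : Fin N) {f g : (Fin N → ℝ) → ℂ} (hf : Continuous f)
    (hg : Continuous g) : integralOp a b (f + g) = integralOp a b f + integralOp a b g := by
  funext x
  exact intervalIntegral.integral_add
    ((hf.comp (by fun_prop)).intervalIntegrable _ _) ((hg.comp (by fun_prop)).intervalIntegrable _ _)

/-- The integral-reflection of a plane wave and the coordinate exchange of the created function have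
equal coefficients, so the pair stays in the span. Injectivity of the wavevectors keeps the
denominators nonzero and survives permutation. Working with pairs avoids proving that the graph is
single-valued. -/
theorem reflection_mem_propagationGraph {γ : ℝ} {N : ℕ}
    {r : ((Fin N → ℝ) → ℂ) × ((Fin N → ℝ) → ℂ)} (hr : r ∈ propagationGraph γ N) {a b : Fin N}
    (hab : (b : ℕ) = a + 1) :
    (intReflection γ a b r.1, fun x => r.2 (x ∘ Equiv.swap a b)) ∈ propagationGraph γ N := by
  induction hr using Submodule.span_induction with
  | mem r h =>
    obtain ⟨lam, hlam, rfl⟩ := h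
    have hne : lam a ≠ lam b := fun h => by have := hlam h; subst this; omega
    simp only
    rw [intReflection_planeWave γ lam a b hne, created_comp_swap γ lam a b hab hne]
    refine Submodule.add_mem _ (x := ((1 - (γ : ℂ) / (Complex.I * (lam a - lam b))) •
      (planeWave (lam ∘ Equiv.swap a b), created γ (lam ∘ Equiv.swap a b)))) (Submodule.smul_mem _ _
      (Submodule.subset_span ⟨_, hlam.comp (Equiv.injective _), rfl⟩))
      (y := ((γ : ℂ) / (Complex.I * (lam a - lam b))) • (planeWave lam, created γ lam))
      (Submodule.smul_mem _ _ (Submodule.subset_span ⟨_, hlam, rfl⟩))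
  | zero =>
    convert Submodule.zero_mem (propagationGraph γ N) using 1
    refine Prod.ext (funext fun x => ?_) rfl
    simp [intReflection, integralOp]
  | add r s h1 h2 h3 h4 =>
    convert Submodule.add_mem _ h3 h4 using 1
    refine Prod.ext (funext fun x => ?_) rfl
    simp only [intReflection, Prod.fst_add, Pi.add_apply,
      integralOp_add a b (continuous_of_mem_propagationGraph h1)
        (continuous_of_mem_propagationGraph h2)]
    ring
  | smul c r _ h =>
    convert Submodule.smul_mem _ c h using 1
    refine Prod.ext (funext fun x => ?_) rfl
    simp only [intReflection, integralOp, Prod.smul_fst, Pi.smul_apply, smul_eq_mul,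
      intervalIntegral.integral_const_mul]
    ring

/-- Following the word of `w` letter by letter gives the pair of `w^γ e^{iλ}` and the permuted
created function. At the sorted point the components agree, and the sorting undoes the permutation.
Any word for `w` would serve. -/
theorem psi_eq_created (γ : ℝ) {N : ℕ} {lam : Fin N → ℂ} (hlam : Function.Injective lam) :
    psi γ lam = created γ lam := by
  have hword : ∀ l : List (Fin (N - 1)),
      (l.foldr (fun j g => intReflection γ (leftLabel j) (rightLabel j) g) (planeWave lam),
        fun x => created γ lam (x ∘ (l.map simpleTransposition).prod)) ∈ propagationGraph γ N := by
    intro l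
    induction l with
    | nil => exact Submodule.subset_span ⟨lam, hlam, rfl⟩
    | cons j l ih =>
      have := reflection_mem_propagationGraph ih (a := leftLabel j) (b := rightLabel j) rfl
      simp only [List.foldr_cons, List.map_cons, List.prod_cons, Equiv.Perm.coe_mul,
        ← Function.comp_assoc]
      exact this
  funext x
  have hanti : Antitone (x ∘ sortDesc x) := by
    intro a b h
    have := Tuple.monotone_sort (fun j => -x j) h
    exact neg_le_neg_iff.1 this
  have h := eq_of_mem_propagationGraph (hword (word (sortDesc x)⁻¹)) hanti
  rw [psi, propagation, intRepr]
  refine h.trans ?_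
  have hw : ((word (sortDesc x)⁻¹).map simpleTransposition).prod = (sortDesc x)⁻¹ :=
    (exists_word _).choose_spec
  simp only [hw]
  congr 1
  funext j
  simp

/-! ### The creation operator as a perturbation of the identity -/

variable {N n : ℕ}

theorem sum_chain_telescope (c : Fin (n + 1) → ℝ) :
    c 0 + ∑ m : Fin n, (c m.succ - c m.castSucc) = c (Fin.last n) := by
  have h1 := Fin.sum_univ_succ c
  have h2 := Fin.sum_univ_castSucc c
  rw [Finset.sum_sub_distrib]
  linarith

/-- The elementary term of the creation operator `b⁻`, applied to a source `G` in which the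
particle that is added is coupled to the others. -/
def shiftTerm (i : Fin n ↪ Fin N) (G : (Fin (N + 1) → ℝ) → ℂ) (x : Fin (N + 1) → ℝ) : ℂ :=
  ∫ y in segBox (bMinusChain i x), G (Fin.snoc (α := fun _ => ℝ)
    (Function.extend i y fun j => x j.castSucc)
    (x (Fin.last N) + ∑ m, (x (i m).castSucc - y m)))

theorem cis_add_sum (μ : ℂ) {ι : Type*} (s : Finset ι) (t : ℝ) (f : ι → ℝ) :
    cis μ (t + ∑ m ∈ s, f m) = cis μ t * ∏ m ∈ s, cis μ (f m) := by
  classical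
  induction s using Finset.induction_on with
  | empty => simp
  | insert a s ha ih =>
    rw [Finset.sum_insert ha, Finset.prod_insert ha, add_left_comm, cis_add, ih]
    ring

/-- All phases combine into one plane wave at a shifted last coordinate. This form makes sense for
sources that are not products. -/
theorem eHatMinus_eq_shiftTerm (μ : ℂ) (i : Fin n ↪ Fin N) (f : (Fin N → ℝ) → ℂ)
    (x : Fin (N + 1) → ℝ) : eHatMinus μ i f x =
      shiftTerm i (fun z => cis μ (z (Fin.last N)) * f fun j => z j.castSucc) x := by
  rw [eHatMinus_eq, ← integral_const_mul, shiftTerm]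
  refine integral_congr_ae (Filter.Eventually.of_forall fun y => ?_)
  simp only [Fin.snoc_last, Fin.snoc_castSucc, cis_add_sum, mul_assoc]

/-- The creation operator `b⁻`, applied to a source `G` in which the particle that is added is
coupled to the others. -/
def sourceOp (γ : ℝ) (G : (Fin (N + 1) → ℝ) → ℂ) (x : Fin (N + 1) → ℝ) : ℂ :=
  ∑ n ∈ Finset.range (N + 1), (γ : ℂ) ^ n * ∑ i : Fin n ↪ Fin N, shiftTerm i G x

theorem bMinusFun_eq_sourceOp (γ : ℝ) (μ : ℂ) (f : (Fin N → ℝ) → ℂ) :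
    bMinusFun γ μ f =
      sourceOp γ fun z => cis μ (z (Fin.last N)) * f fun j => z j.castSucc := by
  funext x
  simp only [bMinusFun, sourceOp, Finset.sum_apply, Pi.smul_apply, smul_eq_mul,
    eHatMinus_eq_shiftTerm]

theorem integrableOn_shiftTerm (i : Fin n ↪ Fin N) {G : (Fin (N + 1) → ℝ) → ℂ} (hG : Continuous G)
    (x : Fin (N + 1) → ℝ) : IntegrableOn (fun y => G (Fin.snoc (α := fun _ => ℝ)
      (Function.extend i y fun j => x j.castSucc)
      (x (Fin.last N) + ∑ m, (x (i m).castSucc - y m)))) (segBox (bMinusChain i x)) := by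
  refine integrableOn_segBox _ (hG.comp ?_)
  refine Continuous.finSnoc (A := fun _ => ℝ) (continuous_extend i _) (by fun_prop)

theorem sourceOp_add (γ : ℝ) {G H : (Fin (N + 1) → ℝ) → ℂ} (hG : Continuous G)
    (hH : Continuous H) : sourceOp γ (G + H) = sourceOp γ G + sourceOp γ H := by
  funext x
  have h : ∀ {n : ℕ} (i : Fin n ↪ Fin N),
      shiftTerm i (G + H) x = shiftTerm i G x + shiftTerm i H x := fun i =>
    integral_add (integrableOn_shiftTerm i hG x) (integrableOn_shiftTerm i hH x)
  simp only [sourceOp, Pi.add_apply, h, Finset.sum_add_distrib, mul_add]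

theorem sourceOp_smul (γ : ℝ) (c : ℂ) (G : (Fin (N + 1) → ℝ) → ℂ) :
    sourceOp γ (c • G) = c • sourceOp γ G := by
  funext x
  have h : ∀ {n : ℕ} (i : Fin n ↪ Fin N), shiftTerm i (c • G) x = c * shiftTerm i G x := fun i =>
    integral_const_mul _ _
  simp only [sourceOp, Pi.smul_apply, smul_eq_mul, h, Finset.mul_sum]
  refine Finset.sum_congr rfl fun n _ => Finset.sum_congr rfl fun i _ => ?_
  ring

theorem setIntegral_exp_sub_le {α : ℝ} (hα : 0 < α) (a b : ℝ) :
    ∫ y in Set.Ioc a b, Real.exp (α * (a - y)) ≤ α⁻¹ := by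
  rcases le_or_gt b a with h | h
  · rw [Set.Ioc_eq_empty (not_lt.2 h), setIntegral_empty]
    positivity
  · have hder : ∀ y : ℝ, HasDerivAt (fun y => -α⁻¹ * Real.exp (α * (a - y)))
        (Real.exp (α * (a - y))) y := fun y => by
      have h1 : HasDerivAt (fun y => α * (a - y)) (-α) y := by
        simpa using ((hasDerivAt_id y).const_sub a).const_mul α
      refine (h1.exp.const_mul (-α⁻¹)).congr_deriv ?_
      field_simp
    rw [← intervalIntegral.integral_of_le h.le,
      intervalIntegral.integral_eq_sub_of_hasDerivAt (fun y _ => hder y)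
        (by apply Continuous.intervalIntegrable; fun_prop)]
    have : 0 < α⁻¹ * Real.exp (α * (a - b)) := by positivity
    simp only [sub_self, mul_zero, Real.exp_zero]
    linarith

/-- The last coordinate is shifted by the nonpositive amounts `x_{i_m} - y_m`. The weight turns each
into a factor whose integral is at most `α⁻¹`. Telescoping along the chain shows that the shifted
coordinate stays between the ends of the chain, hence in the cube. -/
theorem norm_shiftTerm_le {xp xm α M : ℝ} (hα : 0 < α) (hM : 0 ≤ M) {G : (Fin (N + 1) → ℝ) → ℂ}
    (hG : ∀ z ∈ cube xp xm (N + 1), ‖G z‖ ≤ M * Real.exp (α * z (Fin.last N)))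
    (i : Fin n ↪ Fin N) {x : Fin (N + 1) → ℝ} (hx : x ∈ cube xp xm (N + 1)) :
    ‖shiftTerm i G x‖ ≤ M * Real.exp (α * x (Fin.last N)) * α⁻¹ ^ n := by
  set c := bMinusChain i x with hc
  have hcJ : ∀ m, c m ∈ Set.Icc xp xm := by
    intro m
    refine Fin.cases ?_ (fun m => ?_) m
    · simpa [hc, bMinusChain] using hx (Fin.last N) trivial
    · simpa [hc, bMinusChain] using hx (i m).castSucc trivial
  have hc0 : c 0 = x (Fin.last N) := rfl
  have hcs : ∀ m : Fin n, x (i m).castSucc = c m.succ := fun m => by simp [hc, bMinusChain]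
  have hbox : MeasurableSet (segBox c) := MeasurableSet.univ_pi fun _ => measurableSet_Ioc
  have hcont : Continuous fun y : Fin n → ℝ => ∏ m, Real.exp (α * (c m.succ - y m)) := by fun_prop
  have hint : IntegrableOn (fun y : Fin n → ℝ => M * Real.exp (α * x (Fin.last N)) *
      ∏ m, Real.exp (α * (c m.succ - y m))) (segBox c) :=
    ((continuous_const.mul hcont).continuousOn.integrableOn_compact
      (isCompact_univ_pi fun m : Fin n => isCompact_Icc (a := c m.succ) (b := c m.castSucc))).mono_set
      (Set.pi_mono fun _ _ => Set.Ioc_subset_Icc_self)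
  have hle : ‖shiftTerm i G x‖ ≤ ∫ y in segBox c, M * Real.exp (α * x (Fin.last N)) *
      ∏ m, Real.exp (α * (c m.succ - y m)) := by
    refine norm_integral_le_of_norm_le hint ?_
    filter_upwards [ae_restrict_mem hbox] with y hy
    have hy' : ∀ m : Fin n, c m.succ < y m ∧ y m ≤ c m.castSucc := fun m => hy m trivial
    refine (hG _ ?_).trans (le_of_eq ?_)
    · intro k _
      refine Fin.lastCases ?_ (fun k => ?_) k
      · rw [Fin.snoc_last]
        simp only [hcs, ← hc0]
        constructor
        · refine (hcJ (Fin.last n)).1.trans ?_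
          rw [← sum_chain_telescope c]
          gcongr with m
          exact (hy' m).2
        · refine le_trans ?_ (hcJ 0).2
          have : ∑ m : Fin n, (c m.succ - y m) ≤ 0 :=
            Finset.sum_nonpos fun m _ => sub_nonpos.2 (hy' m).1.le
          linarith
      · rw [Fin.snoc_castSucc]
        by_cases hk : ∃ m, i m = k
        · obtain ⟨m, rfl⟩ := hk
          rw [i.injective.extend_apply]
          exact ⟨(hcJ _).1.trans (hy' m).1.le, (hy' m).2.trans (hcJ _).2⟩
        · rw [Function.extend_apply' _ _ _ hk]
          exact hx _ trivial
    · rw [Fin.snoc_last, ← Real.exp_sum, mul_assoc, ← Real.exp_add, mul_add, Finset.mul_sum]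
      simp only [hcs]
  refine hle.trans ?_
  rw [integral_const_mul]
  refine mul_le_mul_of_nonneg_left ?_ (by positivity)
  rw [segBox, volume_pi, Measure.restrict_pi_pi, integral_fintype_prod_eq_prod
    (f := fun (m : Fin n) (y : ℝ) => Real.exp (α * (c m.succ - y)))]
  refine (Finset.prod_le_prod (fun m _ => ?_) fun m _ =>
    setIntegral_exp_sub_le hα (c m.succ) (c m.castSucc)).trans ?_
  · exact integral_nonneg fun _ => (Real.exp_pos _).le
  · simp

theorem shiftTerm_zero (i : Fin 0 ↪ Fin N) (G : (Fin (N + 1) → ℝ) → ℂ) (x : Fin (N + 1) → ℝ) :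
    shiftTerm i G x = G x := by
  have h1 : segBox (bMinusChain i x) = Set.univ := Set.eq_univ_of_forall fun y m => m.elim0
  have h2 : ∀ y : Fin 0 → ℝ, Function.extend i y (fun j => x j.castSucc) = fun j => x j.castSucc :=
    fun y => funext fun j => Function.extend_apply' _ _ _ fun ⟨m, _⟩ => m.elim0
  have h3 : Fin.snoc (α := fun _ => ℝ) (fun j : Fin N => x j.castSucc) (x (Fin.last N)) = x :=
    Fin.snoc_init_self x
  simp [shiftTerm, h1, h2, h3, Measure.real, volume_pi]

/-- For a large weight `α`, the operator `sourceOp` is close to the identity in the sup norm with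
weight `e^{-α x_{N+1}}`. -/
theorem exists_weight (γ : ℝ) (N : ℕ) : ∃ α : ℝ, 0 < α ∧ ∀ (xp xm M : ℝ), 0 ≤ M →
    ∀ G : (Fin (N + 1) → ℝ) → ℂ,
    (∀ z ∈ cube xp xm (N + 1), ‖G z‖ ≤ M * Real.exp (α * z (Fin.last N))) →
    ∀ x ∈ cube xp xm (N + 1), ‖sourceOp γ G x - G x‖ ≤ M / 4 * Real.exp (α * x (Fin.last N)) := by
  -- There are at most `N ^ k` tuples of length `k`, so order `k` contributes at most `r ^ k`, where
  -- `r = |γ| N / α`. The choice of `α` gives `r ≤ 1 / (4 (N + 1))`, and the `N` nonzero orders sum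
  -- to at most `1 / 4`.
  set α : ℝ := 4 * (N + 1) ^ 2 * (|γ| + 1) with hα
  have hα0 : 0 < α := by positivity
  refine ⟨α, hα0, fun xp xm M hM G hG x hx => ?_⟩
  set E := M * Real.exp (α * x (Fin.last N)) with hE
  have hE0 : 0 ≤ E := by positivity
  set r : ℝ := |γ| * N * α⁻¹ with hr
  have hr0 : 0 ≤ r := by positivity
  have hr1 : r * (4 * (N + 1)) ≤ 1 := by
    rw [hr, mul_right_comm, ← div_eq_mul_inv, div_le_one hα0, hα]
    have h1 : |γ| * N ≤ (|γ| + 1) * (N + 1) := by gcongr <;> linarith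
    nlinarith [mul_le_mul_of_nonneg_right h1 (by positivity : (0 : ℝ) ≤ 4 * (N + 1))]
  have hrle : r ≤ 1 := by nlinarith [Nat.cast_nonneg (α := ℝ) N]
  rw [sourceOp, Finset.sum_range_succ', pow_zero, one_mul, Fintype.sum_unique,
    shiftTerm_zero, add_sub_cancel_right]
  have hterm : ∀ k ∈ Finset.range N,
      ‖(γ : ℂ) ^ (k + 1) * ∑ i : Fin (k + 1) ↪ Fin N, shiftTerm i G x‖ ≤ E * r := by
    intro k _
    have h1 : ‖∑ i : Fin (k + 1) ↪ Fin N, shiftTerm i G x‖ ≤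
        (N : ℝ) ^ (k + 1) * (E * α⁻¹ ^ (k + 1)) := by
      refine (norm_sum_le_of_le _ fun i _ => norm_shiftTerm_le hα0 hM hG i hx).trans ?_
      rw [Finset.sum_const, nsmul_eq_mul]
      refine mul_le_mul_of_nonneg_right ?_ (by positivity)
      rw [Finset.card_univ, Fintype.card_embedding_eq, Fintype.card_fin, Fintype.card_fin]
      exact_mod_cast Nat.descFactorial_le_pow _ _
    rw [norm_mul, norm_pow, Complex.norm_real, Real.norm_eq_abs]
    calc |γ| ^ (k + 1) * ‖∑ i : Fin (k + 1) ↪ Fin N, shiftTerm i G x‖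
        ≤ |γ| ^ (k + 1) * ((N : ℝ) ^ (k + 1) * (E * α⁻¹ ^ (k + 1))) := by gcongr
      _ = E * r ^ (k + 1) := by rw [hr, mul_pow, mul_pow]; ring
      _ ≤ E * r := by
        gcongr
        exact pow_le_of_le_one hr0 hrle (Nat.succ_ne_zero k)
  refine (norm_sum_le_of_le _ hterm).trans ?_
  rw [Finset.sum_const, Finset.card_range, nsmul_eq_mul]
  have : (N : ℝ) * r ≤ 1 / 4 := by nlinarith
  calc (N : ℝ) * (E * r) = E * (N * r) := by ring
    _ ≤ E * (1 / 4) := by gcongr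
    _ = _ := by rw [hE]; ring

/-! ### Density of the span of the wavefunctions -/

variable {N : ℕ}

/-- The wavenumber `-i (k + 1 / (j + 2))`. -/
def gridNumber (j k : ℕ) : ℂ := -Complex.I * (((k + 1 / (j + 2) : ℝ)) : ℂ)

/-- On the negative imaginary axis the plane waves are real exponentials. Apart from a fixed factor
for each slot they are powers of `e^t`, which are closed under products and conjugation. -/
theorem cis_gridNumber (j k : ℕ) (t : ℝ) :
    cis (gridNumber j k) t = ((Real.exp (k * t) * Real.exp (1 / (j + 2) * t) : ℝ) : ℂ) := by
  rw [cis, gridNumber, ← Real.exp_add, Complex.ofReal_exp]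
  congr 1
  push_cast
  linear_combination -((k : ℂ) + 1 / (j + 2)) * t * Complex.I_sq

/-- Wavevectors with entries of the form `-i (k + 1 / (j + 2))`. -/
def gridVector (n : Fin N → ℕ) : Fin N → ℂ := fun j => gridNumber j (n j)

/-- The offsets `1 / (j + 2)` lie strictly between `0` and `1` and differ from slot to slot, so
equal wavenumbers force equal integer parts and then equal slots. Distinct wavenumbers are what
`psi_eq_created` asks for. -/
theorem gridVector_injective (n : Fin N → ℕ) : Function.Injective (gridVector n) := by
  intro j k h
  have h1 : ((n j : ℝ) + 1 / ((j : ℕ) + 2)) = n k + 1 / ((k : ℕ) + 2) := by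
    have := mul_left_cancel₀ (neg_ne_zero.2 Complex.I_ne_zero) h
    exact_mod_cast this
  have hb : ∀ m : Fin N, 0 < 1 / (((m : ℕ) : ℝ) + 2) ∧ 1 / (((m : ℕ) : ℝ) + 2) < 1 := fun m =>
    ⟨by positivity, by rw [div_lt_one (by positivity)]; linarith [Nat.cast_nonneg (α := ℝ) (m : ℕ)]⟩
  have h2 : n j = n k := by
    have h3 : (n j : ℝ) < n k + 1 := by linarith [(hb j).1, (hb k).2]
    have h4 : (n k : ℝ) < n j + 1 := by linarith [(hb k).1, (hb j).2]
    have h3' : n j < n k + 1 := by exact_mod_cast h3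
    have h4' : n k < n j + 1 := by exact_mod_cast h4
    omega
  rw [h2, add_right_inj, div_eq_div_iff (by positivity) (by positivity)] at h1
  refine Fin.ext ?_
  have : ((j : ℕ) : ℝ) = (k : ℕ) := by linarith
  exact_mod_cast this

/-- The span of the wavefunctions with wavevectors on the grid. -/
def gridSpan (γ : ℝ) (N : ℕ) : Submodule ℂ ((Fin N → ℝ) → ℂ) :=
  Submodule.span ℂ (Set.range fun n : Fin N → ℕ => created γ (gridVector n))

theorem continuous_of_mem_gridSpan {γ : ℝ} {f : (Fin N → ℝ) → ℂ} (hf : f ∈ gridSpan γ N) :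
    Continuous f := by
  induction hf using Submodule.span_induction with
  | mem f h => obtain ⟨n, rfl⟩ := h; exact continuous_created _ _
  | zero => exact continuous_const
  | add f g _ _ h1 h2 => exact h1.add h2
  | smul c f _ h => exact h.const_smul c

/-- Continuous functions that are uniform limits on the cube of elements of the grid span. -/
def gridClosure (γ xp xm : ℝ) (N : ℕ) : Submodule ℂ ((Fin N → ℝ) → ℂ) where
  carrier := {f | Continuous f ∧ ∀ ε > 0, ∃ g ∈ gridSpan γ N, ∀ x ∈ cube xp xm N, ‖f x - g x‖ ≤ ε}
  add_mem' := by
    rintro f f' ⟨hf, h⟩ ⟨hf', h'⟩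
    refine ⟨hf.add hf', fun ε hε => ?_⟩
    obtain ⟨g, hg, hfg⟩ := h (ε / 2) (half_pos hε)
    obtain ⟨g', hg', hfg'⟩ := h' (ε / 2) (half_pos hε)
    refine ⟨g + g', add_mem hg hg', fun x hx => ?_⟩
    rw [Pi.add_apply, Pi.add_apply, add_sub_add_comm, ← add_halves ε]
    exact norm_add_le_of_le (hfg x hx) (hfg' x hx)
  zero_mem' := ⟨continuous_const, fun ε hε => ⟨0, zero_mem _, fun x _ => by simpa using hε.le⟩⟩
  smul_mem' := by
    rintro c f ⟨hf, h⟩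
    refine ⟨hf.const_smul c, fun ε hε => ?_⟩
    obtain ⟨g, hg, hfg⟩ := h (ε / (‖c‖ + 1)) (by positivity)
    refine ⟨c • g, Submodule.smul_mem _ c hg, fun x hx => ?_⟩
    rw [Pi.smul_apply, Pi.smul_apply, ← smul_sub, norm_smul]
    calc ‖c‖ * ‖f x - g x‖ ≤ (‖c‖ + 1) * (ε / (‖c‖ + 1)) := by
          gcongr
          · linarith
          · exact hfg x hx
      _ = ε := by field_simp

theorem gridSpan_le_gridClosure (γ xp xm : ℝ) (N : ℕ) : gridSpan γ N ≤ gridClosure γ xp xm N :=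
  fun f hf => ⟨continuous_of_mem_gridSpan hf, fun ε hε => ⟨f, hf, fun x _ => by simpa using hε.le⟩⟩

theorem mem_gridClosure_of_approx {γ xp xm : ℝ} {f : (Fin N → ℝ) → ℂ} (hf : Continuous f)
    (h : ∀ ε > 0, ∃ g ∈ gridClosure γ xp xm N, ∀ x ∈ cube xp xm N, ‖f x - g x‖ ≤ ε) :
    f ∈ gridClosure γ xp xm N := by
  refine ⟨hf, fun ε hε => ?_⟩
  obtain ⟨g, hg, hfg⟩ := h (ε / 2) (half_pos hε)
  obtain ⟨g', hg', hgg'⟩ := hg.2 (ε / 2) (half_pos hε)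
  refine ⟨g', hg', fun x hx => ?_⟩
  rw [← sub_add_sub_cancel (f x) (g x), ← add_halves ε]
  exact norm_add_le_of_le (hfg x hx) (hgg' x hx)

theorem bMinusFun_mem_gridSpan {γ : ℝ} {f : (Fin N → ℝ) → ℂ} (hf : f ∈ gridSpan γ N) (k : ℕ) :
    bMinusFun γ (gridNumber N k) f ∈ gridSpan γ (N + 1) := by
  induction hf using Submodule.span_induction with
  | mem f h =>
    obtain ⟨n, rfl⟩ := h
    refine Submodule.subset_span ⟨Fin.snoc (α := fun _ => ℕ) n k, ?_⟩
    simp only [created_succ, gridVector, Fin.snoc_last, Fin.snoc_castSucc, Fin.val_last,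
      Fin.val_castSucc]
    rfl
  | zero =>
    have := bMinusFun_linear γ (gridNumber N k) 0 0 (f := (0 : (Fin N → ℝ) → ℂ))
      (g := 0) continuous_const continuous_const
    simp only [zero_mul, add_zero] at this
    have h0 : bMinusFun γ (gridNumber N k) (0 : (Fin N → ℝ) → ℂ) = 0 := this
    rw [h0]
    exact zero_mem _
  | add f g hf hg h1 h2 =>
    have := bMinusFun_linear γ (gridNumber N k) 1 1 (continuous_of_mem_gridSpan hf)
      (continuous_of_mem_gridSpan hg)
    simp only [one_mul] at this
    exact (congrArg (· ∈ gridSpan γ (N + 1)) this).mpr (add_mem h1 h2)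
  | smul c f hf h =>
    have := bMinusFun_linear γ (gridNumber N k) c 0 (continuous_of_mem_gridSpan hf)
      (continuous_of_mem_gridSpan hf)
    simp only [zero_mul, add_zero] at this
    exact (congrArg (· ∈ gridSpan γ (N + 1)) this).mpr (Submodule.smul_mem _ c h)

/-- On the compact cube the weighted and the plain sup norm are equivalent, so closeness of
`sourceOp` to the identity gives boundedness. Creation thus preserves uniform limits. -/
theorem exists_norm_bMinusFun_le (γ xp xm : ℝ) (μ : ℂ) (N : ℕ) : ∃ C : ℝ, 0 < C ∧
    ∀ (f : (Fin N → ℝ) → ℂ) (ε : ℝ), 0 ≤ ε → (∀ x ∈ cube xp xm N, ‖f x‖ ≤ ε) →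
      ∀ x ∈ cube xp xm (N + 1), ‖bMinusFun γ μ f x‖ ≤ C * ε := by
  obtain ⟨α, hα, h⟩ := exists_weight γ N
  obtain ⟨B, hB⟩ := (isCompact_Icc (a := xp) (b := xm)).exists_bound_of_continuousOn
    (f := fun t => cis μ t * ((Real.exp (-α * t) : ℝ) : ℂ)) (by fun_prop)
  obtain ⟨D, hD⟩ := (isCompact_Icc (a := xp) (b := xm)).exists_bound_of_continuousOn
    (f := fun t => Real.exp (α * t)) (by fun_prop)
  refine ⟨2 * (|B| + 1) * (|D| + 1), by positivity, fun f ε hε hf x hx => ?_⟩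
  set G : (Fin (N + 1) → ℝ) → ℂ := fun z => cis μ (z (Fin.last N)) * f fun j => z j.castSucc with hG
  have hGle : ∀ z ∈ cube xp xm (N + 1), ‖G z‖ ≤ (|B| + 1) * ε * Real.exp (α * z (Fin.last N)) := by
    intro z hz
    have h1 := hB (z (Fin.last N)) (hz _ trivial)
    rw [norm_mul, Complex.norm_real, Real.norm_eq_abs, Real.abs_exp] at h1
    have h2 : ‖cis μ (z (Fin.last N))‖ ≤ (|B| + 1) * Real.exp (α * z (Fin.last N)) := by
      have h3 : ‖cis μ (z (Fin.last N))‖ ≤ B * Real.exp (α * z (Fin.last N)) := by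
        rw [← mul_one ‖cis μ (z (Fin.last N))‖, ← Real.exp_zero,
          show (0 : ℝ) = -α * z (Fin.last N) + α * z (Fin.last N) by ring, Real.exp_add, ← mul_assoc]
        gcongr
      refine h3.trans ?_
      gcongr
      linarith [le_abs_self B]
    rw [hG, norm_mul]
    calc _ ≤ (|B| + 1) * Real.exp (α * z (Fin.last N)) * ε :=
          mul_le_mul h2 (hf _ fun j _ => hz _ trivial) (norm_nonneg _) (by positivity)
      _ = _ := by ring
  have h1 := h xp xm _ (by positivity) G hGle x hx
  have h2 := hGle x hx
  have h3 : Real.exp (α * x (Fin.last N)) ≤ |D| + 1 := by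
    have := hD _ (hx (Fin.last N) trivial)
    rw [Real.norm_eq_abs, Real.abs_exp] at this
    linarith [le_abs_self D]
  rw [bMinusFun_eq_sourceOp, ← hG, ← sub_add_cancel (sourceOp γ G x) (G x)]
  refine (norm_add_le_of_le h1 h2).trans ?_
  have h4 : 0 ≤ (|B| + 1) * ε := by positivity
  calc _ ≤ 2 * ((|B| + 1) * ε) * Real.exp (α * x (Fin.last N)) := by
        nlinarith [mul_nonneg h4 (Real.exp_pos (α * x (Fin.last N))).le]
    _ ≤ 2 * ((|B| + 1) * ε) * (|D| + 1) := by gcongr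
    _ = _ := by ring

theorem bMinusFun_mem_gridClosure {γ xp xm : ℝ} {f : (Fin N → ℝ) → ℂ}
    (hf : f ∈ gridClosure γ xp xm N) (k : ℕ) :
    bMinusFun γ (gridNumber N k) f ∈ gridClosure γ xp xm (N + 1) := by
  refine ⟨continuous_bMinusFun _ _ hf.1, fun ε hε => ?_⟩
  obtain ⟨C, hC, h⟩ := exists_norm_bMinusFun_le γ xp xm (gridNumber N k) N
  obtain ⟨g, hg, hfg⟩ := hf.2 (ε / C) (by positivity)
  refine ⟨_, bMinusFun_mem_gridSpan hg k, fun x hx => ?_⟩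
  have h1 := h (fun x => 1 * f x + -1 * g x) (ε / C) (by positivity)
    (fun x hx => by simpa [sub_eq_add_neg] using hfg x hx) x hx
  rw [bMinusFun_linear γ _ 1 (-1) hf.1 (continuous_of_mem_gridSpan hg), mul_div_cancel₀ _ hC.ne'] at h1
  simpa [sub_eq_add_neg] using h1

/-! ### Uniform density by Stone–Weierstrass and a Neumann iteration -/

variable {N : ℕ}

/-- Sums of products of a continuous function of the first `N` coordinates and an exponential in
the last one. -/
def sourceSpan (N : ℕ) : Submodule ℂ ((Fin (N + 1) → ℝ) → ℂ) :=
  Submodule.span ℂ {G | ∃ (f : (Fin N → ℝ) → ℂ) (k : ℕ), Continuous f ∧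
    G = fun z => cis (gridNumber N k) (z (Fin.last N)) * f fun j => z j.castSucc}

/-- On a product source `sourceOp` is a creation operator with grid wavenumber, and the inductive
hypothesis covers the function it acts on. -/
theorem sourceOp_mem_gridClosure {γ xp xm : ℝ}
    (ih : ∀ f : (Fin N → ℝ) → ℂ, Continuous f → f ∈ gridClosure γ xp xm N)
    {G : (Fin (N + 1) → ℝ) → ℂ} (hG : G ∈ sourceSpan N) :
    Continuous G ∧ sourceOp γ G ∈ gridClosure γ xp xm (N + 1) := by
  induction hG using Submodule.span_induction with
  | mem G h =>
    obtain ⟨f, k, hf, rfl⟩ := h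
    refine ⟨by fun_prop, ?_⟩
    rw [← bMinusFun_eq_sourceOp]
    exact bMinusFun_mem_gridClosure (ih f hf) k
  | zero =>
    refine ⟨continuous_const, ?_⟩
    have := sourceOp_smul γ 0 (0 : (Fin (N + 1) → ℝ) → ℂ)
    rw [zero_smul, zero_smul] at this
    rw [this]
    exact zero_mem _
  | add G H _ _ h1 h2 =>
    refine ⟨h1.1.add h2.1, ?_⟩
    rw [sourceOp_add γ h1.1 h2.1]
    exact add_mem h1.2 h2.2
  | smul c G _ h =>
    refine ⟨h.1.const_smul c, ?_⟩
    rw [sourceOp_smul]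
    exact Submodule.smul_mem _ c h.2

/-- Products of a continuous function of the first `N` coordinates and a power of the exponential
of the last one, as functions on a compact set. -/
def productFunctions (K : Set (Fin (N + 1) → ℝ)) : Set C(K, ℂ) :=
  {φ | ∃ (f : (Fin N → ℝ) → ℂ) (k : ℕ), Continuous f ∧ ∀ z : K,
    φ z = ((Real.exp (k * z.1 (Fin.last N)) : ℝ) : ℂ) * f fun j => z.1 j.castSucc}

theorem star_mem_productFunctions {K : Set (Fin (N + 1) → ℝ)} {φ : C(K, ℂ)}
    (hφ : φ ∈ productFunctions K) : star φ ∈ productFunctions K := by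
  obtain ⟨f, k, hf, h⟩ := hφ
  refine ⟨fun z => star (f z), k, hf.star, fun z => ?_⟩
  rw [ContinuousMap.star_apply, h, star_mul', Complex.star_def, Complex.conj_ofReal]

/-- The product functions are closed under multiplication and conjugation and include `1`, so the
generated star algebra is merely their linear span. -/
theorem adjoin_productFunctions (K : Set (Fin (N + 1) → ℝ)) :
    Subalgebra.toSubmodule (StarAlgebra.adjoin ℂ (productFunctions K)).toSubalgebra =
      Submodule.span ℂ (productFunctions K) := by
  have hstar : star (productFunctions K) = productFunctions K :=
    Set.ext fun φ => ⟨fun h => by simpa using star_mem_productFunctions h,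
      fun h => star_mem_productFunctions h⟩
  rw [StarAlgebra.adjoin_toSubalgebra, hstar, Set.union_self]
  refine Algebra.adjoin_eq_span_of_subset ℂ (Set.Subset.trans (fun φ hφ => ?_)
    Submodule.subset_span)
  refine Submonoid.closure_induction (fun _ => id) ⟨fun _ => 1, 0, continuous_const, by simp⟩ ?_ hφ
  rintro φ ψ - - ⟨f, k, hf, h⟩ ⟨g, l, hg, h'⟩
  refine ⟨fun z => f z * g z, k + l, hf.mul hg, fun z => ?_⟩
  rw [ContinuousMap.mul_apply, h, h']
  push_cast
  rw [add_mul, Complex.exp_add]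
  ring

theorem adjoin_productFunctions_separatesPoints (K : Set (Fin (N + 1) → ℝ)) :
    (StarAlgebra.adjoin ℂ (productFunctions K)).SeparatesPoints := by
  intro x y hxy
  obtain ⟨j, hj⟩ : ∃ j, x.1 j ≠ y.1 j := by
    by_contra! h
    exact hxy (Subtype.ext (funext h))
  induction j using Fin.lastCases with
  | last =>
    let φ : C(K, ℂ) := ⟨fun z => ((Real.exp (z.1 (Fin.last N)) : ℝ) : ℂ),
      Complex.continuous_ofReal.comp (Real.continuous_exp.comp
        ((continuous_apply _).comp continuous_subtype_val))⟩
    refine ⟨φ, ⟨φ, StarAlgebra.subset_adjoin ℂ _ ⟨fun _ => 1, 1, continuous_const, fun z => ?_⟩,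
      rfl⟩, fun h => hj ?_⟩
    · simp [φ]
    · exact Real.exp_injective (Complex.ofReal_injective h)
  | cast j =>
    let φ : C(K, ℂ) := ⟨fun z => (z.1 j.castSucc : ℂ),
      Complex.continuous_ofReal.comp ((continuous_apply _).comp continuous_subtype_val)⟩
    refine ⟨φ, ⟨φ, StarAlgebra.subset_adjoin ℂ _ ⟨fun z => (z j : ℂ), 0, by fun_prop, fun z => ?_⟩,
      rfl⟩, fun h => hj ?_⟩
    · simp [φ]
    · exact Complex.ofReal_injective h

/-- With the offset, the exponentials of the last coordinate are not closed under multiplication.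
Dividing by the fixed weight `w` removes the offset, Stone–Weierstrass applies to the quotient, and
multiplying back costs only a bounded factor. -/
theorem exists_sourceSpan_approx (xp xm : ℝ) {G : (Fin (N + 1) → ℝ) → ℂ} (hG : Continuous G) {ε : ℝ}
    (hε : 0 < ε) : ∃ F ∈ sourceSpan N, ∀ z ∈ cube xp xm (N + 1), ‖G z - F z‖ ≤ ε := by
  set K := cube xp xm (N + 1) with hK
  have : CompactSpace K := isCompact_iff_compactSpace.1 (isCompact_cube xp xm (N + 1))
  set w : (Fin (N + 1) → ℝ) → ℝ := fun z => Real.exp (1 / (N + 2) * z (Fin.last N)) with hw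
  have hwc : Continuous w := by fun_prop
  have hw0 : ∀ z, w z ≠ 0 := fun z => (Real.exp_pos _).ne'
  obtain ⟨B, hB⟩ := (isCompact_cube xp xm (N + 1)).exists_bound_of_continuousOn hwc.continuousOn
  let φ : C(K, ℂ) := ⟨fun z => ((w z.1)⁻¹ : ℝ) * G z.1, by
    refine Continuous.mul ?_ (hG.comp continuous_subtype_val)
    exact Complex.continuous_ofReal.comp ((hwc.comp continuous_subtype_val).inv₀ fun z => hw0 z)⟩
  have hφ : φ ∈ (StarAlgebra.adjoin ℂ (productFunctions K)).topologicalClosure := by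
    rw [ContinuousMap.starSubalgebra_topologicalClosure_eq_top_of_separatesPoints _
      (adjoin_productFunctions_separatesPoints K)]
    trivial
  have hφ' : φ ∈ closure (StarAlgebra.adjoin ℂ (productFunctions K) : Set C(K, ℂ)) := hφ
  obtain ⟨χ, hχ, hdist⟩ := Metric.mem_closure_iff.1 hφ' (ε / (|B| + 1)) (by positivity)
  have hspan : χ ∈ Submodule.span ℂ (productFunctions K) := by
    rw [← adjoin_productFunctions]
    exact hχ
  obtain ⟨F, hF, hFχ⟩ : ∃ F ∈ sourceSpan N, ∀ z : K, F z.1 = w z.1 * χ z := by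
    clear hdist hχ
    induction hspan using Submodule.span_induction with
    | mem χ h =>
      obtain ⟨f, k, hf, h⟩ := h
      refine ⟨_, Submodule.subset_span ⟨f, k, hf, rfl⟩, fun z => ?_⟩
      rw [h, cis_gridNumber, hw]
      push_cast
      ring
    | zero => exact ⟨0, zero_mem _, fun z => by simp⟩
    | add χ χ' _ _ h h' =>
      obtain ⟨F, hF, h⟩ := h
      obtain ⟨F', hF', h'⟩ := h'
      exact ⟨F + F', add_mem hF hF', fun z => by simp [h, h', mul_add]⟩
    | smul c χ _ h =>
      obtain ⟨F, hF, h⟩ := h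
      exact ⟨c • F, Submodule.smul_mem _ c hF, fun z => by simp [h, mul_left_comm]⟩
  refine ⟨F, hF, fun z hz => ?_⟩
  have h1 : ‖φ ⟨z, hz⟩ - χ ⟨z, hz⟩‖ ≤ ε / (|B| + 1) := by
    rw [← dist_eq_norm]
    exact (ContinuousMap.dist_apply_le_dist _).trans hdist.le
  have h2 : G z - F z = w z * (φ ⟨z, hz⟩ - χ ⟨z, hz⟩) := by
    rw [hFχ ⟨z, hz⟩, mul_sub]
    congr 1
    change G z = w z * (((w z)⁻¹ : ℝ) * G z)
    rw [← mul_assoc, ← Complex.ofReal_mul, mul_inv_cancel₀ (hw0 z), Complex.ofReal_one, one_mul]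
  rw [h2, norm_mul, Complex.norm_real]
  calc ‖w z‖ * ‖φ ⟨z, hz⟩ - χ ⟨z, hz⟩‖ ≤ (|B| + 1) * (ε / (|B| + 1)) := by
        gcongr
        linarith [hB z hz, le_abs_self B]
    _ = ε := by field_simp

theorem gridClosure_of_continuous (γ xp xm : ℝ) {f : (Fin N → ℝ) → ℂ} (hf : Continuous f) :
    f ∈ gridClosure γ xp xm N := by
  induction N with
  | zero =>
    have h : f = f 0 • created γ (gridVector (N := 0) 0) := by
      funext x
      rw [Subsingleton.elim x 0]
      simp [created]
    rw [h]
    exact gridSpan_le_gridClosure _ _ _ _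
      (Submodule.smul_mem _ _ (Submodule.subset_span ⟨0, rfl⟩))
  | succ N ih =>
    obtain ⟨α, hα, hop⟩ := exists_weight γ N
    set w : (Fin (N + 1) → ℝ) → ℝ := fun z => Real.exp (α * z (Fin.last N)) with hw
    have hw0 : ∀ z, 0 < w z := fun z => Real.exp_pos _
    have hwc : Continuous w := by fun_prop
    obtain ⟨B, hB⟩ := (isCompact_cube xp xm (N + 1)).exists_bound_of_continuousOn hwc.continuousOn
    obtain ⟨B', hB'⟩ := (isCompact_cube xp xm (N + 1)).exists_bound_of_continuousOn
      (hwc.inv₀ fun z => (hw0 z).ne').continuousOn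
    obtain ⟨D, hD⟩ := (isCompact_cube xp xm (N + 1)).exists_bound_of_continuousOn hf.continuousOn
    have hle : ∀ z ∈ cube xp xm (N + 1), 1 ≤ (|B'| + 1) * w z := by
      intro z hz
      have h1 := hB' z hz
      rw [Pi.inv_apply, norm_inv, Real.norm_of_nonneg (hw0 z).le] at h1
      exact (inv_mul_cancel₀ (hw0 z).ne').symm.trans_le
        (mul_le_mul_of_nonneg_right (by linarith [le_abs_self B']) (hw0 z).le)
    -- The current error `f - g` is replaced by a source `F` up to a quarter of `M`, and `sourceOp γ
    -- F` is added to `g`. Since `F` has weighted norm at most `5/4 M`, passing from `F` to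
    -- `sourceOp γ F` costs `5/16 M`. The new error is at most `9/16 M`, below `3/4 M`.
    have hiter : ∀ m : ℕ, ∃ g ∈ gridClosure γ xp xm (N + 1), ∀ x ∈ cube xp xm (N + 1),
        ‖f x - g x‖ ≤ (|D| + 1) * (|B'| + 1) * (3 / 4) ^ m * w x := by
      intro m
      induction m with
      | zero =>
        refine ⟨0, zero_mem _, fun x hx => ?_⟩
        rw [Pi.zero_apply, sub_zero, pow_zero, mul_one, mul_assoc]
        calc ‖f x‖ ≤ (|D| + 1) * 1 := by linarith [hD x hx, le_abs_self D]
          _ ≤ _ := by gcongr; exact hle x hx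
      | succ m ihm =>
        obtain ⟨g, hg, hfg⟩ := ihm
        set M := (|D| + 1) * (|B'| + 1) * (3 / 4) ^ m with hM
        have hM0 : 0 < M := by positivity
        obtain ⟨F, hF, hFle⟩ := exists_sourceSpan_approx xp xm (G := f - g) (hf.sub hg.1)
          (ε := M / 4 / (|B'| + 1)) (by positivity)
        have hFle' : ∀ z ∈ cube xp xm (N + 1), ‖(f - g) z - F z‖ ≤ M / 4 * w z := by
          intro z hz
          refine (hFle z hz).trans ?_
          rw [div_le_iff₀ (by positivity), mul_assoc, mul_comm (w z)]
          exact le_mul_of_one_le_right (by positivity) (hle z hz)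
        have hFM : ∀ z ∈ cube xp xm (N + 1), ‖F z‖ ≤ 5 / 4 * M * w z := by
          intro z hz
          have h1 := hFle' z hz
          have h2 := hfg z hz
          rw [← sub_sub_cancel ((f - g) z) (F z)]
          refine (norm_sub_le_of_le h2 h1).trans (le_of_eq (by ring))
        refine ⟨g + sourceOp γ F, add_mem hg (sourceOp_mem_gridClosure (fun f hf => ih hf) hF).2,
          fun x hx => ?_⟩
        have h1 := hop xp xm (5 / 4 * M) (by positivity) F hFM x hx
        have h2 := hFle' x hx
        have h3 : f x - (g + sourceOp γ F) x = ((f - g) x - F x) - (sourceOp γ F x - F x) := by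
          simp only [Pi.add_apply, Pi.sub_apply]
          ring
        rw [h3]
        refine (norm_sub_le_of_le h2 h1).trans ?_
        have h4 : (|D| + 1) * (|B'| + 1) * (3 / 4) ^ (m + 1) = M * (3 / 4) := by rw [hM]; ring
        rw [h4]
        change M / 4 * w x + 5 / 4 * M / 4 * w x ≤ _
        nlinarith [mul_pos hM0 (hw0 x)]
    refine mem_gridClosure_of_approx hf fun ε hε => ?_
    have hlim : Filter.Tendsto (fun m : ℕ => (|D| + 1) * (|B'| + 1) * (3 / 4 : ℝ) ^ m * (|B| + 1))
        Filter.atTop (nhds ((|D| + 1) * (|B'| + 1) * 0 * (|B| + 1))) :=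
      ((tendsto_pow_atTop_nhds_zero_of_lt_one (by norm_num) (by norm_num)).const_mul _).mul_const _
    rw [mul_zero, zero_mul] at hlim
    obtain ⟨m, hm⟩ := (hlim.eventually (eventually_le_nhds hε)).exists
    obtain ⟨g, hg, hfg⟩ := hiter m
    refine ⟨g, hg, fun x hx => (hfg x hx).trans (le_trans ?_ hm)⟩
    gcongr
    have := hB x hx
    rw [Real.norm_of_nonneg (hw0 x).le] at this
    linarith [le_abs_self B]

/-! ### From uniform approximation to density in `L²` -/

theorem memLp_of_continuous (xp xm : ℝ) {f : (Fin N → ℝ) → ℂ} (hf : Continuous f) :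
    MemLp f 2 (cubeMeasure xp xm N) := by
  obtain ⟨M, hM⟩ := (isCompact_cube xp xm N).exists_bound_of_continuousOn hf.continuousOn
  refine MemLp.of_bound hf.aestronglyMeasurable M ?_
  filter_upwards [ae_restrict_mem (measurableSet_cube xp xm N)] with x hx using hM x hx

/-- The class of a continuous function in `L²(J^N)`. -/
def contToLp (xp xm : ℝ) (f : C(Fin N → ℝ, ℂ)) : Sector xp xm N :=
  (memLp_of_continuous xp xm f.continuous).toLp f

theorem dense_contToLp (xp xm : ℝ) (N : ℕ) :
    Dense (Set.range (contToLp xp xm : C(Fin N → ℝ, ℂ) → Sector xp xm N)) := by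
  refine (BoundedContinuousFunction.toLp_denseRange (p := 2) ℂ (μ := cubeMeasure xp xm N) ℂ
    (by norm_num)).mono ?_
  rintro _ ⟨f, rfl⟩
  exact ⟨f.toContinuousMap, rfl⟩

theorem gridSpan_toLp_mem_zBar {γ xp xm : ℝ} {g : C(Fin N → ℝ, ℂ)} (hg : ⇑g ∈ gridSpan γ N) :
    contToLp xp xm g ∈ zBar γ xp xm N := by
  obtain ⟨g, hgc⟩ := g
  change g ∈ gridSpan γ N at hg
  refine Submodule.le_topologicalClosure _ ?_
  induction hg using Submodule.span_induction with
  | mem g h =>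
    obtain ⟨n, rfl⟩ := h
    refine Submodule.subset_span ⟨gridVector n, ?_⟩
    exact MemLp.toLp_congr _ _ (by rw [psi_eq_created γ (gridVector_injective n)]; rfl)
  | zero => exact zero_mem _
  | add f g hf hg h1 h2 =>
    exact add_mem (h1 (continuous_of_mem_gridSpan hf)) (h2 (continuous_of_mem_gridSpan hg))
  | smul c f hf h => exact Submodule.smul_mem _ c (h (continuous_of_mem_gridSpan hf))

/-- Continuous functions are dense in `L²`, and on a cube of finite measure uniform approximation by
grid wavefunctions implies `L²` approximation. Invariance of `zBar` under any operator between
sectors follows at once. -/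
theorem zBar_eq_top (γ xp xm : ℝ) (N : ℕ) : zBar γ xp xm N = ⊤ := by
  have hclosed : IsClosed (zBar γ xp xm N : Set (Sector xp xm N)) :=
    Submodule.isClosed_topologicalClosure _
  refine Submodule.eq_top_iff'.2 fun F => ?_
  have hsub : Set.range (contToLp xp xm : C(Fin N → ℝ, ℂ) → Sector xp xm N) ⊆
      (zBar γ xp xm N : Set (Sector xp xm N)) := by
    rintro _ ⟨f, rfl⟩
    rw [← hclosed.closure_eq, Metric.mem_closure_iff]
    intro ε hε
    set V : ℝ := (cubeMeasure xp xm N).real Set.univ ^ (2 : ENNReal).toReal⁻¹ with hV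
    have hV0 : 0 ≤ V := by positivity
    obtain ⟨g, hg, hfg⟩ := (gridClosure_of_continuous γ xp xm f.continuous).2 (ε / (2 * (V + 1)))
      (by positivity)
    refine ⟨contToLp xp xm ⟨g, continuous_of_mem_gridSpan hg⟩, gridSpan_toLp_mem_zBar hg, ?_⟩
    rw [dist_eq_norm]
    have h1 : ‖contToLp xp xm f - contToLp xp xm ⟨g, continuous_of_mem_gridSpan hg⟩‖ ≤
        V * (ε / (2 * (V + 1))) := by
      rw [hV]
      refine Lp.norm_le_of_ae_bound (by positivity) ?_
      rw [contToLp, contToLp, ← MemLp.toLp_sub]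
      filter_upwards [MemLp.coeFn_toLp ((memLp_of_continuous xp xm f.continuous).sub
        (memLp_of_continuous xp xm (continuous_of_mem_gridSpan hg))),
        ae_restrict_mem (measurableSet_cube xp xm N)] with x hx hxc
      exact (congrArg norm hx).trans_le (hfg x hxc)
    refine h1.trans_lt ?_
    calc V * (ε / (2 * (V + 1))) ≤ (V + 1) * (ε / (2 * (V + 1))) := by gcongr; linarith
      _ = ε / 2 := by field_simp
      _ < ε := half_lt_self hε
  exact hclosed.closure_subset_iff.2 hsub (dense_contToLp xp xm N F)

/-! ### Commutation of the creation operators on `L²` -/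

variable {N : ℕ}

theorem liftL2_toLp {α β : Type*} [MeasurableSpace α] [MeasurableSpace β] {ρ : Measure α}
    {μ : Measure β} {T : (α → ℂ) → β → ℂ} (hT : IsL2Bounded ρ μ T) {f : α → ℂ} (hf : MemLp f 2 ρ) :
    liftL2 T hT (hf.toLp f) = (hT.memLp f hf).toLp (T f) :=
  MemLp.toLp_congr (hT.memLp _ (Lp.memLp _)) _ (hT.congr _ _ hf.coeFn_toLp)

theorem bPlus_contToLp (γ xp xm : ℝ) (μ : ℂ) (f : C(Fin N → ℝ, ℂ)) :
    bPlus γ xp xm μ (contToLp xp xm f) =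
      contToLp xp xm ⟨bPlusFun γ μ f, continuous_bPlusFun γ μ f.continuous⟩ :=
  liftL2_toLp _ _

theorem bMinus_contToLp (γ xp xm : ℝ) (μ : ℂ) (f : C(Fin N → ℝ, ℂ)) :
    bMinus γ xp xm μ (contToLp xp xm f) =
      contToLp xp xm ⟨bMinusFun γ μ f, continuous_bMinusFun γ μ f.continuous⟩ :=
  liftL2_toLp _ _

theorem bPlus_bMinus_comm (γ xp xm : ℝ) (μ ν : ℂ) (F : Sector xp xm N) :
    bPlus γ xp xm μ (bMinus γ xp xm ν F) = bMinus γ xp xm ν (bPlus γ xp xm μ F) := by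
  have h : (fun F : Sector xp xm N => bPlus γ xp xm μ (bMinus γ xp xm ν F)) =
      fun F => bMinus γ xp xm ν (bPlus γ xp xm μ F) := by
    refine Continuous.ext_on (dense_contToLp xp xm N) (by fun_prop) (by fun_prop) ?_
    rintro _ ⟨f, rfl⟩
    simp only [bMinus_contToLp, bPlus_contToLp]
    congr 2
    exact bPlusFun_bMinusFun_comm γ μ ν f.continuous
  exact congrFun h F

/-! ### Adjointness of the creation and annihilation operators -/

/-- The change of variables that permutes the coordinates according to `σ`. -/
def reindexProd {A B C D : Type*} (σ : A ⊕ B ≃ C ⊕ D) :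
    (C → ℝ) × (D → ℝ) ≃ᵐ (A → ℝ) × (B → ℝ) :=
  ((MeasurableEquiv.sumPiEquivProdPi fun _ : C ⊕ D => ℝ).symm.trans
    (MeasurableEquiv.piCongrLeft (fun _ => ℝ) σ).symm).trans
    (MeasurableEquiv.sumPiEquivProdPi fun _ : A ⊕ B => ℝ)

theorem reindexProd_apply {A B C D : Type*} (σ : A ⊕ B ≃ C ⊕ D) (z : (C → ℝ) × (D → ℝ)) :
    reindexProd σ z = (fun a => Sum.elim z.1 z.2 (σ (Sum.inl a)),
      fun b => Sum.elim z.1 z.2 (σ (Sum.inr b))) := by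
  refine Prod.ext (funext fun a => ?_) (funext fun b => ?_)
  · change @Sum.rec C D (fun _ => ℝ) z.1 z.2 (σ (Sum.inl a)) = Sum.elim z.1 z.2 (σ (Sum.inl a))
    cases σ (Sum.inl a) <;> rfl
  · change @Sum.rec C D (fun _ => ℝ) z.1 z.2 (σ (Sum.inr b)) = Sum.elim z.1 z.2 (σ (Sum.inr b))
    cases σ (Sum.inr b) <;> rfl

theorem measurePreserving_reindexProd {A B C D : Type*} [Fintype A] [Fintype B] [Fintype C]
    [Fintype D] (σ : A ⊕ B ≃ C ⊕ D) : MeasurePreserving (reindexProd σ) :=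
  ((volume_measurePreserving_sumPiEquivProdPi_symm fun _ : C ⊕ D => ℝ).trans
    (volume_measurePreserving_piCongrLeft (fun _ => ℝ) σ).symm).trans
    (volume_measurePreserving_sumPiEquivProdPi fun _ : A ⊕ B => ℝ)

/-- The domain of integration `{(x, y) | x ∈ J^A, p_{m+1}(x) ≤ y_m ≤ p_m(x)}`. -/
def chainDomain (xp xm : ℝ) {A n : ℕ} (p : (Fin A → ℝ) → Fin (n + 1) → ℝ) :
    Set ((Fin A → ℝ) × (Fin n → ℝ)) :=
  {z | z.1 ∈ cube xp xm A ∧ ∀ m : Fin n, z.2 m ∈ Set.Icc (p z.1 m.succ) (p z.1 m.castSucc)}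

theorem isCompact_chainDomain {xp xm : ℝ} {A n : ℕ} {p : (Fin A → ℝ) → Fin (n + 1) → ℝ}
    (hp : Continuous p) (hpJ : ∀ x ∈ cube xp xm A, ∀ m, p x m ∈ Set.Icc xp xm) :
    IsCompact (chainDomain xp xm p) := by
  refine ((isCompact_cube xp xm A).prod (isCompact_cube xp xm n)).of_isClosed_subset ?_ ?_
  · have h : chainDomain xp xm p = (Prod.fst ⁻¹' cube xp xm A) ∩
        ⋂ m : Fin n, ({z : (Fin A → ℝ) × (Fin n → ℝ) | p z.1 m.succ ≤ z.2 m} ∩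
          {z | z.2 m ≤ p z.1 m.castSucc}) := by
      ext z
      simp only [chainDomain, Set.mem_ofPred_eq, Set.mem_inter_iff, Set.mem_preimage, Set.mem_iInter,
        Set.mem_Icc]
    have hpm : ∀ m, Continuous fun z : (Fin A → ℝ) × (Fin n → ℝ) => p z.1 m := fun m =>
      (continuous_apply m).comp (hp.comp continuous_fst)
    have hym : ∀ m : Fin n, Continuous fun z : (Fin A → ℝ) × (Fin n → ℝ) => z.2 m := fun m =>
      (continuous_apply m).comp continuous_snd
    rw [h]
    exact ((isCompact_cube xp xm A).isClosed.preimage continuous_fst).inter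
      (isClosed_iInter fun m => (isClosed_le (hpm _) (hym _)).inter (isClosed_le (hym _) (hpm _)))
  · intro z hz
    exact ⟨hz.1, fun m _ => ⟨(hpJ _ hz.1 _).1.trans (hz.2 m).1, (hz.2 m).2.trans (hpJ _ hz.1 _).2⟩⟩

/-- The half-open boxes are replaced by closed ones, which changes null sets only. Half-open
conditions would not be preserved when coordinates and integration variables trade places, whereas
closed ones are. -/
theorem setIntegral_chainDomain {xp xm : ℝ} {A n : ℕ} {p : (Fin A → ℝ) → Fin (n + 1) → ℝ}
    (hp : Continuous p) (hpJ : ∀ x ∈ cube xp xm A, ∀ m, p x m ∈ Set.Icc xp xm)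
    {Φ : (Fin A → ℝ) × (Fin n → ℝ) → ℂ} (hΦ : Continuous Φ) :
    ∫ x in cube xp xm A, ∫ y in segBox (p x), Φ (x, y) = ∫ z in chainDomain xp xm p, Φ z := by
  have hD := isCompact_chainDomain hp hpJ
  have hint : Integrable ((chainDomain xp xm p).indicator Φ) (volume.prod volume) :=
    (hΦ.continuousOn.integrableOn_compact hD).integrable_indicator hD.measurableSet
  rw [← integral_indicator hD.measurableSet, Measure.volume_eq_prod, integral_prod _ hint,
    ← integral_indicator (measurableSet_cube xp xm A)]
  refine integral_congr_ae (Filter.Eventually.of_forall fun x => ?_)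
  by_cases hx : x ∈ cube xp xm A
  · rw [Set.indicator_of_mem hx]
    have hbox : segBox (p x) =ᵐ[volume] Set.Icc (fun m => p x m.succ) fun m => p x m.castSucc :=
      Measure.univ_pi_Ioc_ae_eq_Icc
    rw [setIntegral_congr_set hbox, ← integral_indicator measurableSet_Icc]
    refine integral_congr_ae (Filter.Eventually.of_forall fun y => ?_)
    change _ = (chainDomain xp xm p).indicator Φ (x, y)
    by_cases hy : y ∈ Set.Icc (fun m => p x m.succ) fun m => p x m.castSucc
    · rw [Set.indicator_of_mem hy, Set.indicator_of_mem
        (show (x, y) ∈ chainDomain xp xm p from ⟨hx, fun m => ⟨hy.1 m, hy.2 m⟩⟩)]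
    · rw [Set.indicator_of_notMem hy, Set.indicator_of_notMem
        fun h : (x, y) ∈ chainDomain xp xm p => hy ⟨fun m => (h.2 m).1, fun m => (h.2 m).2⟩]
  · rw [Set.indicator_of_notMem hx]
    refine (integral_eq_zero_of_ae (Filter.Eventually.of_forall fun y => ?_)).symm
    exact Set.indicator_of_notMem (fun h : (x, y) ∈ chainDomain xp xm p => hx h.1) _

theorem setIntegral_segBox_reindex {xp xm : ℝ} {A B n k : ℕ} (σ : Fin A ⊕ Fin n ≃ Fin B ⊕ Fin k)
    {p : (Fin A → ℝ) → Fin (n + 1) → ℝ} (hp : Continuous p)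
    (hpJ : ∀ x ∈ cube xp xm A, ∀ m, p x m ∈ Set.Icc xp xm)
    {q : (Fin B → ℝ) → Fin (k + 1) → ℝ} (hq : Continuous q)
    (hqJ : ∀ x ∈ cube xp xm B, ∀ m, q x m ∈ Set.Icc xp xm)
    (hpq : ∀ z, reindexProd σ z ∈ chainDomain xp xm p ↔ z ∈ chainDomain xp xm q)
    {Φ : (Fin A → ℝ) × (Fin n → ℝ) → ℂ} (hΦ : Continuous Φ) :
    ∫ x in cube xp xm A, ∫ y in segBox (p x), Φ (x, y) =
      ∫ x in cube xp xm B, ∫ y in segBox (q x), Φ (reindexProd σ (x, y)) := by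
  have hT : Continuous (reindexProd σ) := by
    have : ⇑(reindexProd σ) = _ := funext (reindexProd_apply σ)
    rw [this]
    refine Continuous.prodMk (continuous_pi fun a => ?_) (continuous_pi fun b => ?_)
    · cases σ (Sum.inl a) <;> simp only [Sum.elim_inl, Sum.elim_inr] <;> fun_prop
    · cases σ (Sum.inr b) <;> simp only [Sum.elim_inl, Sum.elim_inr] <;> fun_prop
  have h := setIntegral_chainDomain hq hqJ (hΦ.comp hT)
  simp only [Function.comp_apply] at h
  rw [setIntegral_chainDomain hp hpJ hΦ, h,
    ← (measurePreserving_reindexProd σ).setIntegral_preimage_emb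
      (reindexProd σ).measurableEmbedding]
  congr 2
  exact Set.ext hpq

variable {N n : ℕ}

theorem not_strictAnti_cChain {xp xm : ℝ} {i : Fin n ↪ Fin N} {x : Fin N → ℝ}
    (h : ¬ StrictAnti fun m => x (i m)) : ¬ StrictAnti (cChain xp xm i x) := fun hc =>
  h fun a b hab => by
    have := hc (Fin.succ_lt_succ_iff.2 (Fin.castSucc_lt_castSucc_iff.2 hab))
    simpa [cChain] using this

theorem eCheckPlus_eq (xp xm : ℝ) (μ : ℂ) (i : Fin n ↪ Fin N) (g : (Fin (N + 1) → ℝ) → ℂ)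
    (x : Fin N → ℝ) : eCheckPlus xp xm μ i g x = cis μ xp * ∫ y in segBox (cChain xp xm i x),
      (∏ m : Fin (n + 1), cis μ (cChain xp xm i x m.castSucc - y m)) *
        g (Fin.snoc (α := fun _ => ℝ) (Function.extend i (fun m => y m.succ) x) (y 0)) := by
  rw [eCheckPlus]
  split_ifs with h
  · simp only [cis, Complex.ofReal_sub]
  · rw [segBox_eq_empty (not_strictAnti_cChain h), setIntegral_empty, mul_zero]

theorem eCheckMinus_eq (xp xm : ℝ) (μ : ℂ) (i : Fin n ↪ Fin N) (g : (Fin (N + 1) → ℝ) → ℂ)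
    (x : Fin N → ℝ) : eCheckMinus xp xm μ i g x = cis μ xm * ∫ y in segBox (cChain xp xm i x),
      (∏ m : Fin (n + 1), cis μ (cChain xp xm i x m.succ - y m)) *
        g (Fin.cons (α := fun _ => ℝ) (y (Fin.last n))
          (Function.extend i (fun m => y m.castSucc) x)) := by
  rw [eCheckMinus]
  split_ifs with h
  · simp only [cis, Complex.ofReal_sub]
  · rw [segBox_eq_empty (not_strictAnti_cChain h), setIntegral_empty, mul_zero]

theorem cis_neg (μ : ℂ) (t : ℝ) : cis (-μ) t = cis μ (-t) := by
  rw [cis, cis]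
  push_cast
  ring_nf

theorem prod_cis (μ : ℂ) {ι : Type*} (s : Finset ι) (f : ι → ℝ) :
    ∏ m ∈ s, cis μ (f m) = cis μ (∑ m ∈ s, f m) := by
  simpa using (cis_add_sum μ s 0 f).symm

/-- The relabelling of the coordinates that turns `ě⁺` into `ê⁻`. -/
def snocReindex (i : Fin n ↪ Fin N) : Fin (N + 1) ⊕ Fin n → Fin N ⊕ Fin (n + 1) :=
  Sum.elim (Fin.snoc (α := fun _ => Fin N ⊕ Fin (n + 1))
    (Function.extend i (fun m => Sum.inr m.succ) Sum.inl) (Sum.inr 0)) fun m => Sum.inl (i m)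

/-- The relabelling of the coordinates that turns `ě⁻` into `ê⁺`. -/
def consReindex (i : Fin n ↪ Fin N) : Fin (N + 1) ⊕ Fin n → Fin N ⊕ Fin (n + 1) :=
  Sum.elim (Fin.cons (α := fun _ => Fin N ⊕ Fin (n + 1)) (Sum.inr (Fin.last n))
    (Function.extend i (fun m => Sum.inr m.castSucc) Sum.inl)) fun m => Sum.inl (i m)

theorem extend_inr_ne {k : ℕ} (i : Fin n ↪ Fin N) (a : Fin n → Fin k) {l : Fin k}
    (hl : ∀ m, a m ≠ l) (j : Fin N) :
    Function.extend i (fun m => (Sum.inr (a m) : Fin N ⊕ Fin k)) Sum.inl j ≠ Sum.inr l := by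
  by_cases h : ∃ m, i m = j
  · obtain ⟨m, rfl⟩ := h
    rw [i.injective.extend_apply]
    exact fun h => hl m (Sum.inr_injective h)
  · rw [Function.extend_apply' _ _ _ h]
    exact Sum.inl_ne_inr

theorem extend_inr_ne_inl {k : ℕ} (i : Fin n ↪ Fin N) (a : Fin n → Fin k) (j : Fin N) (m : Fin n) :
    Function.extend i (fun m => (Sum.inr (a m) : Fin N ⊕ Fin k)) Sum.inl j ≠ Sum.inl (i m) := by
  by_cases h : ∃ m, i m = j
  · obtain ⟨l, rfl⟩ := h
    rw [i.injective.extend_apply]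
    exact Sum.inr_ne_inl
  · rw [Function.extend_apply' _ _ _ h]
    exact fun h' => h ⟨m, (Sum.inl_injective h').symm⟩

theorem snocReindex_bijective (i : Fin n ↪ Fin N) : Function.Bijective (snocReindex i) := by
  refine (Fintype.bijective_iff_injective_and_card _).2 ⟨?_, by simp; omega⟩
  refine Function.Injective.sumElim ?_ (Sum.inl_injective.comp i.injective) fun j m => ?_
  · rw [Fin.snoc_injective_iff]
    refine ⟨extend_injective i _ _ (Sum.inr_injective.comp (Fin.succ_injective _))
      Sum.inl_injective (by simp), ?_⟩
    rintro ⟨j, hj⟩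
    exact extend_inr_ne i _ Fin.succ_ne_zero j hj
  · induction j using Fin.lastCases with
    | last => rw [Fin.snoc_last]; exact Sum.inr_ne_inl
    | cast j => rw [Fin.snoc_castSucc]; exact extend_inr_ne_inl i _ j m

theorem consReindex_bijective (i : Fin n ↪ Fin N) : Function.Bijective (consReindex i) := by
  refine (Fintype.bijective_iff_injective_and_card _).2 ⟨?_, by simp; omega⟩
  refine Function.Injective.sumElim ?_ (Sum.inl_injective.comp i.injective) fun j m => ?_
  · rw [Fin.cons_injective_iff]
    refine ⟨?_, extend_injective i _ _ (Sum.inr_injective.comp (Fin.castSucc_injective _))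
      Sum.inl_injective (by simp)⟩
    rintro ⟨j, hj⟩
    exact extend_inr_ne i _ (fun m => (Fin.castSucc_lt_last m).ne) j hj
  · induction j using Fin.cases with
    | zero => rw [Fin.cons_zero]; exact Sum.inr_ne_inl
    | succ j => rw [Fin.cons_succ]; exact extend_inr_ne_inl i _ j m

theorem reindexProd_snocReindex (i : Fin n ↪ Fin N) (x : Fin N → ℝ) (y : Fin (n + 1) → ℝ) :
    reindexProd (Equiv.ofBijective _ (snocReindex_bijective i)) (x, y) =
      (Fin.snoc (α := fun _ => ℝ) (Function.extend i (fun m => y m.succ) x) (y 0),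
        fun m => x (i m)) := by
  rw [reindexProd_apply]
  refine Prod.ext ?_ rfl
  change Sum.elim x y ∘ Fin.snoc (α := fun _ => Fin N ⊕ Fin (n + 1)) _ _ = _
  rw [Fin.comp_snoc, comp_extend]
  rfl

theorem reindexProd_consReindex (i : Fin n ↪ Fin N) (x : Fin N → ℝ) (y : Fin (n + 1) → ℝ) :
    reindexProd (Equiv.ofBijective _ (consReindex_bijective i)) (x, y) =
      (Fin.cons (α := fun _ => ℝ) (y (Fin.last n)) (Function.extend i (fun m => y m.castSucc) x),
        fun m => x (i m)) := by
  rw [reindexProd_apply]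
  refine Prod.ext ?_ rfl
  change Sum.elim x y ∘ Fin.cons (α := fun _ => Fin N ⊕ Fin (n + 1)) _ _ = _
  rw [Fin.comp_cons, comp_extend]
  rfl

/-- The variables integrated in `ě⁺` form the chain of `ê⁻`, while the coordinates `x (i m)` become
the variables integrated there. Both operators encode the interlacing `xm ≥ y 0 ≥ x (i 0) ≥ y 1 ≥ ⋯
≥ y n ≥ xp`. -/
theorem bMinusChain_snoc (i : Fin n ↪ Fin N) (x : Fin N → ℝ) (y : Fin (n + 1) → ℝ) :
    bMinusChain i (Fin.snoc (α := fun _ => ℝ) (Function.extend i (fun m => y m.succ) x) (y 0)) =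
      y := by
  funext m
  refine Fin.cases ?_ (fun m => ?_) m
  · simp [bMinusChain]
  · simp [bMinusChain, i.injective.extend_apply]

theorem bPlusChain_cons (i : Fin n ↪ Fin N) (x : Fin N → ℝ) (y : Fin (n + 1) → ℝ) :
    bPlusChain i (Fin.cons (α := fun _ => ℝ) (y (Fin.last n))
      (Function.extend i (fun m => y m.castSucc) x)) = y := by
  funext m
  refine Fin.lastCases ?_ (fun m => ?_) m
  · simp [bPlusChain]
  · simp [bPlusChain, i.injective.extend_apply]

theorem cChain_last (xp xm : ℝ) (i : Fin n ↪ Fin N) (x : Fin N → ℝ) :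
    cChain xp xm i x (Fin.last n).succ = xp := by simp [cChain]

theorem cChain_mid (xp xm : ℝ) (i : Fin n ↪ Fin N) (x : Fin N → ℝ) (m : Fin n) :
    cChain xp xm i x m.castSucc.succ = x (i m) := by simp [cChain]

/-- The interlacing conditions of `ě^±` and `ê^∓` agree. -/
theorem interlacing_iff {xp xm : ℝ} (hJ : xp ≤ xm) (i : Fin n ↪ Fin N) (x : Fin N → ℝ)
    (y : Fin (n + 1) → ℝ) :
    (x, y) ∈ chainDomain xp xm (cChain xp xm i) ↔
      ((∀ j, (¬ ∃ m, i m = j) → x j ∈ Set.Icc xp xm) ∧ ∀ m, y m ∈ Set.Icc xp xm) ∧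
        ∀ m : Fin n, x (i m) ∈ Set.Icc (y m.succ) (y m.castSucc) := by
  constructor
  · rintro ⟨hx, hy⟩
    refine ⟨⟨fun j _ => hx j trivial, fun m => ⟨(cChain_mem hJ i x hx _).1.trans (hy m).1,
      (hy m).2.trans (cChain_mem hJ i x hx _).2⟩⟩, fun m => ⟨?_, ?_⟩⟩
    · have := (hy m.succ).2
      rwa [Fin.castSucc_succ, cChain_mid] at this
    · have := (hy m.castSucc).1
      rwa [cChain_mid] at this
  · rintro ⟨⟨hx, hy⟩, hxy⟩
    refine ⟨fun j _ => ?_, fun m => ⟨?_, ?_⟩⟩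
    · by_cases h : ∃ m, i m = j
      · obtain ⟨m, rfl⟩ := h
        exact ⟨(hy _).1.trans (hxy m).1, (hxy m).2.trans (hy _).2⟩
      · exact hx j h
    · induction m using Fin.lastCases with
      | last => simpa only [cChain_last] using (hy _).1
      | cast m => simpa only [cChain_mid] using (hxy m).2
    · induction m using Fin.cases with
      | zero => exact (hy _).2
      | succ m => simpa only [Fin.castSucc_succ, cChain_mid] using (hxy m).1

theorem forall_extend_iff (i : Fin n ↪ Fin N) (x : Fin N → ℝ) (a : Fin n → ℝ) (P : ℝ → Prop) :
    (∀ j, P (Function.extend i a x j)) ↔ (∀ j, (¬ ∃ m, i m = j) → P (x j)) ∧ ∀ m, P (a m) := by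
  constructor
  · refine fun h => ⟨fun j hj => ?_, fun m => ?_⟩
    · have := h j
      rwa [Function.extend_apply' _ _ _ hj] at this
    · have := h (i m)
      rwa [i.injective.extend_apply] at this
  · rintro ⟨h1, h2⟩ j
    by_cases hj : ∃ m, i m = j
    · obtain ⟨m, rfl⟩ := hj
      rw [i.injective.extend_apply]
      exact h2 m
    · rw [Function.extend_apply' _ _ _ hj]
      exact h1 j hj

theorem sum_cChain_castSucc (xp xm : ℝ) (i : Fin n ↪ Fin N) (x : Fin N → ℝ) :
    ∑ m : Fin (n + 1), cChain xp xm i x m.castSucc = xm + ∑ m, x (i m) := by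
  rw [Fin.sum_univ_succ]
  simp only [Fin.castSucc_succ, cChain_mid]
  rfl

theorem sum_cChain_succ (xp xm : ℝ) (i : Fin n ↪ Fin N) (x : Fin N → ℝ) :
    ∑ m : Fin (n + 1), cChain xp xm i x m.succ = ∑ m, x (i m) + xp := by
  rw [Fin.sum_univ_castSucc]
  simp only [cChain_mid, cChain_last]

theorem continuous_extend_prod (i : Fin n ↪ Fin N) {X : Type*} [TopologicalSpace X]
    {a : X → Fin n → ℝ} {b : X → Fin N → ℝ} (ha : Continuous a) (hb : Continuous b) :
    Continuous fun z => Function.extend i (a z) (b z) := by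
  refine continuous_pi fun j => ?_
  by_cases h : ∃ m, i m = j
  · obtain ⟨m, rfl⟩ := h
    simp only [i.injective.extend_apply]
    fun_prop
  · simp only [Function.extend_apply' _ _ _ h]
    fun_prop

theorem extend_extend_self (i : Fin n ↪ Fin N) (x : Fin N → ℝ) (a : Fin n → ℝ) :
    Function.extend i (fun m => x (i m)) (Function.extend i a x) = x := by
  funext j
  by_cases hj : ∃ m, i m = j
  · obtain ⟨m, rfl⟩ := hj
    rw [i.injective.extend_apply]
  · rw [Function.extend_apply' _ _ _ hj, Function.extend_apply' _ _ _ hj]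

/-- A relabelling of the variables preserves Lebesgue measure and identifies the two domains. The
pairing is bilinear, so the exponent changes sign without conjugation of `μ`. -/
theorem integral_eCheckPlus {xp xm : ℝ} (hJ : xp ≤ xm) (μ : ℂ) (i : Fin n ↪ Fin N)
    {f : (Fin N → ℝ) → ℂ} (hf : Continuous f) {g : (Fin (N + 1) → ℝ) → ℂ} (hg : Continuous g) :
    ∫ x in cube xp xm N, f x * eCheckPlus xp xm μ i g x =
      cis μ (xp + xm) * ∫ z in cube xp xm (N + 1), eHatMinus (-μ) i f z * g z := by
  have hb : ∀ x ∈ cube xp xm (N + 1), ∀ m, bMinusChain i x m ∈ Set.Icc xp xm := by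
    intro x hx m
    refine Fin.cases ?_ (fun m => ?_) m
    · simpa [bMinusChain] using hx (Fin.last N) trivial
    · simpa [bMinusChain] using hx (i m).castSucc trivial
  have h := setIntegral_segBox_reindex (xp := xp) (xm := xm)
    (Equiv.ofBijective _ (snocReindex_bijective i)) (bMinusChain_continuous i) hb
    (cChain_continuous xp xm i) (fun x hx m => cChain_mem hJ i x hx m)
    (Φ := fun z => cis (-μ) (z.1 (Fin.last N)) * ((∏ m, cis (-μ) (z.1 (i m).castSucc - z.2 m)) *
      f (Function.extend i z.2 fun j => z.1 j.castSucc)) * g z.1 * cis μ (xp + xm)) ?_ ?_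
  · simp only [reindexProd_snocReindex, Fin.snoc_last, Fin.snoc_castSucc, extend_extend_self,
      i.injective.extend_apply] at h
    rw [← integral_const_mul]
    simp only [eHatMinus_eq, ← integral_const_mul, ← integral_mul_const, mul_comm (cis μ (xp + xm))]
    refine Eq.trans ?_ h.symm
    simp only [eCheckPlus_eq, ← integral_const_mul]
    congr 1 with x
    congr 1 with y
    simp only [prod_cis, cis_neg, Finset.sum_neg_distrib, Finset.sum_sub_distrib, sum_cChain_castSucc]
    -- Both exponents are the sum of `xp`, `xm` and the chain coordinates minus the sum of all `y`;
    -- isolating `xp + xm` leaves the phase of `ê⁻` with wavenumber `-μ`.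
    have e : cis μ xp * cis μ (xm + ∑ m, x (i m) - ∑ m, y m) =
        cis μ (-y 0) * cis μ (-(∑ m : Fin n, y m.succ - ∑ m, x (i m))) * cis μ (xp + xm) := by
      rw [← cis_add, ← cis_add, ← cis_add, Fin.sum_univ_succ y]
      congr 1
      ring
    linear_combination (f x * g _) * e
  · rintro ⟨x, y⟩
    rw [interlacing_iff hJ, reindexProd_snocReindex, chainDomain, Set.mem_ofPred_eq]
    simp only [bMinusChain_snoc]
    refine and_congr ?_ Iff.rfl
    rw [cube, Set.mem_univ_pi, Fin.forall_fin_succ']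
    simp only [Fin.snoc_castSucc, Fin.snoc_last]
    rw [forall_extend_iff i x _ (· ∈ Set.Icc xp xm), and_assoc, Fin.forall_fin_succ,
      and_comm (a := y 0 ∈ _)]
  · have := hf.comp (continuous_extend_prod i (X := (Fin (N + 1) → ℝ) × (Fin n → ℝ))
      (a := fun z => z.2) (b := fun z j => z.1 j.castSucc) (by fun_prop) (by fun_prop))
    simp only [Function.comp_def] at this
    refine ((Continuous.mul (by fun_prop) (Continuous.mul (by fun_prop) this)).mul
      (by fun_prop)).mul continuous_const

theorem integral_eCheckMinus {xp xm : ℝ} (hJ : xp ≤ xm) (μ : ℂ) (i : Fin n ↪ Fin N)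
    {f : (Fin N → ℝ) → ℂ} (hf : Continuous f) {g : (Fin (N + 1) → ℝ) → ℂ} (hg : Continuous g) :
    ∫ x in cube xp xm N, f x * eCheckMinus xp xm μ i g x =
      cis μ (xp + xm) * ∫ z in cube xp xm (N + 1), eHatPlus (-μ) i f z * g z := by
  have hb : ∀ x ∈ cube xp xm (N + 1), ∀ m, bPlusChain i x m ∈ Set.Icc xp xm := by
    intro x hx m
    refine Fin.lastCases ?_ (fun m => ?_) m
    · simpa [bPlusChain] using hx 0 trivial
    · simpa [bPlusChain] using hx (i m).succ trivial
  have h := setIntegral_segBox_reindex (xp := xp) (xm := xm)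
    (Equiv.ofBijective _ (consReindex_bijective i)) (bPlusChain_continuous i) hb
    (cChain_continuous xp xm i) (fun x hx m => cChain_mem hJ i x hx m)
    (Φ := fun z => cis (-μ) (z.1 0) * ((∏ m, cis (-μ) (z.1 (i m).succ - z.2 m)) *
      f (Function.extend i z.2 fun j => z.1 j.succ)) * g z.1 * cis μ (xp + xm)) ?_ ?_
  · simp only [reindexProd_consReindex, Fin.cons_zero, Fin.cons_succ, extend_extend_self,
      i.injective.extend_apply] at h
    rw [← integral_const_mul]
    simp only [eHatPlus_eq, ← integral_const_mul, ← integral_mul_const, mul_comm (cis μ (xp + xm))]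
    refine Eq.trans ?_ h.symm
    simp only [eCheckMinus_eq, ← integral_const_mul]
    congr 1 with x
    congr 1 with y
    simp only [prod_cis, cis_neg, Finset.sum_neg_distrib, Finset.sum_sub_distrib, sum_cChain_succ]
    have e : cis μ xm * cis μ (∑ m, x (i m) + xp - ∑ m, y m) =
        cis μ (-y (Fin.last n)) * cis μ (-(∑ m : Fin n, y m.castSucc - ∑ m, x (i m))) *
          cis μ (xp + xm) := by
      rw [← cis_add, ← cis_add, ← cis_add, Fin.sum_univ_castSucc y]
      congr 1
      ring
    linear_combination (f x * g _) * e
  · rintro ⟨x, y⟩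
    rw [interlacing_iff hJ, reindexProd_consReindex, chainDomain, Set.mem_ofPred_eq]
    simp only [bPlusChain_cons]
    refine and_congr ?_ Iff.rfl
    rw [cube, Set.mem_univ_pi, Fin.forall_fin_succ]
    simp only [Fin.cons_zero, Fin.cons_succ]
    rw [forall_extend_iff i x _ (· ∈ Set.Icc xp xm), Fin.forall_fin_succ' (P := fun m => y m ∈ _)]
    tauto
  · have := hf.comp (continuous_extend_prod i (X := (Fin (N + 1) → ℝ) × (Fin n → ℝ))
      (a := fun z => z.2) (b := fun z j => z.1 j.succ) (by fun_prop) (by fun_prop))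
    simp only [Function.comp_def] at this
    refine ((Continuous.mul (by fun_prop) (Continuous.mul (by fun_prop) this)).mul
      (by fun_prop)).mul continuous_const

/-! ### Commutation of the annihilation operators on `L²` -/

variable {N n : ℕ}

/-- The complex conjugate of a continuous function. -/
def conjMap {X : Type*} [TopologicalSpace X] (f : C(X, ℂ)) : C(X, ℂ) :=
  ⟨fun x => starRingEnd ℂ (f x), Complex.continuous_conj.comp f.continuous⟩

theorem conjMap_conjMap {X : Type*} [TopologicalSpace X] (f : C(X, ℂ)) : conjMap (conjMap f) = f :=
  ContinuousMap.ext fun x => Complex.conj_conj (f x)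

/-- The inner product is conjugate-linear in its first argument; testing against a conjugated
function restores the bilinear pairing of the transposition formulas. -/
theorem inner_conj_toLp {xp xm : ℝ} (f : C(Fin N → ℝ, ℂ)) {g : (Fin N → ℝ) → ℂ}
    (hg : MemLp g 2 (cubeMeasure xp xm N)) :
    inner ℂ (contToLp xp xm (conjMap f)) (hg.toLp g) = ∫ x in cube xp xm N, f x * g x := by
  rw [L2.inner_def]
  refine integral_congr_ae ?_
  filter_upwards [hg.coeFn_toLp, (memLp_of_continuous xp xm (conjMap f).continuous).coeFn_toLp]
    with x h1 h2
  rw [contToLp, h1, h2, RCLike.inner_apply]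
  change g x * starRingEnd ℂ (starRingEnd ℂ (f x)) = _
  rw [Complex.conj_conj, mul_comm]

theorem integrableOn_mul_memLp {xp xm : ℝ} {f : (Fin N → ℝ) → ℂ} (hf : Continuous f)
    {g : (Fin N → ℝ) → ℂ} (hg : MemLp g 2 (cubeMeasure xp xm N)) :
    IntegrableOn (fun x => f x * g x) (cube xp xm N) := by
  have := (memLp_of_continuous xp xm hf).integrable_mul hg
  exact this

theorem integral_cPlusFun (γ : ℝ) {xp xm : ℝ} (hJ : xp ≤ xm) (μ : ℂ) {f : (Fin N → ℝ) → ℂ}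
    (hf : Continuous f) {g : (Fin (N + 1) → ℝ) → ℂ} (hg : Continuous g) :
    ∫ x in cube xp xm N, f x * cPlusFun γ xp xm μ g x =
      γ * cis μ (xp + xm) * ∫ z in cube xp xm (N + 1), bMinusFun γ (-μ) f z * g z := by
  have hL : ∀ n (i : Fin n ↪ Fin N),
      IntegrableOn (fun x => f x * eCheckPlus xp xm μ i g x) (cube xp xm N) := fun n i =>
    integrableOn_mul_memLp hf ((eCheckPlus_isL2Bounded hJ μ i).memLp g (memLp_of_continuous _ _ hg))
  have hR : ∀ n (i : Fin n ↪ Fin N),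
      IntegrableOn (fun z => eHatMinus (-μ) i f z * g z) (cube xp xm (N + 1)) := fun n i =>
    ((continuous_eHatMinus (-μ) hf i).mul hg).continuousOn.integrableOn_compact (isCompact_cube _ _ _)
  simp only [cPlusFun, bMinusFun, Finset.sum_apply, Pi.smul_apply, smul_eq_mul, Finset.mul_sum,
    Finset.sum_mul, mul_assoc, mul_left_comm (f _)]
  rw [integral_finsetSum _ fun n _ => integrable_finsetSum _ fun i _ => (hL n i).const_mul _,
    integral_finsetSum _ fun n _ => integrable_finsetSum _ fun i _ => (hR n i).const_mul _,
    Finset.mul_sum, Finset.mul_sum]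
  refine Finset.sum_congr rfl fun n _ => ?_
  rw [integral_finsetSum _ fun i _ => (hL n i).const_mul _,
    integral_finsetSum _ fun i _ => (hR n i).const_mul _, Finset.mul_sum, Finset.mul_sum]
  refine Finset.sum_congr rfl fun i _ => ?_
  rw [integral_const_mul, integral_const_mul, integral_eCheckPlus hJ μ i hf hg]
  ring

theorem integral_cMinusFun (γ : ℝ) {xp xm : ℝ} (hJ : xp ≤ xm) (μ : ℂ) {f : (Fin N → ℝ) → ℂ}
    (hf : Continuous f) {g : (Fin (N + 1) → ℝ) → ℂ} (hg : Continuous g) :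
    ∫ x in cube xp xm N, f x * cMinusFun γ xp xm μ g x =
      γ * cis μ (xp + xm) * ∫ z in cube xp xm (N + 1), bPlusFun γ (-μ) f z * g z := by
  have hL : ∀ n (i : Fin n ↪ Fin N),
      IntegrableOn (fun x => f x * eCheckMinus xp xm μ i g x) (cube xp xm N) := fun n i =>
    integrableOn_mul_memLp hf
      ((eCheckMinus_isL2Bounded hJ μ i).memLp g (memLp_of_continuous _ _ hg))
  have hR : ∀ n (i : Fin n ↪ Fin N),
      IntegrableOn (fun z => eHatPlus (-μ) i f z * g z) (cube xp xm (N + 1)) := fun n i =>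
    ((continuous_eHatPlus (-μ) hf i).mul hg).continuousOn.integrableOn_compact (isCompact_cube _ _ _)
  simp only [cMinusFun, bPlusFun, Finset.sum_apply, Pi.smul_apply, smul_eq_mul, Finset.mul_sum,
    Finset.sum_mul, mul_assoc, mul_left_comm (f _)]
  rw [integral_finsetSum _ fun n _ => integrable_finsetSum _ fun i _ => (hL n i).const_mul _,
    integral_finsetSum _ fun n _ => integrable_finsetSum _ fun i _ => (hR n i).const_mul _,
    Finset.mul_sum, Finset.mul_sum]
  refine Finset.sum_congr rfl fun n _ => ?_
  rw [integral_finsetSum _ fun i _ => (hL n i).const_mul _,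
    integral_finsetSum _ fun i _ => (hR n i).const_mul _, Finset.mul_sum, Finset.mul_sum]
  refine Finset.sum_congr rfl fun i _ => ?_
  rw [integral_const_mul, integral_const_mul, integral_eCheckMinus hJ μ i hf hg]
  ring

/-- The test function remains continuous, so only the pointwise definition of `b⁻` on continuous
functions enters. Both sides are continuous in `G`, which density extends to the whole sector. -/
theorem inner_cPlus (γ : ℝ) {xp xm : ℝ} (hJ : xp < xm) (μ : ℂ) (f : C(Fin N → ℝ, ℂ))
    (G : Sector xp xm (N + 1)) :
    inner ℂ (contToLp xp xm (conjMap f)) (cPlus γ hJ μ G) = γ * cis μ (xp + xm) *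
      inner ℂ (contToLp xp xm
        (conjMap ⟨bMinusFun γ (-μ) f, continuous_bMinusFun γ (-μ) f.continuous⟩)) G := by
  have h : (fun G : Sector xp xm (N + 1) =>
      inner ℂ (contToLp xp xm (conjMap f)) (cPlus γ hJ μ G)) = fun G => γ * cis μ (xp + xm) *
      inner ℂ (contToLp xp xm
        (conjMap ⟨bMinusFun γ (-μ) f, continuous_bMinusFun γ (-μ) f.continuous⟩)) G := by
    refine Continuous.ext_on (dense_contToLp xp xm (N + 1)) (by fun_prop) (by fun_prop) ?_
    rintro _ ⟨g, rfl⟩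
    simp only
    rw [cPlus, show contToLp xp xm g = (memLp_of_continuous xp xm g.continuous).toLp g from rfl,
      liftL2_toLp, inner_conj_toLp, inner_conj_toLp]
    exact integral_cPlusFun γ hJ.le μ f.continuous g.continuous
  exact congrFun h G

theorem inner_cMinus (γ : ℝ) {xp xm : ℝ} (hJ : xp < xm) (μ : ℂ) (f : C(Fin N → ℝ, ℂ))
    (G : Sector xp xm (N + 1)) :
    inner ℂ (contToLp xp xm (conjMap f)) (cMinus γ hJ μ G) = γ * cis μ (xp + xm) *
      inner ℂ (contToLp xp xm
        (conjMap ⟨bPlusFun γ (-μ) f, continuous_bPlusFun γ (-μ) f.continuous⟩)) G := by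
  have h : (fun G : Sector xp xm (N + 1) =>
      inner ℂ (contToLp xp xm (conjMap f)) (cMinus γ hJ μ G)) = fun G => γ * cis μ (xp + xm) *
      inner ℂ (contToLp xp xm
        (conjMap ⟨bPlusFun γ (-μ) f, continuous_bPlusFun γ (-μ) f.continuous⟩)) G := by
    refine Continuous.ext_on (dense_contToLp xp xm (N + 1)) (by fun_prop) (by fun_prop) ?_
    rintro _ ⟨g, rfl⟩
    simp only
    rw [cMinus, show contToLp xp xm g = (memLp_of_continuous xp xm g.continuous).toLp g from rfl,
      liftL2_toLp, inner_conj_toLp, inner_conj_toLp]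
    exact integral_cMinusFun γ hJ.le μ f.continuous g.continuous
  exact congrFun h G

/-- Against a continuous test function, the two orders of annihilation become the two orders of
creation with wavenumbers `-ν` and `-μ`, with equal scalar factors. Continuous functions are dense,
so the difference is orthogonal to itself. -/
theorem cPlus_cMinus_comm (γ : ℝ) {xp xm : ℝ} (hJ : xp < xm) (μ ν : ℂ)
    (G : Sector xp xm (N + 2)) :
    cPlus γ hJ μ (cMinus γ hJ ν G) = cMinus γ hJ ν (cPlus γ hJ μ G) := by
  have h : ∀ f : C(Fin N → ℝ, ℂ), inner ℂ (contToLp xp xm f) (cPlus γ hJ μ (cMinus γ hJ ν G)) =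
      inner ℂ (contToLp xp xm f) (cMinus γ hJ ν (cPlus γ hJ μ G)) := by
    intro f
    rw [← conjMap_conjMap f, inner_cPlus, inner_cMinus, inner_cMinus, inner_cPlus]
    have hcomm := bPlusFun_bMinusFun_comm γ (-ν) (-μ) (conjMap f).continuous
    simp only [ContinuousMap.coe_mk, hcomm]
    ring
  rw [← sub_eq_zero, ← inner_self_eq_zero (𝕜 := ℂ)]
  set H := cPlus γ hJ μ (cMinus γ hJ ν G) - cMinus γ hJ ν (cPlus γ hJ μ G) with hH
  have h0 : (fun F : Sector xp xm N => inner ℂ F H) = fun _ => (0 : ℂ) := by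
    refine Continuous.ext_on (dense_contToLp xp xm N) (by fun_prop) (by fun_prop) ?_
    rintro _ ⟨f, rfl⟩
    simp only
    rw [hH, inner_sub_right, h, sub_self]
  exact congrFun h0 H

end

end QNLS

theorem mainTheorem8 (γ xp xm : ℝ) (hJ : xp < xm) (N : ℕ) (μ ν : ℂ) :
    (∀ f ∈ QNLS.zBar γ xp xm N,
      QNLS.bPlus γ xp xm μ f ∈ QNLS.zBar γ xp xm (N + 1) ∧
      QNLS.bMinus γ xp xm ν f ∈ QNLS.zBar γ xp xm (N + 1) ∧
      QNLS.bPlus γ xp xm μ (QNLS.bMinus γ xp xm ν f) ∈ QNLS.zBar γ xp xm (N + 2) ∧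
      QNLS.bMinus γ xp xm ν (QNLS.bPlus γ xp xm μ f) ∈ QNLS.zBar γ xp xm (N + 2) ∧
      QNLS.bPlus γ xp xm μ (QNLS.bMinus γ xp xm ν f) -
        QNLS.bMinus γ xp xm ν (QNLS.bPlus γ xp xm μ f) = 0) ∧
    (∀ f ∈ QNLS.zBar γ xp xm (N + 2),
      QNLS.cPlus γ hJ μ f ∈ QNLS.zBar γ xp xm (N + 1) ∧
      QNLS.cMinus γ hJ ν f ∈ QNLS.zBar γ xp xm (N + 1) ∧
      QNLS.cPlus γ hJ μ (QNLS.cMinus γ hJ ν f) ∈ QNLS.zBar γ xp xm N ∧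
      QNLS.cMinus γ hJ ν (QNLS.cPlus γ hJ μ f) ∈ QNLS.zBar γ xp xm N ∧
      QNLS.cPlus γ hJ μ (QNLS.cMinus γ hJ ν f) -
        QNLS.cMinus γ hJ ν (QNLS.cPlus γ hJ μ f) = 0) := by
  -- Density makes every membership trivial; only the two commutators are left.
  simp only [QNLS.zBar_eq_top, Submodule.mem_top, true_and, sub_eq_zero, forall_true_left]
  exact ⟨QNLS.bPlus_bMinus_comm γ xp xm μ ν, QNLS.cPlus_cMinus_comm γ hJ μ ν⟩
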